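/- **Notation.** If $t>0$ is not the ordinate of a zero of $\zeta$, let $S(t)=\frac1\pi\arg\zeta(\frac12+it)$, the argument being obtained by continuous variation along the straight line segments joining $2$, $2+it$ and $\frac12+it$, with $\arg\zeta(2)=0$; if $t>0$ is the ordinate of a zero, let $S(t)=\frac12\lim_{\varepsilon\to0}\{S(t+\varepsilon)+S(t-\varepsilon)\}$. Put $S_0=S$ and, for $n\ge1$ and $t>0$, $$S_n(t)=\int_0^tS_{n-1}(\tau)\,d\tau+\delta_n,$$ where, for $k\ge1$, $$\delta_{2k-1}=\frac{(-1)^{k-1}}{\pi}\int_{1/2}^\infty\int_{\sigma_{2k-2}}^\infty\cdots\int_{\sigma_1}^\infty\log|\zeta(\sigma_0)|\,d\sigma_0\,d\sigma_1\cdots d\sigma_{2k-2},\qquad \delta_{2k}=\frac{(-1)^{k-1}}{(2k)!\,2^{2k}}.$$ For integers $m\ge0$ and $x\in\mathbb{R}$ let $$f_{2m}(x)=(-1)^mx^{2m}\arctan\Big(\frac1x\Big)+\sum_{k=0}^{m-1}\frac{(-1)^{m-k+1}}{2k+1}x^{2m-2k-1}-\frac{x}{(2m+1)(1+x^2)},$$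 $$f_{2m+1}(x)=\frac1{2m+1}\left[(-1)^{m+1}x^{2m+1}\arctan\Big(\frac1x\Big)+\sum_{k=0}^{m}\frac{(-1)^{m-k}}{2k+1}x^{2m-2k}\right],$$ with the value at $x=0$ given by continuity (by $f_0(0)=0$ when the index is $0$). **Lemma (Representation lemma).** Assume the Riemann hypothesis. Let $m\ge0$ be an integer. In the sums below, $\gamma$ runs over the ordinates of the non-trivial zeros $\rho=\frac12+i\gamma$ of $\zeta(s)$, counted with multiplicity; these sums converge absolutely, and the constants implied by $O(1)$ depend only on $m$. (i) For all $t\ge2$ (with $t$ not the ordinate of a zero of $\zeta$ if $m=0$), $$S_{2m}(t)=\frac{(-1)^m}{\pi(2m)!}\sum_\gamma f_{2m}(t-\gamma)+O(1).$$ (ii) For all $t\ge2$, $$S_{2m+1}(t)=\frac{(-1)^m}{2\pi(2m+2)!}\log t-\frac{(-1)^m}{\pi(2m)!}\sum_\gamma f_{2m+1}(t-\gamma)+O(1).$$ -/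

import Mathlib

open scoped Real Nat Topology

noncomputable section

namespace ZetaMoments

/-- `θ` is a continuous choice of the argument of `f` along the segment from `a` to `b`,
parametrized by `u ∈ [0, 1]`. -/
def IsArgAlong (f : ℂ → ℂ) (a b : ℂ) (θ : ℝ → ℝ) : Prop :=
  ContinuousOn θ (Set.Icc 0 1) ∧
    ∀ u ∈ Set.Icc (0 : ℝ) 1,
      f (a + u * (b - a)) = ‖f (a + u * (b - a))‖ * Complex.exp (θ u * Complex.I)

open Classical in
/-- The variation of the argument of `f` along the segment from `a` to `b`: the total increment
of any continuous choice of the argument (`argVariation_eq` below: the choice is irrelevant when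
`f` does not vanish on the segment). -/
def argVariation (f : ℂ → ℂ) (a b : ℂ) : ℝ :=
  if h : ∃ θ : ℝ → ℝ, IsArgAlong f a b θ then h.choose 1 - h.choose 0 else 0

/-- `t` is the ordinate of a zero of `ζ`. -/
def IsZetaOrdinate (t : ℝ) : Prop := ∃ ρ : ℂ, riemannZeta ρ = 0 ∧ ρ.im = t

/-- `(1/π) arg ζ(1/2 + i t)`, the argument being obtained by continuous variation along the
segments joining `2`, `2 + i t`, `1/2 + i t`, with `arg ζ(2) = 0`. -/
def argZeta (t : ℝ) : ℝ :=
  (1 / π) * (argVariation riemannZeta 2 (2 + t * Complex.I) +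
    argVariation riemannZeta (2 + t * Complex.I) (1 / 2 + t * Complex.I))

open Classical in
/-- The function `S(t)`. -/
def S (t : ℝ) : ℝ :=
  if IsZetaOrdinate t then
    (1 / 2) * Filter.limUnder (𝓝[≠] (0 : ℝ)) (fun ε => argZeta (t + ε) + argZeta (t - ε))
  else argZeta t

/-- `logZetaIter j` is the `j`-fold iterate of `g ↦ ∫_σ^∞ g` applied to `log |ζ(σ)|`. -/
def logZetaIter : ℕ → ℝ → ℝ
  | 0, σ => Real.log ‖riemannZeta (σ : ℂ)‖
  | j + 1, σ => ∫ x in Set.Ioi σ, logZetaIter j x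

/-- The constants `δ_n`, `n ≥ 1` (the value at `0` is not used):
`δ_{2k} = (-1)^(k-1) / ((2k)! 2^(2k))`, and `δ_{2k-1}` is `(-1)^(k-1) / π` times the
`(2k-1)`-fold iterated integral of `log |ζ|` from `1/2`. -/
def delta (n : ℕ) : ℝ :=
  if Even n then (-1) ^ (n / 2 - 1) / ((n)! * 2 ^ n)
  else (-1) ^ (n / 2) / π * logZetaIter n (1 / 2)

/-- The moments: `S_0 = S` and `S_n(t) = ∫_0^t S_{n-1}(τ) dτ + δ_n`. -/
def SMoment : ℕ → ℝ → ℝ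
  | 0, t => S t
  | n + 1, t => (∫ τ in (0 : ℝ)..t, SMoment n τ) + delta (n + 1)

/-- The function `f_{2m}`. -/
def fEven (m : ℕ) (x : ℝ) : ℝ :=
  (-1) ^ m * x ^ (2 * m) * Real.arctan (1 / x)
    + ∑ k ∈ Finset.range m, (-1) ^ (m - k + 1) / (2 * k + 1) * x ^ (2 * m - 2 * k - 1)
    - x / ((2 * m + 1) * (1 + x ^ 2))

/-- The function `f_{2m+1}`. -/
def fOdd (m : ℕ) (x : ℝ) : ℝ :=
  1 / (2 * m + 1) * ((-1) ^ (m + 1) * x ^ (2 * m + 1) * Real.arctan (1 / x)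
    + ∑ k ∈ Finset.range (m + 1), (-1) ^ (m - k) / (2 * k + 1) * x ^ (2 * m - 2 * k))

/-- The non-trivial zeros of `ζ`. -/
def nontrivialZeros : Set ℂ := {ρ | riemannZeta ρ = 0 ∧ 0 < ρ.re ∧ ρ.re < 1}

/-- The term of the zero `ρ = β + i γ` in `∑_γ g(t - γ)`, zeros being counted with
multiplicity. -/
def zeroTerm (g : ℝ → ℝ) (t : ℝ) (ρ : nontrivialZeros) : ℝ :=
  (analyticOrderNatAt riemannZeta (ρ : ℂ) : ℝ) * g (t - (ρ : ℂ).im)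

theorem argVariation_eq {f : ℂ → ℂ} {a b : ℂ} {θ : ℝ → ℝ} (h : IsArgAlong f a b θ)
    (hf : ∀ u ∈ Set.Icc (0 : ℝ) 1, f (a + u * (b - a)) ≠ 0) :
    argVariation f a b = θ 1 - θ 0 := by
  have hex : ∃ θ : ℝ → ℝ, IsArgAlong f a b θ := ⟨θ, h⟩
  rw [argVariation, dif_pos hex]
  have h' := hex.choose_spec
  set η := hex.choose
  have hc : ContinuousOn (fun u => (η u - θ u) / (2 * π)) (Set.Icc (0 : ℝ) 1) :=
    (h'.1.sub h.1).div_const _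
  have hm : Set.MapsTo (fun u => (η u - θ u) / (2 * π)) (Set.Icc (0 : ℝ) 1)
      (Set.range ((↑) : ℤ → ℝ)) := by
    intro u hu
    have h0 : (‖f (a + u * (b - a))‖ : ℂ) ≠ 0 := by
      exact_mod_cast norm_ne_zero_iff.mpr (hf u hu)
    have e := (h'.2 u hu).symm.trans (h.2 u hu)
    obtain ⟨n, hn⟩ := Complex.exp_eq_exp_iff_exists_int.mp (mul_left_cancel₀ h0 e)
    refine ⟨n, ?_⟩
    have e2 : (η u : ℂ) = θ u + n * (2 * π) := by
      apply mul_right_cancel₀ Complex.I_ne_zero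
      rw [hn]; ring
    have e3 : η u = θ u + n * (2 * π) := by exact_mod_cast e2
    simp only [e3]
    field_simp
    ring
  have hT : IsDiscrete (Set.range ((↑) : ℤ → ℝ)) :=
    ⟨Int.isClosedEmbedding_coe_real.isEmbedding.toHomeomorph.symm.isEmbedding.discreteTopology⟩
  have := isPreconnected_Icc.constant_of_mapsTo hT hc hm
    (Set.left_mem_Icc.mpr zero_le_one) (Set.right_mem_Icc.mpr zero_le_one)
  have hpi := Real.pi_pos.ne'
  field_simp at this
  linarith

end ZetaMoments

end

noncomputable section

namespace ZetaMoments

open Filter Metric Set MeasureTheory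

/-! Write s = 1/2 + u + it. Cauchy's theorem to the right of the critical line turns integration in
t into integration in u. Induction on n then gives Littlewood's formula π S_n(t) = Im(i^n ∫_0^∞
u^(n-1)/(n-1)! log ζ(s) du) for n ≥ 1 (`pi_mul_SMoment_succ`). The constants δ_n are exactly what
this formula requires at t = 0 (`delta_eq`): the odd ones come from log |ζ| on the real axis, the
even ones from the argument -π of ζ on (1/2, 1).

For u ≥ 1 the function log ζ(s) decays exponentially, so that range contributes O(1). Integration by
parts on [0, 1] leaves π S_n(t) = -Im(i^n ∫_0^1 u^n/n! (ζ'/ζ)(s) du) + O(1)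
(`exists_SMoment_bound`). For n = 0 this is the variation of the argument along the horizontal
segment (`pi_mul_S_eq`).

Now ζ'/ζ is ξ'/ξ minus an archimedean part, whose real part is (log t)/2 + O(1) and whose imaginary
part is bounded (`exists_archPart_bound`). Put x = t - γ. Under RH, Re ξ'/ξ = Σ u/(u²+x²)
(`hasSum_re_xiL`). The imaginary part is expanded only as a difference between the abscissas u and
1, namely -Σ (x/(u²+x²) - x/(1+x²)) (`hasSum_im_xiL`), and the value at u = 1 is bounded
(`exists_im_xiL_le`). The factor i^n selects the imaginary part for n = 2m and the real part for n =
2m+1. Integrating the summands against u^n yields f_{2m} and (2m+1) f_{2m+1} (`integral_fEven`,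
`integral_fOdd`), and the term (log t)/2 yields (log t)/(2(2m+2)!).

The partial fractions of ξ'/ξ come from a general result on entire functions of growth
exp(A(1+|z|)^(3/2)) (`hasSum_logDeriv_sub`). Working with differences of two values removes the
unknown constant of the Hadamard product. -/

/-! ### Entire functions of order below two: zeros and logarithmic derivative -/

theorem analyticOrderAt_ne_top_of_entire {f : ℂ → ℂ} (hf : Differentiable ℂ f) (h0 : f 0 ≠ 0)
    (z : ℂ) : analyticOrderAt f z ≠ ⊤ := by
  intro h
  have han : AnalyticOnNhd ℂ f univ := fun w _ => hf.analyticAt w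
  exact h0 (han.eqOn_zero_of_preconnected_of_eventuallyEq_zero isPreconnected_univ (mem_univ z)
    (analyticOrderAt_eq_top.mp h) (mem_univ 0))

theorem exists_eq_pow_mul_of_differentiable {f : ℂ → ℂ} (hf : Differentiable ℂ f) {ρ : ℂ}
    (h : analyticOrderAt f ρ ≠ ⊤) :
    ∃ g : ℂ → ℂ, Differentiable ℂ g ∧ g ρ ≠ 0 ∧
      ∀ z, f z = (z - ρ) ^ (analyticOrderNatAt f ρ) * g z := by
  obtain ⟨g₀, hg₀, hne, he⟩ := (hf.analyticAt ρ).analyticOrderAt_ne_top.mp h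
  set n := analyticOrderNatAt f ρ
  let g : ℂ → ℂ := fun z => if z = ρ then g₀ ρ else f z / (z - ρ) ^ n
  have hgρ : g ρ = g₀ ρ := by simp [g]
  have hg1 : ∀ z, z ≠ ρ → g z = f z / (z - ρ) ^ n := fun z hz => by simp [g, hz]
  have hev : g =ᶠ[𝓝 ρ] g₀ := by
    filter_upwards [he] with z hz
    by_cases hzρ : z = ρ
    · rw [hzρ, hgρ]
    · rw [hg1 z hzρ, hz, smul_eq_mul, mul_div_cancel_left₀]
      exact pow_ne_zero _ (sub_ne_zero.mpr hzρ)
  refine ⟨g, fun z => ?_, by rwa [hgρ], fun z => ?_⟩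
  · by_cases hzρ : z = ρ
    · rw [hzρ]
      exact hg₀.differentiableAt.congr_of_eventuallyEq hev
    · have : g =ᶠ[𝓝 z] fun z => f z / (z - ρ) ^ n := by
        filter_upwards [isOpen_ne.mem_nhds hzρ] with w hw using hg1 w hw
      refine DifferentiableAt.congr_of_eventuallyEq ?_ this
      exact (hf z).div (by fun_prop) (pow_ne_zero _ (sub_ne_zero.mpr hzρ))
  · by_cases hzρ : z = ρ
    · have := he.self_of_nhds
      rw [hzρ, this, hgρ]; rfl
    · rw [hg1 z hzρ, mul_div_cancel₀]
      exact pow_ne_zero _ (sub_ne_zero.mpr hzρ)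

/-- The product of the factors `1 - z / ρ` over a finite set, with exponents the orders of `f`. -/
def zeroProd (f : ℂ → ℂ) (T : Finset ℂ) (z : ℂ) : ℂ :=
  ∏ ρ ∈ T, (1 - z / ρ) ^ analyticOrderNatAt f ρ

/-- Induction on the finite set: the factors already split off do not vanish at the next zero, so
its order for the quotient is still its order for `f`. -/
theorem exists_eq_zeroProd_mul {f : ℂ → ℂ} (hf : Differentiable ℂ f) (h0 : f 0 ≠ 0)
    (T : Finset ℂ) (hT : ∀ ρ ∈ T, ρ ≠ 0) :
    ∃ g : ℂ → ℂ, Differentiable ℂ g ∧ (∀ ρ ∈ T, g ρ ≠ 0) ∧ ∀ z, f z = zeroProd f T z * g z := by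
  classical
  induction T using Finset.induction_on with
  | empty => exact ⟨f, hf, by simp, by simp [zeroProd]⟩
  | insert ρ T hρ ih =>
    obtain ⟨g, hg, hgT, hfg⟩ := ih fun x hx => hT x (Finset.mem_insert_of_mem hx)
    have hρ0 : ρ ≠ 0 := hT ρ (Finset.mem_insert_self _ _)
    have hPd : Differentiable ℂ (zeroProd f T) := by unfold zeroProd; fun_prop
    have hPρ : zeroProd f T ρ ≠ 0 := by
      refine Finset.prod_ne_zero_iff.mpr fun x hx => pow_ne_zero _ ?_
      have hx0 : x ≠ 0 := hT x (Finset.mem_insert_of_mem hx)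
      have : ρ ≠ x := fun h => hρ (h ▸ hx)
      rw [sub_ne_zero, ne_comm, ne_eq, div_eq_one_iff_eq hx0]
      exact this
    have hord : analyticOrderAt f ρ = analyticOrderAt g ρ := by
      have : f = zeroProd f T * g := funext hfg
      conv_lhs => rw [this]
      rw [analyticOrderAt_mul (hPd.analyticAt ρ) (hg.analyticAt ρ),
        (hPd.analyticAt ρ).analyticOrderAt_eq_zero.mpr hPρ, zero_add]
    have hordn : analyticOrderNatAt f ρ = analyticOrderNatAt g ρ := by
      simp only [analyticOrderNatAt, hord]
    obtain ⟨g', hg', hg'ρ, hgg'⟩ := exists_eq_pow_mul_of_differentiable hg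
      (hord ▸ analyticOrderAt_ne_top_of_entire hf h0 ρ)
    refine ⟨fun z => (-ρ) ^ analyticOrderNatAt f ρ * g' z, by fun_prop, fun x hx => ?_,
      fun z => ?_⟩
    · refine mul_ne_zero (pow_ne_zero _ (neg_ne_zero.mpr hρ0)) ?_
      rcases Finset.mem_insert.mp hx with h | h
      · rwa [h]
      · have := hgT x h
        rw [hgg' x] at this
        exact right_ne_zero_of_mul this
    · rw [hfg z, hgg' z, zeroProd, zeroProd, Finset.prod_insert hρ, ← hordn]
      have : (1 - z / ρ) ^ analyticOrderNatAt f ρ * (-ρ) ^ analyticOrderNatAt f ρ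
          = (z - ρ) ^ analyticOrderNatAt f ρ := by
        rw [← mul_pow]; congr 1; field_simp; ring
      rw [← this]; ring

theorem finite_zeros_closedBall {f : ℂ → ℂ} (hf : Differentiable ℂ f) (h0 : f 0 ≠ 0) (R : ℝ) :
    (closedBall (0 : ℂ) R ∩ f ⁻¹' {0}).Finite := by
  have han : AnalyticOnNhd ℂ f univ := fun w _ => hf.analyticAt w
  have h := han.preimage_zero_mem_codiscrete (x := 0) h0
  have h' := mem_codiscrete'.mp h
  have hcl : IsClosed (f ⁻¹' {0}) := isClosed_singleton.preimage hf.continuous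
  refine ((isCompact_closedBall (0 : ℂ) R).inter_right hcl).finite ?_
  have h2 : IsDiscrete (f ⁻¹' {0}) := by simpa using h'.2
  exact h2.mono Set.inter_subset_right

/-- The zeros of `f` in the closed disc of radius `R`. -/
def zerosIn (f : ℂ → ℂ) (R : ℝ) : Finset ℂ :=
  open Classical in
  if h : (closedBall (0 : ℂ) R ∩ f ⁻¹' {0}).Finite then h.toFinset else ∅

theorem mem_zerosIn {f : ℂ → ℂ} (hf : Differentiable ℂ f) (h0 : f 0 ≠ 0) {R : ℝ} {ρ : ℂ} :
    ρ ∈ zerosIn f R ↔ ‖ρ‖ ≤ R ∧ f ρ = 0 := by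
  simp [zerosIn, finite_zeros_closedBall hf h0 R]

/-- Removing the zeros in `|z| ≤ R` from an entire function of growth `exp (A (1+|z|)^(3/2))`. -/
theorem exists_zeroFree_factor {f : ℂ → ℂ} (hf : Differentiable ℂ f) (h0 : f 0 = 1) {A : ℝ}
    (hA : ∀ z, ‖f z‖ ≤ Real.exp (A * (1 + ‖z‖) ^ (3 / 2 : ℝ))) {R : ℝ} (hR : 1 ≤ R) :
    ∃ g : ℂ → ℂ, Differentiable ℂ g ∧ g 0 = 1 ∧ (∀ z, ‖z‖ ≤ R → g z ≠ 0) ∧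
      (∀ z, f z = zeroProd f (zerosIn f R) z * g z) ∧
      ∀ z, ‖z‖ ≤ 4 * R → 3 ^ (∑ ρ ∈ zerosIn f R, analyticOrderNatAt f ρ) * ‖g z‖
        ≤ Real.exp (A * (1 + 4 * R) ^ (3 / 2 : ℝ)) := by
  have h0' : f 0 ≠ 0 := by simp [h0]
  have hmem := @mem_zerosIn f hf h0' R
  have hT0 : ∀ ρ ∈ zerosIn f R, ρ ≠ 0 := by
    rintro ρ hρ rfl
    exact h0' (hmem.mp hρ).2
  obtain ⟨g, hg, hgT, hfg⟩ := exists_eq_zeroProd_mul hf h0' (zerosIn f R) hT0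
  refine ⟨g, hg, ?_, fun z hz hgz => ?_, hfg, ?_⟩
  · have := hfg 0
    simpa [zeroProd, h0] using this.symm
  · have hfz : f z = 0 := by rw [hfg z, hgz, mul_zero]
    exact hgT z (hmem.mpr ⟨hz, hfz⟩) hgz
  · have hsph : ∀ z ∈ sphere (0 : ℂ) (4 * R),
        ‖g z‖ ≤ Real.exp (A * (1 + 4 * R) ^ (3 / 2 : ℝ))
          / 3 ^ (∑ ρ ∈ zerosIn f R, analyticOrderNatAt f ρ) := by
      intro z hz
      have hz' : ‖z‖ = 4 * R := by simpa using hz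
      rw [le_div_iff₀ (by positivity), mul_comm]
      -- On |z| = 4R a zero with |ρ| ≤ R has |z/ρ| ≥ 4, so every factor has modulus at least 4 - 1 =
      -- 3. The maximum principle carries the resulting bound for `g` inside.
      have h1 : (3 : ℝ) ^ (∑ ρ ∈ zerosIn f R, analyticOrderNatAt f ρ)
          ≤ ‖zeroProd f (zerosIn f R) z‖ := by
        rw [← Finset.prod_pow_eq_pow_sum, zeroProd, norm_prod]
        refine Finset.prod_le_prod (fun _ _ => by positivity) fun ρ hρ => ?_
        rw [norm_pow]
        refine pow_le_pow_left₀ (by norm_num) ?_ _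
        have hρ1 : 0 < ‖ρ‖ := norm_pos_iff.mpr (hT0 ρ hρ)
        have h2 : 4 ≤ ‖z / ρ‖ := by
          rw [norm_div, hz', le_div_iff₀ hρ1]
          have := (hmem.mp hρ).1
          linarith
        have h3 := norm_sub_norm_le (z / ρ) 1
        rw [norm_one, norm_sub_rev] at h3
        linarith
      calc _ ≤ ‖zeroProd f (zerosIn f R) z‖ * ‖g z‖ := by gcongr
        _ = ‖f z‖ := by rw [hfg z, norm_mul]
        _ ≤ _ := by rw [← hz']; exact hA z
    intro z hz
    have := Complex.norm_le_of_forall_mem_frontier_norm_le (U := ball 0 (4 * R)) isBounded_ball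
      hg.diffContOnCl (fun w hw => hsph w (frontier_ball_subset_sphere hw)) (z := z)
      (by rw [closure_ball _ (by positivity)]; simpa using hz)
    rwa [le_div_iff₀ (by positivity), mul_comm] at this

/-- A Jensen-type count: the bound for 3^N |g| is read at 0, where g = 1, and e ≤ 3. -/
theorem sum_order_zerosIn_le {f : ℂ → ℂ} (hf : Differentiable ℂ f) (h0 : f 0 = 1) {A : ℝ}
    (hA : ∀ z, ‖f z‖ ≤ Real.exp (A * (1 + ‖z‖) ^ (3 / 2 : ℝ))) {R : ℝ} (hR : 1 ≤ R) :
    (∑ ρ ∈ zerosIn f R, analyticOrderNatAt f ρ : ℝ) ≤ A * (1 + 4 * R) ^ (3 / 2 : ℝ) := by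
  obtain ⟨g, -, hg0, -, -, hle⟩ := exists_zeroFree_factor hf h0 hA hR
  have h := hle 0 (by simp; linarith)
  rw [hg0, norm_one, mul_one] at h
  have h2 : Real.exp 1 ≤ 3 := by linarith [Real.exp_one_lt_d9]
  rw [← Nat.cast_sum, ← Real.exp_le_exp]
  refine le_trans ?_ h
  calc Real.exp ((∑ ρ ∈ zerosIn f R, analyticOrderNatAt f ρ : ℕ) : ℝ)
      = Real.exp 1 ^ (∑ ρ ∈ zerosIn f R, analyticOrderNatAt f ρ) := by
        rw [← Real.exp_nat_mul, mul_one]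
    _ ≤ _ := pow_le_pow_left₀ (by positivity) h2 _

/-- The logarithmic derivative of the zero-free factor varies little near the origin. -/
theorem norm_logDeriv_sub_le {g : ℂ → ℂ} (hg : Differentiable ℂ g) (hg0 : g 0 = 1) {R M : ℝ}
    (hR : 0 < R) (hM : 0 < M) (hne : ∀ z, ‖z‖ ≤ R → g z ≠ 0)
    (hb : ∀ z, ‖z‖ ≤ R → ‖g z‖ ≤ Real.exp M) {z w : ℂ} (hz : ‖z‖ ≤ R / 8) (hw : ‖w‖ ≤ R / 8) :
    ‖deriv g z / g z - deriv g w / g w‖ ≤ 64 * M / R ^ 2 * ‖z - w‖ := by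
  have hdg : Differentiable ℂ (deriv g) := fun z =>
    (hg.analyticAt z).deriv.differentiableAt
  have hq : DifferentiableOn ℂ (fun z => deriv g z / g z) (ball 0 R) := fun z hz =>
    ((hdg z).div (hg z) (hne z (by simpa using (mem_ball.mp hz).le))).differentiableWithinAt
  obtain ⟨h, hh0, hh⟩ := hq.isExactOn_ball.with_val_at 0 0
  have hhd : DifferentiableOn ℂ h (ball 0 R) := fun z hz =>
    (hh z hz).differentiableAt.differentiableWithinAt
  -- The product g exp(-h) has derivative zero and value 1 at the origin, so `h` is a logarithm of
  -- `g` on the disc.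
  have hexp : ∀ z ∈ ball (0 : ℂ) R, Complex.exp (h z) = g z := by
    have hd : ∀ z ∈ ball (0 : ℂ) R, HasDerivAt (fun z => g z * Complex.exp (-h z)) 0 z := by
      intro z hz
      have hgz : g z ≠ 0 := hne z (by simpa using (mem_ball.mp hz).le)
      convert! (hg z).hasDerivAt.mul (hh z hz).neg.cexp using 1
      field_simp
      ring
    intro z hz
    have hc := (convex_ball (0 : ℂ) R).is_const_of_fderivWithin_eq_zero (𝕜 := ℂ)
      (f := fun z => g z * Complex.exp (-h z))
      (fun z hz => (hd z hz).differentiableAt.differentiableWithinAt)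
      (fun z hz => by
        rw [fderivWithin_of_isOpen isOpen_ball hz]
        ext; simp [(hd z hz).deriv]) (mem_ball_self hR) hz
    simp only [hh0, hg0, neg_zero, Complex.exp_zero, mul_one] at hc
    rw [Complex.exp_neg, eq_comm, ← div_eq_mul_inv, div_eq_one_iff_eq (Complex.exp_ne_zero _)] at hc
    exact hc.symm
  have hre : MapsTo h (ball 0 R) {z | z.re ≤ M} := by
    intro z hz
    have h1 := hb z (by simpa using (mem_ball.mp hz).le)
    rw [← hexp z hz, Complex.norm_exp, Real.exp_le_exp] at h1
    exact h1
  -- Borel–Carathéodory turns Re h ≤ M into |h| ≤ 2M on the half disc. Cauchy estimates on circles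
  -- of radius R/4 and R/8 then give 8M/R for h' and 64M/R² for h''.
  have hbd : ∀ z, ‖z‖ ≤ R / 2 → ‖h z‖ ≤ 2 * M := by
    intro z hz
    have hzR : ‖z‖ < R := by linarith
    refine (Complex.borelCaratheodory_zero hM hhd hre hR (by simpa using hzR) hh0).trans ?_
    rw [div_le_iff₀ (by linarith)]
    nlinarith
  have hball : ∀ c : ℂ, ∀ r, ‖c‖ + r < R → closedBall c r ⊆ ball 0 R := by
    intro c r hcr x hx
    have h1 : ‖x - c‖ ≤ r := by simpa [dist_eq_norm] using hx
    have h2 := norm_add_le (x - c) c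
    simp only [sub_add_cancel] at h2
    simp; linarith
  have hd1 : ∀ z, ‖z‖ ≤ R / 4 → ‖deriv h z‖ ≤ 8 * M / R := by
    intro z hz
    have hs := hball z (R / 4) (by linarith)
    have := Complex.norm_deriv_le_of_forall_mem_sphere_norm_le (c := z) (R := R / 4) (C := 2 * M)
      (by positivity) ((hhd.mono hs).diffContOnCl_ball subset_rfl) (fun x hx => by
        apply hbd
        have h1 : ‖x - z‖ = R / 4 := by simpa [dist_eq_norm] using hx
        have h2 := norm_add_le (x - z) z
        simp only [sub_add_cancel] at h2
        linarith)
    refine this.trans (le_of_eq ?_)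
    field_simp; ring
  have hdd : DifferentiableOn ℂ (deriv h) (ball 0 R) := hhd.deriv isOpen_ball
  have hd2 : ∀ z, ‖z‖ ≤ R / 8 → ‖deriv (deriv h) z‖ ≤ 64 * M / R ^ 2 := by
    intro z hz
    have hs := hball z (R / 8) (by linarith)
    have := Complex.norm_deriv_le_of_forall_mem_sphere_norm_le (c := z) (R := R / 8)
      (C := 8 * M / R)
      (by positivity) ((hdd.mono hs).diffContOnCl_ball subset_rfl) (fun x hx => by
        apply hd1
        have h1 : ‖x - z‖ = R / 8 := by simpa [dist_eq_norm] using hx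
        have h2 := norm_add_le (x - z) z
        simp only [sub_add_cancel] at h2
        linarith)
    refine this.trans (le_of_eq ?_)
    field_simp; ring
  have hsub : closedBall (0 : ℂ) (R / 8) ⊆ ball 0 R := hball 0 (R / 8) (by simp; linarith)
  have hmv := (convex_closedBall (0 : ℂ) (R / 8)).norm_image_sub_le_of_norm_deriv_le
    (f := deriv h) (C := 64 * M / R ^ 2)
    (fun x hx => (hdd x (hsub hx)).differentiableAt (isOpen_ball.mem_nhds (hsub hx)))
    (fun x hx => hd2 x (by simpa using hx)) (x := w) (y := z) (by simpa using hw) (by simpa using hz)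
  have e : ∀ x, ‖x‖ ≤ R / 8 → deriv h x = deriv g x / g x := fun x hx =>
    (hh x (hsub (by simpa using hx))).deriv
  rwa [e z hz, e w hw] at hmv

/-- A dyadic majorant, which reduces a sum over zeros to zero counts in the discs of radius 2^k. The
first k with r ≤ 2^k already suffices, because then 2^(k-1) < r or k = 0. -/
theorem one_div_one_add_sq_le_tsum {r : ℝ} (hr : 0 ≤ r) :
    1 / (1 + r) ^ 2 ≤ ∑' k : ℕ, if r ≤ 2 ^ k then 4 * (1 / 4 : ℝ) ^ k else 0 := by
  have hs : Summable fun k : ℕ => if r ≤ (2 : ℝ) ^ k then 4 * (1 / 4 : ℝ) ^ k else 0 := by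
    refine Summable.of_nonneg_of_le (fun k => by split_ifs <;> positivity) (fun k => ?_)
      ((summable_geometric_of_lt_one (r := (1 / 4 : ℝ)) (by norm_num) (by norm_num)).mul_left 4)
    split_ifs
    · exact le_rfl
    · positivity
  obtain ⟨n, hn⟩ := pow_unbounded_of_one_lt r (by norm_num : (1 : ℝ) < 2)
  have hex : ∃ n : ℕ, r ≤ (2 : ℝ) ^ n := ⟨n, hn.le⟩
  classical
  set k := Nat.find hex
  have hk : r ≤ (2 : ℝ) ^ k := Nat.find_spec hex
  refine le_trans ?_ (hs.le_tsum k fun j _ => by split_ifs <;> positivity)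
  rw [if_pos hk]
  rcases Nat.eq_zero_or_pos k with h0 | hpos
  · rw [h0, pow_zero, mul_one, div_le_iff₀ (by positivity)]
    nlinarith
  · have h1 : ¬ r ≤ (2 : ℝ) ^ (k - 1) := Nat.find_min hex (by omega)
    push Not at h1
    obtain ⟨j, hj⟩ : ∃ j, k = j + 1 := ⟨k - 1, by omega⟩
    rw [hj] at h1 ⊢
    simp only [add_tsub_cancel_right] at h1
    have h2 : (4 : ℝ) ^ j = (2 ^ j) ^ 2 := by rw [← pow_mul, mul_comm, pow_mul]; norm_num
    have hp : (0 : ℝ) < 2 ^ j := by positivity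
    have h3 : (2 : ℝ) ^ j ≤ 1 + r := by linarith
    have h4 : 4 * (1 / 4 : ℝ) ^ (j + 1) = 1 / (2 ^ j) ^ 2 := by
      rw [pow_succ (1 / 4 : ℝ), one_div_pow, h2]; ring
    rw [h4]
    gcongr

/-- The zeros of an entire function of growth `exp (A (1+|z|)^(3/2))` satisfy
`∑ m_ρ / (1 + |ρ|)^2 < ∞`. -/
theorem summable_order_div {f : ℂ → ℂ} (hf : Differentiable ℂ f) (h0 : f 0 = 1) {A : ℝ}
    (hA : ∀ z, ‖f z‖ ≤ Real.exp (A * (1 + ‖z‖) ^ (3 / 2 : ℝ))) {Z : Set ℂ}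
    (hZ : ∀ ρ, ρ ∈ Z ↔ f ρ = 0) :
    Summable fun ρ : Z => (analyticOrderNatAt f ρ : ℝ) / (1 + ‖(ρ : ℂ)‖) ^ 2 := by
  have h0' : f 0 ≠ 0 := by simp [h0]
  have hA0 : 0 ≤ A := by
    have := hA 0
    rw [h0, norm_one, ← Real.exp_zero, Real.exp_le_exp] at this
    simpa using this
  -- Up to a constant factor the terms are (2^(3/2)/4)^k; the exponent 3/2 being less than 2 is what
  -- gives convergence.
  have hg : Summable fun k : ℕ => 4 * (1 / 4 : ℝ) ^ k * (A * (5 * 2 ^ k) ^ (3 / 2 : ℝ)) := by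
    have h1 : (2 : ℝ) ^ (3 / 2 : ℝ) / 4 < 1 := by
      rw [div_lt_one (by norm_num)]
      calc (2 : ℝ) ^ (3 / 2 : ℝ) < 2 ^ (2 : ℝ) :=
            Real.rpow_lt_rpow_of_exponent_lt (by norm_num) (by norm_num)
        _ = 4 := by norm_num
    refine ((summable_geometric_of_lt_one (by positivity) h1).mul_left
      (4 * A * 5 ^ (3 / 2 : ℝ))).congr fun k => ?_
    rw [Real.mul_rpow (by norm_num) (by positivity), ← Real.rpow_natCast 2 k, ← Real.rpow_mul
      (by norm_num), mul_comm (k : ℝ), Real.rpow_mul (by norm_num), Real.rpow_natCast, div_pow,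
      one_div_pow]
    ring
  refine summable_of_sum_le (c := ∑' k : ℕ, 4 * (1 / 4 : ℝ) ^ k * (A * (5 * 2 ^ k) ^ (3 / 2 : ℝ)))
    (fun ρ => by positivity) fun T => ?_
  have hs : ∀ r : ℝ, Summable fun k : ℕ => if r ≤ (2 : ℝ) ^ k then 4 * (1 / 4 : ℝ) ^ k else 0 := by
    intro r
    refine Summable.of_nonneg_of_le (fun k => by split_ifs <;> positivity) (fun k => ?_)
      ((summable_geometric_of_lt_one (r := (1 / 4 : ℝ)) (by norm_num) (by norm_num)).mul_left 4)
    split_ifs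
    · exact le_rfl
    · positivity
  have hs' : ∀ ρ ∈ T, Summable fun k : ℕ => (analyticOrderNatAt f ρ : ℝ) *
      (if ‖(ρ : ℂ)‖ ≤ (2 : ℝ) ^ k then 4 * (1 / 4 : ℝ) ^ k else 0) :=
    fun ρ _ => (hs _).mul_left _
  calc ∑ ρ ∈ T, (analyticOrderNatAt f ρ : ℝ) / (1 + ‖(ρ : ℂ)‖) ^ 2
      ≤ ∑ ρ ∈ T, ∑' k : ℕ, (analyticOrderNatAt f ρ : ℝ) *
          (if ‖(ρ : ℂ)‖ ≤ (2 : ℝ) ^ k then 4 * (1 / 4 : ℝ) ^ k else 0) := by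
        refine Finset.sum_le_sum fun ρ _ => ?_
        rw [tsum_mul_left, div_eq_mul_one_div]
        gcongr
        exact one_div_one_add_sq_le_tsum (norm_nonneg _)
    _ = ∑' k : ℕ, ∑ ρ ∈ T, (analyticOrderNatAt f ρ : ℝ) *
          (if ‖(ρ : ℂ)‖ ≤ (2 : ℝ) ^ k then 4 * (1 / 4 : ℝ) ^ k else 0) :=
        (Summable.tsum_finsetSum hs').symm
    _ ≤ _ := by
        refine (summable_sum hs').tsum_le_tsum (fun k => ?_) hg
        have h1 : ∑ ρ ∈ T, (analyticOrderNatAt f ρ : ℝ) *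
          (if ‖(ρ : ℂ)‖ ≤ (2 : ℝ) ^ k then 4 * (1 / 4 : ℝ) ^ k else 0)
            = 4 * (1 / 4 : ℝ) ^ k * ∑ ρ ∈ T.filter (fun ρ : Z => ‖(ρ : ℂ)‖ ≤ (2 : ℝ) ^ k),
              (analyticOrderNatAt f ρ : ℝ) := by
          rw [Finset.sum_filter, Finset.mul_sum]
          refine Finset.sum_congr rfl fun ρ _ => ?_
          split_ifs <;> ring
        rw [h1]
        have hk1 : (1 : ℝ) ≤ 2 ^ k := one_le_pow₀ (by norm_num)
        gcongr
        calc ∑ ρ ∈ T.filter (fun ρ : Z => ‖(ρ : ℂ)‖ ≤ (2 : ℝ) ^ k), (analyticOrderNatAt f ρ : ℝ)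
            = ∑ ρ ∈ (T.filter (fun ρ : Z => ‖(ρ : ℂ)‖ ≤ (2 : ℝ) ^ k)).map
                (Function.Embedding.subtype _), (analyticOrderNatAt f ρ : ℝ) := by
              rw [Finset.sum_map]; rfl
          _ ≤ ∑ ρ ∈ zerosIn f (2 ^ k), (analyticOrderNatAt f ρ : ℝ) := by
              refine Finset.sum_le_sum_of_subset_of_nonneg (fun ρ hρ => ?_)
                fun _ _ _ => by positivity
              obtain ⟨x, hx, rfl⟩ := Finset.mem_map.mp hρ
              exact (mem_zerosIn hf h0').mpr ⟨(Finset.mem_filter.mp hx).2, (hZ x).mp x.2⟩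
          _ ≤ A * (1 + 4 * 2 ^ k) ^ (3 / 2 : ℝ) := sum_order_zerosIn_le hf h0 hA hk1
          _ ≤ A * (5 * 2 ^ k) ^ (3 / 2 : ℝ) := by
              gcongr
              linarith

/-- By continuity the zeros stay at a positive distance d from z, and |ρ| ≤ |z| + |z - ρ| covers the
distant ones; the constant combines both. -/
theorem exists_le_norm_sub_of_ne_zero {f : ℂ → ℂ} (hf : Continuous f) {z : ℂ} (hz : f z ≠ 0) :
    ∃ c > 0, ∀ ρ, f ρ = 0 → c * (1 + ‖ρ‖) ≤ ‖z - ρ‖ := by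
  obtain ⟨d, hd, hball⟩ := Metric.isOpen_iff.mp (isOpen_ne.preimage hf) z hz
  have hK : 0 < (1 + ‖z‖) / d + 1 := by positivity
  refine ⟨1 / ((1 + ‖z‖) / d + 1), by positivity, fun ρ hρ => ?_⟩
  have h1 : d ≤ ‖z - ρ‖ := by
    by_contra h
    push Not at h
    have : ρ ∈ ball z d := by rwa [mem_ball, dist_eq_norm, norm_sub_rev]
    exact hball this hρ
  have h2 : ‖ρ‖ ≤ ‖z‖ + ‖z - ρ‖ := by
    have := norm_sub_le z (z - ρ)
    simpa using this
  rw [one_div, inv_mul_le_iff₀ hK]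
  have h3 : 1 + ‖z‖ ≤ (1 + ‖z‖) / d * ‖z - ρ‖ := by
    rw [div_mul_eq_mul_div, le_div_iff₀ hd]
    gcongr
  linarith

theorem summable_order_mul_sub {f : ℂ → ℂ} (hf : Continuous f) {Z : Set ℂ}
    (hZ : ∀ ρ, ρ ∈ Z ↔ f ρ = 0)
    (hs : Summable fun ρ : Z => (analyticOrderNatAt f ρ : ℝ) / (1 + ‖(ρ : ℂ)‖) ^ 2)
    {z w : ℂ} (hz : f z ≠ 0) (hw : f w ≠ 0) :
    Summable fun ρ : Z => (analyticOrderNatAt f ρ : ℂ) * (1 / (z - ρ) - 1 / (w - ρ)) := by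
  obtain ⟨c, hc, hcz⟩ := exists_le_norm_sub_of_ne_zero hf hz
  obtain ⟨d, hd, hdw⟩ := exists_le_norm_sub_of_ne_zero hf hw
  refine Summable.of_norm_bounded (hs.mul_left (‖w - z‖ / (c * d))) fun ρ => ?_
  have h1 := hcz ρ ((hZ ρ).mp ρ.2)
  have h2 := hdw ρ ((hZ ρ).mp ρ.2)
  have hzρ : z - ρ ≠ 0 := norm_pos_iff.mp (lt_of_lt_of_le (by positivity) h1)
  have hwρ : w - ρ ≠ 0 := norm_pos_iff.mp (lt_of_lt_of_le (by positivity) h2)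
  have e : 1 / (z - ρ) - 1 / (w - ρ) = (w - z) / ((z - ρ) * (w - ρ)) := by
    field_simp; ring
  rw [e, norm_mul, norm_div, norm_mul, Complex.norm_natCast]
  calc (analyticOrderNatAt f ρ : ℝ) * (‖w - z‖ / (‖z - ρ‖ * ‖w - ρ‖))
      ≤ (analyticOrderNatAt f ρ : ℝ) * (‖w - z‖ / ((c * (1 + ‖(ρ : ℂ)‖)) * (d * (1 + ‖(ρ : ℂ)‖)))) := by
        gcongr
    _ = _ := by field_simp

/-- Partial fractions of the logarithmic derivative of an entire function of order less than `2`
(in difference form). -/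
theorem hasSum_logDeriv_sub {f : ℂ → ℂ} (hf : Differentiable ℂ f) (h0 : f 0 = 1) {A : ℝ}
    (hA : ∀ z, ‖f z‖ ≤ Real.exp (A * (1 + ‖z‖) ^ (3 / 2 : ℝ))) {Z : Set ℂ}
    (hZ : ∀ ρ, ρ ∈ Z ↔ f ρ = 0) {z w : ℂ} (hz : f z ≠ 0) (hw : f w ≠ 0) :
    HasSum (fun ρ : Z => (analyticOrderNatAt f ρ : ℂ) * (1 / (z - ρ) - 1 / (w - ρ)))
      (deriv f z / f z - deriv f w / f w) := by
  classical
  have h0' : f 0 ≠ 0 := by simp [h0]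
  have hmem : ∀ R ρ, ρ ∈ zerosIn f R ↔ ‖ρ‖ ≤ R ∧ f ρ = 0 := fun R ρ => mem_zerosIn hf h0'
  have hsum := summable_order_mul_sub hf.continuous hZ (summable_order_div hf h0 hA hZ) hz hw
  have hA0 : 0 ≤ A := by
    have := hA 0
    rw [h0, norm_one, ← Real.exp_zero, Real.exp_le_exp] at this
    simpa using this
  -- Summability is known, so the value of the sum may be found along the exhaustion by discs |ρ| ≤
  -- n.
  let T : ℕ → Finset Z := fun n => (zerosIn f n).subtype (· ∈ Z)
  have hTmono : Monotone T := by
    intro a b hab ρ hρ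
    simp only [T, Finset.mem_subtype, hmem] at hρ ⊢
    exact ⟨hρ.1.trans (by exact_mod_cast hab), hρ.2⟩
  have hTex : ∀ ρ : Z, ∃ n, ρ ∈ T n := by
    intro ρ
    obtain ⟨n, hn⟩ := exists_nat_ge ‖(ρ : ℂ)‖
    exact ⟨n, by simp only [T, Finset.mem_subtype, hmem]; exact ⟨hn, (hZ ρ).mp ρ.2⟩⟩
  have hlim := hsum.hasSum.comp (tendsto_atTop_finset_of_monotone hTmono hTex)
  have hlog : ∀ (n : ℕ) (g : ℂ → ℂ), Differentiable ℂ g →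
      (∀ z, f z = zeroProd f (zerosIn f n) z * g z) → ∀ x, f x ≠ 0 →
      deriv f x / f x = (∑ ρ ∈ zerosIn f n, (analyticOrderNatAt f ρ : ℂ) * (1 / (x - ρ)))
        + deriv g x / g x := by
    intro n g hg hfg x hx
    have hfun : f = zeroProd f (zerosIn f n) * g := funext hfg
    have hP : zeroProd f (zerosIn f n) x ≠ 0 := left_ne_zero_of_mul (hfg x ▸ hx)
    have hgx : g x ≠ 0 := right_ne_zero_of_mul (hfg x ▸ hx)
    have hPd : Differentiable ℂ (zeroProd f (zerosIn f n)) := by unfold zeroProd; fun_prop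
    have e : logDeriv f x = logDeriv (zeroProd f (zerosIn f n)) x + logDeriv g x := by
      conv_lhs => rw [hfun]
      exact logDeriv_mul x hP hgx (hPd x) (hg x)
    rw [← logDeriv_apply f, ← logDeriv_apply g, e]
    congr 1
    have hfac : ∀ ρ ∈ zerosIn f n, (1 - x / ρ) ^ analyticOrderNatAt f ρ ≠ 0 :=
      Finset.prod_ne_zero_iff.mp hP
    have hprod : zeroProd f (zerosIn f n)
        = fun z => ∏ ρ ∈ zerosIn f n, (1 - z / ρ) ^ analyticOrderNatAt f ρ := rfl
    rw [hprod]
    rw [logDeriv_prod (f := fun ρ z => (1 - z / ρ) ^ analyticOrderNatAt f ρ) hfac (fun ρ _ => by fun_prop)]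
    refine Finset.sum_congr rfl fun ρ hρ => ?_
    have hρ0 : ρ ≠ 0 := by
      rintro rfl
      exact h0' ((hmem _ _).mp hρ).2
    have hxρ : x - ρ ≠ 0 := by
      intro h
      rw [sub_eq_zero] at h
      exact hx (h ▸ ((hmem _ _).mp hρ).2)
    rw [logDeriv_fun_pow (by fun_prop), logDeriv_apply]
    congr 1
    have : deriv (fun z : ℂ => 1 - z / ρ) x = -(1 / ρ) := by
      simp
    rw [this]
    have h1 : 1 - x / ρ ≠ 0 := by
      rw [sub_ne_zero, ne_comm, ne_eq, div_eq_one_iff_eq hρ0]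
      exact sub_ne_zero.mp hxρ
    rw [div_eq_div_iff h1 hxρ]
    field_simp
    ring
  -- The remainder is the difference of g'/g at z and w for the zero-free factor g of radius n. It
  -- is O(n^(3/2)/n²), hence tends to 0.
  have hdiff : Tendsto (fun n : ℕ => (deriv f z / f z - deriv f w / f w) -
      ∑ ρ ∈ T n, (analyticOrderNatAt f ρ : ℂ) * (1 / (z - ρ) - 1 / (w - ρ))) atTop (𝓝 0) := by
    have hto : Tendsto (fun n : ℕ => 64 * ((A + 1) * (5 * (n : ℝ)) ^ (3 / 2 : ℝ)) / (n : ℝ) ^ 2 * ‖z - w‖)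
        atTop (𝓝 0) := by
      have h1 : Tendsto (fun n : ℕ => (n : ℝ) ^ (-(1 / 2) : ℝ)) atTop (𝓝 0) :=
        (tendsto_rpow_neg_atTop (by norm_num)).comp tendsto_natCast_atTop_atTop
      have h2 := h1.const_mul (64 * (A + 1) * 5 ^ (3 / 2 : ℝ) * ‖z - w‖)
      rw [mul_zero] at h2
      refine h2.congr' ?_
      filter_upwards [eventually_gt_atTop 0] with n hn
      have hn' : (0 : ℝ) < n := by exact_mod_cast hn
      rw [Real.mul_rpow (by norm_num) hn'.le, ← Real.rpow_natCast (n : ℝ) 2]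
      have : (n : ℝ) ^ (-(1 / 2) : ℝ) = (n : ℝ) ^ (3 / 2 : ℝ) / (n : ℝ) ^ ((2 : ℕ) : ℝ) := by
        rw [← Real.rpow_sub hn']; norm_num
      rw [this]; ring
    refine squeeze_zero_norm' ?_ hto
    filter_upwards [eventually_ge_atTop (⌈8 * (1 + ‖z‖ + ‖w‖)⌉₊)] with n hn
    have hn1 : 8 * (1 + ‖z‖ + ‖w‖) ≤ n := Nat.ceil_le.mp hn
    have hz0 := norm_nonneg z
    have hw0 := norm_nonneg w
    have hn2 : (1 : ℝ) ≤ n := by linarith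
    obtain ⟨g, hg, hg0, hgne, hfg, hgle⟩ := exists_zeroFree_factor hf h0 hA hn2
    -- `A + 1` in place of `A` makes the exponent strictly positive, as `norm_logDeriv_sub_le`
    -- demands.
    have hgb : ∀ x, ‖x‖ ≤ n → ‖g x‖ ≤ Real.exp ((A + 1) * (5 * n) ^ (3 / 2 : ℝ)) := by
      intro x hx
      have h1 := hgle x (by linarith)
      have h2 : ‖g x‖ ≤ 3 ^ (∑ ρ ∈ zerosIn f n, analyticOrderNatAt f ρ) * ‖g x‖ :=
        le_mul_of_one_le_left (norm_nonneg _) (one_le_pow₀ (by norm_num))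
      refine (h2.trans h1).trans (Real.exp_le_exp.mpr ?_)
      gcongr
      · linarith
      · linarith
    have hb := norm_logDeriv_sub_le hg hg0 (by linarith) (by positivity) hgne hgb (z := z) (w := w)
      (by linarith) (by linarith)
    refine le_trans (le_of_eq ?_) hb
    congr 1
    rw [hlog n g hg hfg z hz, hlog n g hg hfg w hw]
    have hTsum : ∑ ρ ∈ T n, (analyticOrderNatAt f ρ : ℂ) * (1 / (z - ρ) - 1 / (w - ρ))
        = ∑ ρ ∈ zerosIn f n, (analyticOrderNatAt f ρ : ℂ) * (1 / (z - ρ) - 1 / (w - ρ)) := by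
      refine Finset.sum_subtype_of_mem (fun ρ => (analyticOrderNatAt f ρ : ℂ) * (1 / (z - ρ) - 1 / (w - ρ))) fun ρ hρ => ?_
      exact (hZ ρ).mpr ((hmem _ _).mp hρ).2
    rw [hTsum]
    simp only [mul_sub, Finset.sum_sub_distrib]
    ring
  have h3 := hdiff.add hlim
  simp only [Function.comp_def, sub_add_cancel, zero_add] at h3
  have h4 := tendsto_nhds_unique h3 tendsto_const_nhds
  rw [← h4]
  exact hsum.hasSum

/-! ### Gamma factor: size and logarithmic derivative -/

/-- Since |s + j| ≥ Re s + j, Euler's approximant at s is dominated by the one at Re s, and the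
Bohr–Mollerup inequality puts the latter below Γ(Re s). Uniformity in `n` supplies a dominating
function later. -/
theorem norm_GammaSeq_le {s : ℂ} (hs : 0 < s.re) {n : ℕ} (hn : n ≠ 0) :
    ‖Complex.GammaSeq s n‖ ≤ Real.Gamma s.re := by
  have hpos : ∀ j : ℕ, 0 < s.re + j := fun j => by positivity
  have hn0 : (0 : ℝ) < n := by positivity
  have h1 : Real.BohrMollerup.logGammaSeq s.re n ≤ Real.log (Real.Gamma s.re) := by
    have := Real.BohrMollerup.ge_logGammaSeq (f := Real.log ∘ Real.Gamma) (x := s.re) (n := n)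
      Real.convexOn_log_Gamma
      (fun {y} hy => by
        simp only [Function.comp_apply]
        rw [Real.Gamma_add_one hy.ne', Real.log_mul hy.ne' (Real.Gamma_pos_of_pos hy).ne',
          add_comm]) hs hn
    simpa using this
  calc ‖Complex.GammaSeq s n‖ ≤ (n : ℝ) ^ s.re * n ! / ∏ j ∈ Finset.range (n + 1), (s.re + j) := by
        rw [Complex.GammaSeq, norm_div, norm_mul, Complex.norm_natCast_cpow_of_pos (by omega),
          Complex.norm_natCast, norm_prod]
        gcongr with j hj
        have := Complex.re_le_norm (s + j)
        simpa using this
    _ = Real.exp (Real.BohrMollerup.logGammaSeq s.re n) := by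
        rw [Real.BohrMollerup.logGammaSeq, Real.exp_sub, Real.exp_add, Real.exp_sum,
          Real.exp_log (by positivity), mul_comm s.re, Real.exp_mul, Real.exp_log hn0]
        congr 1
        exact Finset.prod_congr rfl fun j _ => (Real.exp_log (hpos j)).symm
    _ ≤ Real.Gamma s.re := by
        rw [← Real.exp_log (Real.Gamma_pos_of_pos hs)]
        exact Real.exp_le_exp.mpr h1

theorem norm_Gamma_le {s : ℂ} (hs : 0 < s.re) : ‖Complex.Gamma s‖ ≤ Real.Gamma s.re :=
  le_of_tendsto (Complex.GammaSeq_tendsto_Gamma s).norm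
    ((eventually_ne_atTop 0).mono fun _ hn => norm_GammaSeq_le hs hn)

theorem hasDerivAt_GammaSeq {s : ℂ} (hs : 0 < s.re) {n : ℕ} (hn : n ≠ 0) :
    HasDerivAt (fun z => Complex.GammaSeq z n)
      (Complex.GammaSeq s n * (Complex.log n - ∑ j ∈ Finset.range (n + 1), 1 / (s + j))) s := by
  have hn0 : (n : ℂ) ≠ 0 := by exact_mod_cast hn
  have hne : ∀ j : ℕ, s + j ≠ 0 := fun j h => by
    have := congrArg Complex.re h
    simp at this
    have : (0 : ℝ) ≤ j := by positivity
    linarith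
  have hprod : ∏ j ∈ Finset.range (n + 1), (s + j) ≠ 0 := Finset.prod_ne_zero_iff.mpr fun j _ => hne j
  have h1 : HasDerivAt (fun z : ℂ => (n : ℂ) ^ z) ((n : ℂ) ^ s * Complex.log n) s := by
    simpa using (hasDerivAt_id s).const_cpow (c := (n : ℂ)) (Or.inl hn0)
  have h2 : HasDerivAt (fun z : ℂ => ∏ j ∈ Finset.range (n + 1), (z + j))
      ((∏ j ∈ Finset.range (n + 1), (s + j)) * ∑ j ∈ Finset.range (n + 1), 1 / (s + j)) s := by
    have hd : DifferentiableAt ℂ (fun z : ℂ => ∏ j ∈ Finset.range (n + 1), (z + j)) s := by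
      fun_prop
    have := logDeriv_prod (s := Finset.range (n + 1)) (f := fun (j : ℕ) (z : ℂ) => z + j) (x := s)
      (fun j _ => hne j) (fun j _ => by fun_prop)
    rw [logDeriv_apply, div_eq_iff hprod] at this
    have h3 := hd.hasDerivAt
    rw [this, mul_comm] at h3
    convert! h3 using 2
    refine Finset.sum_congr rfl fun j _ => ?_
    simp [logDeriv_apply]
  convert! (h1.mul_const (n ! : ℂ)).div h2 hprod using 1
  rw [Complex.GammaSeq]
  field_simp

/-- Pointwise convergence passes to derivatives through Cauchy's integral formula on a circle, by
dominated convergence. -/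
theorem tendsto_deriv_GammaSeq {s : ℂ} (hs : 0 < s.re) :
    Tendsto (fun n => deriv (fun z => Complex.GammaSeq z n) s) atTop
      (𝓝 (deriv Complex.Gamma s)) := by
  -- On this disc the real part lies in [r, 3r], a compact part of the range where Γ is continuous,
  -- which gives a common bound.
  set r := s.re / 2 with hr
  have hr0 : 0 < r := by positivity
  have hre : ∀ z ∈ closedBall s r, r ≤ z.re ∧ z.re ≤ 3 * r := by
    intro z hz
    have h1 : ‖z - s‖ ≤ r := by simpa [dist_eq_norm] using hz
    have h2 := (Complex.abs_re_le_norm (z - s)).trans h1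
    rw [Complex.sub_re, abs_le] at h2
    constructor <;> linarith
  obtain ⟨B, hB⟩ : ∃ B, ∀ x ∈ Icc r (3 * r), Real.Gamma x ≤ B := by
    have hc : ContinuousOn Real.Gamma (Icc r (3 * r)) := fun x hx =>
      (Real.differentiableAt_Gamma fun m => by
        have : 0 < x := hr0.trans_le hx.1
        have : (0 : ℝ) ≤ m := by positivity
        linarith).continuousAt.continuousWithinAt
    obtain ⟨B, hB⟩ := (isCompact_Icc.image_of_continuousOn hc).bddAbove
    exact ⟨B, fun x hx => hB ⟨x, hx, rfl⟩⟩
  let U : Set ℂ := {z | 0 < z.re}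
  have hU : IsOpen U := isOpen_lt continuous_const Complex.continuous_re
  have hsub : closedBall s r ⊆ U := fun z hz => hr0.trans_le (hre z hz).1
  have hGd : DifferentiableOn ℂ Complex.Gamma U := fun z hz =>
    (Complex.differentiableAt_Gamma z fun m h => by
      have h1 : 0 < z.re := hz
      rw [h] at h1
      simp at h1
      have : (0 : ℝ) ≤ m := by positivity
      linarith).differentiableWithinAt
  have hSd : ∀ n ≠ 0, DifferentiableOn ℂ (fun z => Complex.GammaSeq z n) U := fun n hn z hz =>
    (hasDerivAt_GammaSeq hz hn).differentiableAt.differentiableWithinAt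
  rw [← Complex.cderiv_eq_deriv hU hGd hr0 hsub]
  have hev : (fun n => Complex.cderiv r (fun z => Complex.GammaSeq z n) s) =ᶠ[atTop]
      (fun n => deriv (fun z => Complex.GammaSeq z n) s) := by
    filter_upwards [eventually_ne_atTop 0] with n hn
    exact Complex.cderiv_eq_deriv hU (hSd n hn) hr0 hsub
  refine Tendsto.congr' hev ?_
  unfold Complex.cderiv
  refine Tendsto.const_smul ?_ _
  have hmem : ∀ θ, circleMap s r θ ∈ closedBall s r := fun θ =>
    sphere_subset_closedBall (circleMap_mem_sphere s hr0.le θ)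
  simp only [circleIntegral]
  refine intervalIntegral.tendsto_integral_filter_of_dominated_convergence
    (fun _ => r * ((r ^ 2)⁻¹ * B)) ?_ ?_ ?_ ?_
  · filter_upwards [eventually_ne_atTop 0] with n hn
    refine Continuous.aestronglyMeasurable ?_
    have hc : Continuous fun θ => Complex.GammaSeq (circleMap s r θ) n :=
      (hSd n hn).continuousOn.comp_continuous (continuous_circleMap s r) fun θ => hsub (hmem θ)
    have h2 : Continuous fun θ => ((circleMap s r θ - s) ^ 2)⁻¹ :=
      Continuous.inv₀ (((continuous_circleMap s r).sub continuous_const).pow 2) fun θ =>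
        pow_ne_zero _ (sub_ne_zero.mpr (circleMap_ne_center hr0.ne'))
    have h3 : Continuous (deriv (circleMap s r)) := by
      have : deriv (circleMap s r) = fun θ => circleMap 0 r θ * Complex.I :=
        funext fun θ => deriv_circleMap s r θ
      rw [this]
      exact (continuous_circleMap 0 r).mul continuous_const
    exact h3.smul (h2.smul hc)
  · filter_upwards [eventually_ne_atTop 0] with n hn
    refine Eventually.of_forall fun θ _ => ?_
    have h1 := hre _ (hmem θ)
    rw [norm_smul, norm_smul, deriv_circleMap, norm_mul, Complex.norm_I, mul_one, norm_circleMap_zero,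
      norm_inv, norm_pow, abs_of_pos hr0]
    have h2 : ‖circleMap s r θ - s‖ = r := by
      have := circleMap_mem_sphere s hr0.le θ
      simpa [dist_eq_norm] using this
    rw [h2]
    gcongr
    exact (norm_GammaSeq_le (hr0.trans_le h1.1) hn).trans (hB _ h1)
  · exact intervalIntegrable_const
  · refine Eventually.of_forall fun θ _ => ?_
    exact ((Complex.GammaSeq_tendsto_Gamma _).const_smul _).const_smul _

theorem tendsto_digamma {s : ℂ} (hs : 0 < s.re) :
    Tendsto (fun n : ℕ => Complex.log n - ∑ j ∈ Finset.range (n + 1), 1 / (s + j)) atTop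
      (𝓝 (Complex.digamma s)) := by
  have hG : Complex.Gamma s ≠ 0 := Complex.Gamma_ne_zero_of_re_pos hs
  have h := (tendsto_deriv_GammaSeq hs).div (Complex.GammaSeq_tendsto_Gamma s) hG
  refine h.congr' ?_
  filter_upwards [eventually_ne_atTop 0, (Complex.GammaSeq_tendsto_Gamma s).eventually_ne hG]
    with n hn hne
  simp only [Pi.div_apply]
  rw [(hasDerivAt_GammaSeq hs hn).deriv, mul_div_cancel_left₀ _ hne]

/-- The second-order Taylor error of log(1 + 1/z). The hypotheses force |z| ≥ 1.03, so |1/z| ≤ 0.98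
stays away from the singularity; they match s/2 with Re s ≥ 1/2 and Im s ≥ 2. -/
theorem norm_log_add_one_sub_le {z : ℂ} (hz : 1 / 4 ≤ z.re) (hz1 : 1 ≤ z.im) :
    ‖Complex.log (z + 1) - Complex.log z - 1 / z‖ ≤ 50 / ‖z‖ ^ 2 := by
  have hz0 : z ≠ 0 := by rintro rfl; simp at hz1; linarith
  have hn : 1.03 ≤ ‖z‖ := by
    have h1 : ‖z‖ ^ 2 = z.re ^ 2 + z.im ^ 2 := by
      rw [Complex.sq_norm, Complex.normSq_apply]; ring
    nlinarith [norm_nonneg z]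
  have hw : ‖1 / z‖ ≤ 0.98 := by
    rw [norm_div, norm_one, div_le_iff₀ (by linarith)]
    linarith
  have hre : 0 < (1 + 1 / z).re := by
    rw [Complex.add_re, Complex.one_re, one_div, Complex.inv_re]
    have : 0 ≤ z.re / Complex.normSq z := div_nonneg (by linarith) (Complex.normSq_nonneg _)
    linarith
  have hw0 : 1 + 1 / z ≠ 0 := by
    intro h; rw [h] at hre; simp at hre
  have e : Complex.log (z + 1) = Complex.log z + Complex.log (1 + 1 / z) := by
    rw [← Complex.log_mul hz0 hw0]
    · congr 1; field_simp
    · have h1 := abs_lt.mp (Complex.abs_arg_lt_pi_div_two_iff.mpr (Or.inl (by linarith : 0 < z.re)))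
      have h2 := abs_lt.mp (Complex.abs_arg_lt_pi_div_two_iff.mpr (Or.inl hre))
      constructor <;> linarith
  rw [e, add_sub_cancel_left]
  refine (Complex.norm_log_one_add_sub_self_le (by linarith)).trans ?_
  rw [norm_div, norm_one, one_div_pow, div_eq_mul_one_div 50, mul_comm (50 : ℝ), mul_div_assoc]
  refine mul_le_mul_of_nonneg_left ?_ (by positivity)
  rw [norm_div, norm_one] at hw
  have : (1 - 1 / ‖z‖)⁻¹ ≤ 100 := by
    rw [inv_le_comm₀ (by linarith) (by norm_num)]
    linarith
  linarith

/-- Stirling to accuracy O(1): in Euler's limit for the digamma function, log s is absorbed by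
telescoping log(s + j), and each step costs at most 50/(j² + 1), uniformly in s. -/
theorem exists_norm_digamma_sub_log_le :
    ∃ C, ∀ s : ℂ, 1 / 4 ≤ s.re → 1 ≤ s.im → ‖Complex.digamma s - Complex.log s‖ ≤ C := by
  have hsum : Summable fun j : ℕ => 50 / ((j : ℝ) ^ 2 + 1) := by
    refine Summable.of_norm_bounded_eventually_nat
      (g := fun j : ℕ => 50 * (1 / (j : ℝ) ^ 2)) ((Real.summable_one_div_nat_pow.mpr
        (by norm_num)).mul_left 50) ?_
    filter_upwards [eventually_gt_atTop 0] with j hj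
    rw [Real.norm_of_nonneg (by positivity), mul_one_div]
    gcongr
    linarith
  refine ⟨∑' j : ℕ, 50 / ((j : ℝ) ^ 2 + 1), fun s hs hs1 => ?_⟩
  have hs0 : s ≠ 0 := by rintro rfl; simp at hs1; linarith
  have hlim := (tendsto_digamma (s := s) (by linarith)).sub_const (Complex.log s)
  -- Trading log n for log(s + n + 1) is free in the limit and makes the sum telescope.
  have hlog : Tendsto (fun n : ℕ => Complex.log (s + (n + 1 : ℕ)) - Complex.log n) atTop (𝓝 0) := by
    have h1 : Tendsto (fun n : ℕ => (s + 1) / n + 1) atTop (𝓝 1) := by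
      have : Tendsto (fun n : ℕ => (s + 1) / (n : ℂ)) atTop (𝓝 0) := by
        simp only [div_eq_mul_inv]
        have := (tendsto_inv_atTop_nhds_zero_nat (𝕜 := ℂ)).const_mul (s + 1)
        simpa using this
      simpa using this.add_const 1
    have h2 := (continuousAt_clog (x := (1 : ℂ)) (by simp)).tendsto.comp h1
    rw [Complex.log_one] at h2
    refine h2.congr' ?_
    filter_upwards [eventually_gt_atTop 0] with n hn
    have hn' : (0 : ℝ) < n := by exact_mod_cast hn
    have hne : (s + 1) / n + 1 ≠ 0 := by
      intro h
      have h3 := congrArg Complex.im h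
      rw [Complex.add_im, Complex.div_natCast_im] at h3
      simp at h3
      rcases h3 with h3 | h3
      · linarith
      · omega
    have h4 := Complex.log_ofReal_mul hn' hne
    have h5 : ((n : ℝ) : ℂ) * ((s + 1) / n + 1) = s + (n + 1 : ℕ) := by
      have : (n : ℂ) ≠ 0 := by exact_mod_cast hn.ne'
      push_cast
      field_simp
      ring
    rw [h5] at h4
    rw [Function.comp_apply, h4, Complex.ofReal_log hn'.le]
    simp
  have hlim2 := hlim.add hlog
  rw [add_zero] at hlim2
  refine le_of_tendsto hlim2.norm (Eventually.of_forall fun n => ?_)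
  have e : Complex.log n - ∑ j ∈ Finset.range (n + 1), 1 / (s + j) - Complex.log s
      + (Complex.log (s + (n + 1 : ℕ)) - Complex.log n)
      = ∑ j ∈ Finset.range (n + 1), (Complex.log (s + j + 1) - Complex.log (s + j) - 1 / (s + j)) := by
    have h1 := Finset.sum_range_sub (fun j : ℕ => Complex.log (s + j)) (n + 1)
    simp only [Nat.cast_zero, add_zero] at h1
    rw [Finset.sum_sub_distrib]
    have h2 : ∀ j : ℕ, s + (j : ℂ) + 1 = s + ((j + 1 : ℕ) : ℂ) := fun j => by push_cast; ring
    simp only [h2]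
    rw [h1]
    ring
  rw [e]
  refine (norm_sum_le _ _).trans ((Finset.sum_le_sum fun j _ => ?_).trans
    (hsum.sum_le_tsum _ fun j _ => by positivity))
  have hj : (0 : ℝ) ≤ j := by positivity
  refine (norm_log_add_one_sub_le (z := s + j) (by simp; linarith) (by simp; linarith)).trans ?_
  have : ‖s + j‖ ^ 2 = (s.re + j) ^ 2 + s.im ^ 2 := by
    rw [Complex.sq_norm, Complex.normSq_apply]; simp; ring
  rw [this]
  gcongr
  · linarith
  · nlinarith

theorem deriv_Gammaℝ_div {s : ℂ} (hs : 0 < s.re) :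
    deriv Complex.Gammaℝ s / Complex.Gammaℝ s
      = -Complex.log π / 2 + Complex.digamma (s / 2) / 2 := by
  have hpi : (π : ℂ) ≠ 0 := by exact_mod_cast Real.pi_ne_zero
  have hs2 : 0 < (s / 2).re := by simp; linarith
  have hG : DifferentiableAt ℂ Complex.Gamma (s / 2) :=
    Complex.differentiableAt_Gamma _ fun m h => by
      rw [h] at hs2
      simp at hs2
      have : (0 : ℝ) ≤ m := by positivity
      linarith
  have hGne : Complex.Gamma (s / 2) ≠ 0 := Complex.Gamma_ne_zero_of_re_pos hs2
  have h1 : HasDerivAt (fun z : ℂ => (π : ℂ) ^ (-z / 2)) ((π : ℂ) ^ (-s / 2) * Complex.log π * (-1 / 2)) s := by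
    exact ((hasDerivAt_id s).neg.div_const 2).const_cpow (Or.inl hpi)
  have h2 : HasDerivAt (fun z : ℂ => Complex.Gamma (z / 2)) (deriv Complex.Gamma (s / 2) * (1 / 2)) s :=
    hG.hasDerivAt.comp s ((hasDerivAt_id s).div_const 2)
  have h3 := h1.mul h2
  have e : Complex.Gammaℝ = (fun z : ℂ => (π : ℂ) ^ (-z / 2)) * fun z => Complex.Gamma (z / 2) := rfl
  rw [e, h3.deriv, Complex.digamma_def, logDeriv_apply]
  simp only [Pi.mul_apply]
  have hp : (π : ℂ) ^ (-s / 2) ≠ 0 := by simp [hpi]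
  field_simp

/-- The logarithmic derivative is ½ log(s/2) + O(1). The real part of log(s/2) is within 1 of log t,
and its imaginary part is an argument below π/2 in modulus. -/
theorem exists_logDeriv_Gammaℝ_bound :
    ∃ C, ∀ σ t : ℝ, 1 / 2 ≤ σ → σ ≤ 3 / 2 → 2 ≤ t →
      |(deriv Complex.Gammaℝ (σ + t * Complex.I) / Complex.Gammaℝ (σ + t * Complex.I)).re
        - Real.log t / 2| ≤ C ∧
      |(deriv Complex.Gammaℝ (σ + t * Complex.I) / Complex.Gammaℝ (σ + t * Complex.I)).im| ≤ C := by
  obtain ⟨C, hC⟩ := exists_norm_digamma_sub_log_le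
  refine ⟨C + 4 + Real.log π, fun σ t h1 h2 ht => ?_⟩
  set s : ℂ := σ + t * Complex.I
  have hre : s.re = σ := by simp [s]
  have him : s.im = t := by simp [s]
  have hre2 : (s / 2).re = σ / 2 := by simp [hre]
  have him2 : (s / 2).im = t / 2 := by simp [him]
  have hb := hC (s / 2) (by rw [hre2]; linarith) (by rw [him2]; linarith)
  have hlogpi : 0 ≤ Real.log π := Real.log_nonneg (by linarith [Real.pi_gt_three])
  rw [deriv_Gammaℝ_div (by rw [hre]; linarith)]
  have hC0 : 0 ≤ C := (norm_nonneg _).trans hb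
  have hlp : Complex.log (π : ℂ) = (Real.log π : ℝ) := (Complex.ofReal_log Real.pi_pos.le).symm
  set D := Complex.digamma (s / 2)
  have hbre := (Complex.abs_re_le_norm _).trans hb
  have hbim := (Complex.abs_im_le_norm _).trans hb
  rw [Complex.sub_re, Complex.log_re] at hbre
  rw [Complex.sub_im, Complex.log_im] at hbim
  have hn1 : t / 2 ≤ ‖s / 2‖ := by
    have := Complex.abs_im_le_norm (s / 2)
    rw [him2] at this
    exact (le_abs_self _).trans this
  have hn2 : ‖s / 2‖ ≤ t := by
    have := Complex.norm_le_abs_re_add_abs_im (s / 2)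
    rw [hre2, him2, abs_of_nonneg (by linarith), abs_of_nonneg (by linarith)] at this
    linarith
  have hl1 : Real.log t - 1 ≤ Real.log ‖s / 2‖ := by
    have h3 : Real.log (t / 2) ≤ Real.log ‖s / 2‖ := Real.log_le_log (by linarith) hn1
    rw [Real.log_div (by linarith) (by norm_num)] at h3
    linarith [Real.log_two_lt_d9]
  have hl2 : Real.log ‖s / 2‖ ≤ Real.log t := Real.log_le_log (by linarith) hn2
  have harg := abs_lt.mp (Complex.abs_arg_lt_pi_div_two_iff.mpr
    (Or.inl (by rw [hre2]; linarith : 0 < (s / 2).re)))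
  have hpi4 := Real.pi_lt_four
  have e1 : (-Complex.log (π : ℂ) / 2 + D / 2).re = -Real.log π / 2 + D.re / 2 := by
    rw [hlp, Complex.add_re, Complex.div_ofNat_re, Complex.div_ofNat_re, Complex.neg_re, Complex.ofReal_re]
  have e2 : (-Complex.log (π : ℂ) / 2 + D / 2).im = D.im / 2 := by
    rw [hlp, Complex.add_im, Complex.div_ofNat_im, Complex.div_ofNat_im, Complex.neg_im, Complex.ofReal_im]
    ring
  rw [e1, e2]
  rw [abs_le] at hbre hbim
  constructor <;> rw [abs_le] <;> constructor <;> linarith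

/-! ### The function `xi`: zeros, multiplicities and growth -/

/-- The entire function `s (s - 1) Λ(s)`. -/
def xi (s : ℂ) : ℂ := s * (s - 1) * completedRiemannZeta₀ s + 1

theorem differentiable_xi : Differentiable ℂ xi := by
  unfold xi
  have := differentiable_completedZeta₀
  fun_prop

@[simp] theorem xi_zero : xi 0 = 1 := by simp [xi]

theorem xi_one_sub (s : ℂ) : xi (1 - s) = xi s := by
  rw [xi, xi, completedRiemannZeta₀_one_sub]; ring

theorem xi_eq {s : ℂ} (hs : 0 < s.re) (h1 : s ≠ 1) :
    xi s = s * (s - 1) * Complex.Gammaℝ s * riemannZeta s := by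
  have h0 : s ≠ 0 := by rintro rfl; simp at hs
  have h1' : 1 - s ≠ 0 := sub_ne_zero.mpr (Ne.symm h1)
  rw [riemannZeta_def_of_ne_zero h0, mul_assoc, mul_div_cancel₀ _
    (Complex.Gammaℝ_ne_zero_of_re_pos hs), completedRiemannZeta_eq, xi]
  field_simp
  ring

theorem xi_ne_zero_of_one_le_re {s : ℂ} (hs : 1 ≤ s.re) : xi s ≠ 0 := by
  rcases eq_or_ne s 1 with rfl | h1
  · simp [xi]
  · have h0 : s ≠ 0 := by rintro rfl; simp at hs; linarith
    rw [xi_eq (by linarith) h1]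
    exact mul_ne_zero (mul_ne_zero (mul_ne_zero h0 (sub_ne_zero.mpr h1))
      (Complex.Gammaℝ_ne_zero_of_re_pos (by linarith))) (riemannZeta_ne_zero_of_one_le_re hs)

/-- The functional equation reflects the non-vanishing on Re s ≥ 1 to Re s ≤ 0; inside the strip the
other factors of `xi` have no zeros. -/
theorem mem_nontrivialZeros_iff (ρ : ℂ) : ρ ∈ nontrivialZeros ↔ xi ρ = 0 := by
  constructor
  · rintro ⟨h, h0, h1⟩
    have : ρ ≠ 1 := by rintro rfl; simp at h1
    rw [xi_eq h0 this, h, mul_zero]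
  · intro h
    have h1 : ρ.re < 1 := by
      by_contra hc
      exact xi_ne_zero_of_one_le_re (not_lt.mp hc) h
    have h0 : 0 < ρ.re := by
      by_contra hc
      refine xi_ne_zero_of_one_le_re (s := 1 - ρ) ?_ (by rw [xi_one_sub, h])
      simp; linarith
    refine ⟨?_, h0, h1⟩
    have hne : ρ ≠ 1 := by rintro rfl; simp at h1
    have h00 : ρ ≠ 0 := by rintro rfl; simp at h0
    rw [xi_eq h0 hne] at h
    exact (mul_eq_zero.mp h).resolve_left (mul_ne_zero (mul_ne_zero h00 (sub_ne_zero.mpr hne))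
      (Complex.Gammaℝ_ne_zero_of_re_pos h0))

theorem differentiableAt_Gammaℝ {s : ℂ} (hs : 0 < s.re) : DifferentiableAt ℂ Complex.Gammaℝ s := by
  have h := (Complex.differentiable_Gammaℝ_inv s).inv
    (inv_ne_zero (Complex.Gammaℝ_ne_zero_of_re_pos hs))
  have e : (fun s => (Complex.Gammaℝ s)⁻¹)⁻¹ = Complex.Gammaℝ := by ext; simp
  rwa [e] at h

theorem analyticOrderNatAt_xi {ρ : ℂ} (h : ρ ∈ nontrivialZeros) :
    analyticOrderNatAt xi ρ = analyticOrderNatAt riemannZeta ρ := by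
  obtain ⟨-, h0, h1⟩ := h
  have hne : ρ ≠ 1 := by rintro rfl; simp at h1
  have h00 : ρ ≠ 0 := by rintro rfl; simp at h0
  have hU : IsOpen {z : ℂ | 0 < z.re} := isOpen_lt continuous_const Complex.continuous_re
  have hG : AnalyticAt ℂ Complex.Gammaℝ ρ :=
    (DifferentiableOn.analyticAt (s := {z : ℂ | 0 < z.re})
      (fun z hz => (differentiableAt_Gammaℝ hz).differentiableWithinAt) (hU.mem_nhds h0))
  have hZ : AnalyticAt ℂ riemannZeta ρ := analyticOn_riemannZeta ρ hne
  have hH : AnalyticAt ℂ (fun s : ℂ => s * (s - 1) * Complex.Gammaℝ s) ρ := by fun_prop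
  have hev : xi =ᶠ[𝓝 ρ] (fun s : ℂ => s * (s - 1) * Complex.Gammaℝ s) * riemannZeta := by
    filter_upwards [hU.mem_nhds h0, isOpen_ne.mem_nhds hne] with z hz hz1
    exact xi_eq hz hz1
  unfold analyticOrderNatAt
  rw [analyticOrderAt_congr hev, analyticOrderAt_mul hH hZ, hH.analyticOrderAt_eq_zero.mpr, zero_add]
  exact mul_ne_zero (mul_ne_zero h00 (sub_ne_zero.mpr hne)) (Complex.Gammaℝ_ne_zero_of_re_pos h0)

/-- Λ₀ is the Mellin transform of a modified theta kernel that is integrable against every power. In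
the strip, |t^(s/2-1)| is at most the sum of the powers at the two extreme abscissas. -/
theorem exists_norm_completedRiemannZeta₀_le :
    ∃ K, ∀ s : ℂ, 1 / 2 ≤ s.re → s.re ≤ 2 → ‖completedRiemannZeta₀ s‖ ≤ K := by
  let P := HurwitzZeta.hurwitzEvenFEPair 0
  have hconv : ∀ s : ℂ, MellinConvergent P.f_modif s := by
    intro s
    have hP := P.isStrongFEPair_toStrongFEPair
    exact mellinConvergent_of_isBigO_rpow (a := s.re + 1) (b := s.re - 1) P.hf_modif_int
      (hP.hf_top _) (by linarith) (hP.hf_zero _) (by linarith)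
  have hint : ∀ x : ℝ, IntegrableOn (fun t : ℝ => t ^ (x - 1) * ‖P.f_modif t‖) (Ioi 0) := by
    intro x
    refine (hconv x).norm.congr ((ae_restrict_mem measurableSet_Ioi).mono fun t ht => ?_)
    have ht' : 0 < t := ht
    simp only [norm_smul]
    rw [Complex.norm_cpow_eq_rpow_re_of_pos ht']
    simp
  refine ⟨(∫ t in Ioi (0 : ℝ), (t ^ ((1 / 4 : ℝ) - 1) * ‖P.f_modif t‖
    + t ^ ((1 : ℝ) - 1) * ‖P.f_modif t‖)) / 2, fun s h1 h2 => ?_⟩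
  have e : completedRiemannZeta₀ s = mellin P.f_modif (s / 2) / 2 := rfl
  rw [e, norm_div, Complex.norm_ofNat]
  gcongr
  rw [mellin]
  refine norm_integral_le_of_norm_le ((hint _).add (hint _))
    ((ae_restrict_mem measurableSet_Ioi).mono fun t ht => ?_)
  have ht' : 0 < t := ht
  rw [norm_smul, Complex.norm_cpow_eq_rpow_re_of_pos ht', ← add_mul]
  gcongr
  have e2 : (s / 2 - 1).re = s.re / 2 - 1 := by simp
  rw [e2]
  have p1 : 0 ≤ t ^ ((1 / 4 : ℝ) - 1) := by positivity
  have p2 : 0 ≤ t ^ ((1 : ℝ) - 1) := by positivity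
  rcases le_total t 1 with h | h
  · have := Real.rpow_le_rpow_of_exponent_ge ht' h (show (1 / 4 : ℝ) - 1 ≤ s.re / 2 - 1 by linarith)
    exact this.trans (le_add_of_nonneg_right p2)
  · have := Real.rpow_le_rpow_of_exponent_le h (show s.re / 2 - 1 ≤ (1 : ℝ) - 1 by linarith)
    exact this.trans (le_add_of_nonneg_left p1)

/-- Here log Γ(x) ≤ n log n with n = ⌈x⌉, and log n ≤ 2√n degrades this to the exponent 3/2. -/
theorem Gamma_le_exp {x : ℝ} (hx : 1 ≤ x) :
    Real.Gamma x ≤ Real.exp (2 * (1 + x) ^ (3 / 2 : ℝ)) := by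
  set n := ⌈x⌉₊
  have hn1 : x ≤ n := Nat.le_ceil x
  have hn2 : (n : ℝ) ≤ 1 + x := by
    have := Nat.ceil_lt_add_one (show 0 ≤ x by linarith)
    linarith
  have hn0 : (0 : ℝ) < n := by linarith
  have hG := Real.Gamma_pos_of_pos (show 0 < x by linarith)
  calc Real.Gamma x ≤ x * Real.Gamma x := le_mul_of_one_le_left hG.le hx
    _ = Real.Gamma (x + 1) := (Real.Gamma_add_one (by linarith)).symm
    _ ≤ Real.Gamma (n + 1) := Real.Gamma_strictMonoOn_Ici.monotoneOn (by simp; linarith)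
        (by simp; linarith) (by linarith)
    _ = n ! := Real.Gamma_nat_eq_factorial n
    _ ≤ (n : ℝ) ^ n := by exact_mod_cast Nat.factorial_le_pow n
    _ = Real.exp (Real.log n * n) := by rw [← Real.rpow_natCast, Real.rpow_def_of_pos hn0]
    _ ≤ Real.exp (2 * (1 + x) ^ (3 / 2 : ℝ)) := by
        rw [Real.exp_le_exp]
        have h1 := Real.log_le_rpow_div hn0.le (show (0 : ℝ) < 1 / 2 by norm_num)
        calc Real.log n * n ≤ ((n : ℝ) ^ (1 / 2 : ℝ) / (1 / 2)) * n := by gcongr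
          _ = 2 * (n : ℝ) ^ (3 / 2 : ℝ) := by
              rw [show (3 / 2 : ℝ) = 1 / 2 + 1 by norm_num, Real.rpow_add hn0, Real.rpow_one]
              ring
          _ ≤ _ := by gcongr

theorem norm_completedRiemannZeta₀_le {s : ℂ} (hs : 2 ≤ s.re) :
    ‖completedRiemannZeta₀ s‖ ≤ ((∑' n : ℕ, 1 / (n : ℝ) ^ (2 : ℝ)) + 2)
      * Real.exp (2 * (1 + ‖s‖) ^ (3 / 2 : ℝ)) := by
  have h1 : s ≠ 1 := by rintro rfl; simp at hs
  have h0 : s ≠ 0 := by rintro rfl; simp at hs; linarith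
  have hre := Complex.re_le_norm s
  have e : completedRiemannZeta₀ s = Complex.Gammaℝ s * riemannZeta s + 1 / s + 1 / (1 - s) := by
    rw [riemannZeta_def_of_ne_zero h0, mul_div_cancel₀ _
      (Complex.Gammaℝ_ne_zero_of_re_pos (by linarith)), completedRiemannZeta_eq]
    ring
  have hz : ‖riemannZeta s‖ ≤ ∑' n : ℕ, 1 / (n : ℝ) ^ (2 : ℝ) := by
    rw [zeta_eq_tsum_one_div_nat_cpow (by linarith)]
    refine tsum_of_norm_bounded (Real.summable_one_div_nat_rpow.mpr (by norm_num)).hasSum fun n => ?_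
    rcases Nat.eq_zero_or_pos n with rfl | hn
    · simp [Complex.zero_cpow h0]
    · rw [norm_div, norm_one, Complex.norm_natCast_cpow_of_pos hn]
      have : (1 : ℝ) ≤ n := by exact_mod_cast hn
      gcongr
  have hG : ‖Complex.Gammaℝ s‖ ≤ Real.exp (2 * (1 + ‖s‖) ^ (3 / 2 : ℝ)) := by
    rw [Complex.Gammaℝ_def, norm_mul, Complex.norm_cpow_eq_rpow_re_of_pos Real.pi_pos]
    have e1 : (-s / 2).re = -(s.re / 2) := by simp; ring
    have e2 : (s / 2).re = s.re / 2 := by simp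
    have h2 : π ^ (-s / 2).re ≤ 1 := by
      rw [e1]
      exact Real.rpow_le_one_of_one_le_of_nonpos (by linarith [Real.pi_gt_three]) (by linarith)
    have h3 : ‖Complex.Gamma (s / 2)‖ ≤ Real.exp (2 * (1 + ‖s‖) ^ (3 / 2 : ℝ)) := by
      refine (norm_Gamma_le (by rw [e2]; linarith)).trans ((Gamma_le_exp (by rw [e2]; linarith)).trans ?_)
      rw [e2]
      gcongr
      linarith
    calc _ ≤ 1 * Real.exp (2 * (1 + ‖s‖) ^ (3 / 2 : ℝ)) := by gcongr
      _ = _ := one_mul _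
  have hexp : 1 ≤ Real.exp (2 * (1 + ‖s‖) ^ (3 / 2 : ℝ)) := Real.one_le_exp (by positivity)
  have hb1 : ‖1 / s‖ ≤ 1 := by
    rw [norm_div, norm_one]
    exact div_le_one_of_le₀ (by linarith) (norm_nonneg _)
  have hb2 : ‖1 / (1 - s)‖ ≤ 1 := by
    rw [norm_div, norm_one]
    refine div_le_one_of_le₀ ?_ (norm_nonneg _)
    have := Complex.abs_re_le_norm (1 - s)
    rw [Complex.sub_re, Complex.one_re, abs_sub_comm] at this
    linarith [le_abs_self (s.re - 1)]
  rw [e]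
  calc _ ≤ ‖Complex.Gammaℝ s‖ * ‖riemannZeta s‖ + ‖1 / s‖ + ‖1 / (1 - s)‖ := by
        rw [← norm_mul]; exact norm_add₃_le
    _ ≤ Real.exp (2 * (1 + ‖s‖) ^ (3 / 2 : ℝ)) * (∑' n : ℕ, 1 / (n : ℝ) ^ (2 : ℝ)) + 1 + 1 := by
        gcongr
    _ ≤ _ := by nlinarith

/-- Bounds for Λ₀ in the strip and for Re s ≥ 2 cover the half-plane Re s ≥ 1/2; the symmetry s ↦ 1
- s covers the rest, at the cost of a factor 2^(3/2) ≤ 4 in the exponent. -/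
theorem exists_norm_xi_le :
    ∃ A, ∀ z, ‖xi z‖ ≤ Real.exp (A * (1 + ‖z‖) ^ (3 / 2 : ℝ)) := by
  obtain ⟨K₁, hK₁⟩ := exists_norm_completedRiemannZeta₀_le
  set K₂ := (∑' n : ℕ, 1 / (n : ℝ) ^ (2 : ℝ)) + 2
  set K := |K₁| + |K₂|
  have hK0 : 0 ≤ K := by positivity
  have hhalf : ∀ z : ℂ, 1 / 2 ≤ z.re → ‖xi z‖ ≤ Real.exp ((4 + K) * (1 + ‖z‖) ^ (3 / 2 : ℝ)) := by
    intro z hz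
    set X := (1 + ‖z‖) ^ (3 / 2 : ℝ)
    have hz0 := norm_nonneg z
    have hX : 1 + ‖z‖ ≤ X := by
      calc 1 + ‖z‖ = (1 + ‖z‖) ^ (1 : ℝ) := (Real.rpow_one _).symm
        _ ≤ X := Real.rpow_le_rpow_of_exponent_le (by linarith) (by norm_num)
    have he1 : 1 ≤ Real.exp (2 * X) := Real.one_le_exp (by linarith)
    have hL : ‖completedRiemannZeta₀ z‖ ≤ K * Real.exp (2 * X) := by
      rcases le_total z.re 2 with h | h
      · have h1 := hK₁ z hz h
        have h2 : K₁ ≤ K := (le_abs_self _).trans (le_add_of_nonneg_right (abs_nonneg _))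
        nlinarith
      · refine (norm_completedRiemannZeta₀_le h).trans ?_
        have h2 : K₂ ≤ K := (le_abs_self _).trans (le_add_of_nonneg_left (abs_nonneg _))
        gcongr
    have hsq : (1 + ‖z‖) ^ 2 ≤ Real.exp (2 * X) := by
      have h1 := Real.add_one_le_exp X
      calc (1 + ‖z‖) ^ 2 ≤ (Real.exp X) ^ 2 := by gcongr; linarith
        _ = Real.exp (2 * X) := by rw [← Real.exp_nat_mul]; norm_num
    have hz1 : ‖z - 1‖ ≤ 1 + ‖z‖ := by
      have := norm_sub_le z 1
      rw [norm_one] at this; linarith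
    calc ‖xi z‖ ≤ ‖z‖ * ‖z - 1‖ * ‖completedRiemannZeta₀ z‖ + 1 := by
          refine (norm_add_le _ _).trans ?_
          rw [norm_mul, norm_mul, norm_one]
      _ ≤ (1 + ‖z‖) * (1 + ‖z‖) * (K * Real.exp (2 * X)) + 1 := by
          gcongr
          linarith
      _ ≤ Real.exp (2 * X) * (K * Real.exp (2 * X)) + Real.exp (2 * X) * Real.exp (2 * X) := by
          have h3 : (1 + ‖z‖) * (1 + ‖z‖) ≤ Real.exp (2 * X) := by rw [← sq]; exact hsq
          have h4 : 1 ≤ Real.exp (2 * X) * Real.exp (2 * X) := by nlinarith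
          gcongr
      _ = (K + 1) * Real.exp (4 * X) := by
          rw [show 4 * X = 2 * X + 2 * X by ring, Real.exp_add]; ring
      _ ≤ Real.exp (K * X) * Real.exp (4 * X) := by
          gcongr
          have := Real.add_one_le_exp (K * X)
          nlinarith
      _ = Real.exp ((4 + K) * X) := by rw [← Real.exp_add]; ring_nf
  refine ⟨(4 + K) * 4, fun z => ?_⟩
  rcases le_total (1 / 2) z.re with h | h
  · refine (hhalf z h).trans (Real.exp_le_exp.mpr ?_)
    gcongr
    linarith
  · rw [← xi_one_sub]
    refine (hhalf (1 - z) (by simp; linarith)).trans (Real.exp_le_exp.mpr ?_)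
    have h1 : 1 + ‖1 - z‖ ≤ 2 * (1 + ‖z‖) := by
      have := norm_sub_le 1 z
      rw [norm_one] at this
      linarith [norm_nonneg z]
    calc (4 + K) * (1 + ‖1 - z‖) ^ (3 / 2 : ℝ) ≤ (4 + K) * (2 * (1 + ‖z‖)) ^ (3 / 2 : ℝ) := by gcongr
      _ = (4 + K) * 2 ^ (3 / 2 : ℝ) * (1 + ‖z‖) ^ (3 / 2 : ℝ) := by
          rw [Real.mul_rpow (by norm_num) (by positivity)]; ring
      _ ≤ _ := by
          gcongr
          calc (2 : ℝ) ^ (3 / 2 : ℝ) ≤ 2 ^ (2 : ℝ) :=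
                Real.rpow_le_rpow_of_exponent_le (by norm_num) (by norm_num)
            _ = 4 := by norm_num

/-! ### Partial fractions of ξ'/ξ -/

/-- The multiplicity of a zero of `ζ`. -/
def mult (ρ : nontrivialZeros) : ℝ := analyticOrderNatAt riemannZeta (ρ : ℂ)

theorem mult_nonneg (ρ : nontrivialZeros) : 0 ≤ mult ρ := Nat.cast_nonneg _

theorem summable_mult_div : Summable fun ρ : nontrivialZeros => mult ρ / (1 + ‖(ρ : ℂ)‖) ^ 2 := by
  obtain ⟨A, hA⟩ := exists_norm_xi_le
  refine (summable_order_div differentiable_xi xi_zero hA mem_nontrivialZeros_iff).congr fun ρ => ?_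
  rw [analyticOrderNatAt_xi ρ.2, mult]

theorem hasSum_logDeriv_xi_sub {z w : ℂ} (hz : xi z ≠ 0) (hw : xi w ≠ 0) :
    HasSum (fun ρ : nontrivialZeros => (mult ρ : ℂ) * (1 / (z - ρ) - 1 / (w - ρ)))
      (deriv xi z / xi z - deriv xi w / xi w) := by
  obtain ⟨A, hA⟩ := exists_norm_xi_le
  have h := hasSum_logDeriv_sub differentiable_xi xi_zero hA mem_nontrivialZeros_iff hz hw
  convert! h using 3 with ρ
  rw [analyticOrderNatAt_xi ρ.2, mult]
  simp

theorem re_eq_half (hRH : RiemannHypothesis) {ρ : ℂ} (h : ρ ∈ nontrivialZeros) : ρ.re = 1 / 2 := by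
  refine hRH ρ h.1 ?_ ?_
  · rintro ⟨n, hn⟩
    have h0 := h.2.1
    rw [hn] at h0
    simp at h0
    have : (0 : ℝ) ≤ n := by positivity
    linarith
  · rintro rfl
    have := h.2.2
    simp at this

theorem xi_ne_zero (hRH : RiemannHypothesis) {s : ℂ} (hs : 1 / 2 < s.re) : xi s ≠ 0 := by
  intro h
  have := re_eq_half hRH ((mem_nontrivialZeros_iff s).mpr h)
  linarith

theorem xi_conj {s : ℂ} (hs : 0 < s.re) :
    xi ((starRingEnd ℂ) s) = (starRingEnd ℂ) (xi s) := by
  rcases eq_or_ne s 1 with rfl | h1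
  · simp [xi]
  · have h1' : (starRingEnd ℂ) s ≠ 1 := by
      intro h
      apply h1
      rw [← Complex.conj_conj s, h, map_one]
    rw [xi_eq (by simpa using hs) h1', xi_eq hs h1, riemannZeta_conj, Complex.Gammaℝ_def,
      Complex.Gammaℝ_def]
    have e1 : (starRingEnd ℂ) s / 2 = (starRingEnd ℂ) (s / 2) := by rw [map_div₀, Complex.conj_ofNat]
    have e2 : -(starRingEnd ℂ) s / 2 = (starRingEnd ℂ) (-s / 2) := by rw [map_div₀, map_neg, Complex.conj_ofNat]
    rw [e1, e2, Complex.Gamma_conj, Complex.cpow_conj]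
    · simp
    · rw [Complex.arg_ofReal_of_nonneg Real.pi_pos.le]
      exact Real.pi_pos.ne

theorem logDeriv_xi_conj {s : ℂ} (hs : 0 < s.re) :
    deriv xi ((starRingEnd ℂ) s) / xi ((starRingEnd ℂ) s)
      = (starRingEnd ℂ) (deriv xi s / xi s) := by
  have hU : IsOpen {z : ℂ | 0 < z.re} := isOpen_lt continuous_const Complex.continuous_re
  have hev : ((starRingEnd ℂ) ∘ xi ∘ (starRingEnd ℂ)) =ᶠ[𝓝 s] xi := by
    filter_upwards [hU.mem_nhds hs] with z hz
    simp only [Function.comp_apply]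
    rw [xi_conj hz, Complex.conj_conj]
  have h2 : deriv xi ((starRingEnd ℂ) s) = (starRingEnd ℂ) (deriv xi s) := by
    have h4 := (differentiable_xi ((starRingEnd ℂ) s)).hasDerivAt.conj_conj
    rw [Complex.conj_conj] at h4
    have h5 := (h4.congr_of_eventuallyEq hev.symm).deriv
    rw [h5, Complex.conj_conj]
  rw [h2, xi_conj hs, map_div₀]

theorem logDeriv_xi_one_sub (s : ℂ) :
    deriv xi (1 - s) / xi (1 - s) = -(deriv xi s / xi s) := by
  have h1 : HasDerivAt (fun z => xi (1 - z)) (deriv xi (1 - s) * (-1)) s :=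
    (differentiable_xi (1 - s)).hasDerivAt.comp s ((hasDerivAt_id s).const_sub 1)
  have h2 : (fun z => xi (1 - z)) = xi := funext xi_one_sub
  rw [h2] at h1
  rw [h1.deriv, xi_one_sub]
  ring

/-- The difference formula is applied to s and its mirror image 1 - s̄ in the critical line.
Functional equation and conjugation turn the difference of the values of ξ'/ξ into twice the real
part. Under RH each zero is its own mirror image, so every term doubles likewise and no constant
remains. -/
theorem hasSum_re_logDeriv_xi (hRH : RiemannHypothesis) {s : ℂ} (hs : 1 / 2 < s.re) :
    HasSum (fun ρ : nontrivialZeros => mult ρ * (1 / (s - ρ)).re) (deriv xi s / xi s).re := by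
  set w := (starRingEnd ℂ) s
  have hwre : w.re = s.re := Complex.conj_re s
  have hxw : xi (1 - w) ≠ 0 := by
    rw [xi_one_sub]; exact xi_ne_zero hRH (by rw [hwre]; exact hs)
  have h := hasSum_logDeriv_xi_sub (xi_ne_zero hRH hs) hxw
  rw [logDeriv_xi_one_sub, logDeriv_xi_conj (by linarith : 0 < s.re)] at h
  have h2 := (Complex.hasSum_re h).div_const 2
  convert! h2 using 1
  · funext ρ
    rw [Complex.re_ofReal_mul]
    have hρ := re_eq_half hRH ρ.2
    have e : 1 - w - ρ = -(starRingEnd ℂ) (s - ρ) := by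
      rw [map_sub]
      have : (ρ : ℂ) = 1 - (starRingEnd ℂ) (ρ : ℂ) := by
        apply Complex.ext
        · simp [hρ]; norm_num
        · simp
      conv_lhs => rw [this]
      ring
    rw [e]
    have : (1 / -(starRingEnd ℂ) (s - ρ)) = -(starRingEnd ℂ) (1 / (s - ρ)) := by
      rw [map_div₀, map_one, div_neg]
    rw [this, sub_neg_eq_add, Complex.add_re, Complex.conj_re]
    ring
  · rw [sub_neg_eq_add, Complex.add_re, Complex.conj_re]
    ring

/-! ### The functions f_{2m}, f_{2m+1} as integrals over the distance to the critical line -/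

theorem sq_add_sq_pos {x : ℝ} (hx : x ≠ 0) (u : ℝ) : 0 < u ^ 2 + x ^ 2 := by
  have := sq_nonneg u; positivity

theorem continuous_pow_mul_div {x : ℝ} (hx : x ≠ 0) (n : ℕ) :
    Continuous fun u : ℝ => u ^ n * (x / (u ^ 2 + x ^ 2)) := by
  have := fun u => (sq_add_sq_pos hx u).ne'
  fun_prop (disch := assumption)

theorem integral_div_sq_add_sq {x : ℝ} (hx : x ≠ 0) :
    ∫ u in (0 : ℝ)..1, x / (u ^ 2 + x ^ 2) = Real.arctan (1 / x) := by
  have h : ∀ u ∈ uIcc (0 : ℝ) 1, HasDerivAt (fun u => Real.arctan (u / x)) (x / (u ^ 2 + x ^ 2)) u := by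
    intro u _
    convert! ((hasDerivAt_id u).div_const x).arctan using 1
    have := (sq_add_sq_pos hx u).ne'
    simp only [id]
    field_simp
    ring
  have hc := continuous_pow_mul_div hx 0
  simp only [pow_zero, one_mul] at hc
  rw [intervalIntegral.integral_eq_sub_of_hasDerivAt h (hc.intervalIntegrable _ _)]
  simp

/-- Induction by the division step u²/(u²+x²) = 1 - x²/(u²+x²), starting from the arctangent. -/
theorem integral_pow_mul_div {x : ℝ} (hx : x ≠ 0) (m : ℕ) :
    ∫ u in (0 : ℝ)..1, u ^ (2 * m) * (x / (u ^ 2 + x ^ 2))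
      = (-1) ^ m * x ^ (2 * m) * Real.arctan (1 / x)
        + ∑ k ∈ Finset.range m, (-1) ^ (m - k + 1) / (2 * k + 1) * x ^ (2 * m - 2 * k - 1) := by
  induction m with
  | zero => simpa using integral_div_sq_add_sq hx
  | succ m ih =>
    have e : ∀ u : ℝ, u ^ (2 * (m + 1)) * (x / (u ^ 2 + x ^ 2))
        = x * u ^ (2 * m) - x ^ 2 * (u ^ (2 * m) * (x / (u ^ 2 + x ^ 2))) := by
      intro u
      have := (sq_add_sq_pos hx u).ne'
      rw [show 2 * (m + 1) = 2 * m + 2 by ring, pow_add]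
      field_simp
      ring
    simp only [e]
    rw [intervalIntegral.integral_sub
      ((by fun_prop : Continuous fun u : ℝ => x * u ^ (2 * m)).intervalIntegrable _ _)
      (((continuous_pow_mul_div hx _).const_mul _).intervalIntegrable _ _),
      intervalIntegral.integral_const_mul, intervalIntegral.integral_const_mul, ih, integral_pow,
      Finset.sum_range_succ, mul_add, Finset.mul_sum]
    have hs : ∑ k ∈ Finset.range m, x ^ 2 * ((-1) ^ (m - k + 1) / (2 * (k : ℝ) + 1) * x ^ (2 * m - 2 * k - 1))
        = -∑ k ∈ Finset.range m, (-1) ^ (m + 1 - k + 1) / (2 * (k : ℝ) + 1)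
          * x ^ (2 * (m + 1) - 2 * k - 1) := by
      rw [← Finset.sum_neg_distrib]
      refine Finset.sum_congr rfl fun k hk => ?_
      have hk' := Finset.mem_range.mp hk
      rw [show m + 1 - k + 1 = (m - k + 1) + 1 by omega,
        show 2 * (m + 1) - 2 * k - 1 = (2 * m - 2 * k - 1) + 2 by omega, pow_succ (-1 : ℝ), pow_add x]
      ring
    rw [hs, show m + 1 - m + 1 = 2 by omega, show 2 * (m + 1) - 2 * m - 1 = 1 by omega]
    push_cast
    simp only [one_pow, ne_eq, Nat.add_eq_zero_iff, one_ne_zero, and_false, not_false_eq_true, zero_pow]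
    ring

theorem integral_fEven (m : ℕ) (x : ℝ) :
    ∫ u in (0 : ℝ)..1, u ^ (2 * m) * (x / (u ^ 2 + x ^ 2) - x / (1 + x ^ 2)) = fEven m x := by
  -- At x = 0 both sides vanish: division by zero makes arctan(1/0) = 0, in agreement with the
  -- convention f_0(0) = 0.
  rcases eq_or_ne x 0 with rfl | hx
  · have hs : ∑ k ∈ Finset.range m, (-1 : ℝ) ^ (m - k + 1) / (2 * k + 1) * 0 ^ (2 * m - 2 * k - 1) = 0 := by
      refine Finset.sum_eq_zero fun k hk => ?_
      have hk' := Finset.mem_range.mp hk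
      rw [zero_pow (by omega), mul_zero]
    simp [fEven, hs]
  · simp only [mul_sub]
    rw [intervalIntegral.integral_sub ((continuous_pow_mul_div hx _).intervalIntegrable _ _)
      ((by fun_prop : Continuous fun u : ℝ => u ^ (2 * m) * (x / (1 + x ^ 2))).intervalIntegrable _ _),
      integral_pow_mul_div hx, intervalIntegral.integral_mul_const, integral_pow, fEven]
    congr 1
    have : (1 + x ^ 2) ≠ 0 := by positivity
    push_cast
    simp only [one_pow, ne_eq, Nat.add_eq_zero_iff, one_ne_zero, and_false, not_false_eq_true, zero_pow]
    field_simp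
    ring

theorem integral_fOdd (m : ℕ) (x : ℝ) :
    ∫ u in (0 : ℝ)..1, u ^ (2 * m + 1) * (u / (u ^ 2 + x ^ 2)) = (2 * m + 1) * fOdd m x := by
  have h2 : (2 * (m : ℝ) + 1) ≠ 0 := by positivity
  rcases eq_or_ne x 0 with rfl | hx
  -- At x = 0 only the term k = m survives, through 0^0 = 1; this is the value by continuity.
  · have hs : ∑ k ∈ Finset.range (m + 1), (-1 : ℝ) ^ (m - k) / (2 * k + 1) * 0 ^ (2 * m - 2 * k)
        = 1 / (2 * m + 1) := by
      rw [Finset.sum_range_succ, Finset.sum_eq_zero, zero_add]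
      · simp
      · intro k hk
        have hk' := Finset.mem_range.mp hk
        rw [zero_pow (by omega), mul_zero]
    have e : ∫ u in (0 : ℝ)..1, u ^ (2 * m + 1) * (u / (u ^ 2 + 0 ^ 2))
        = ∫ u in (0 : ℝ)..1, u ^ (2 * m) := by
      rw [intervalIntegral.integral_of_le zero_le_one, intervalIntegral.integral_of_le zero_le_one]
      refine setIntegral_congr_fun measurableSet_Ioc fun u hu => ?_
      have hu0 : u ≠ 0 := hu.1.ne'
      field_simp
      ring
    rw [e, integral_pow, fOdd, hs]
    simp
    field_simp
  · have e : ∀ u : ℝ, u ^ (2 * m + 1) * (u / (u ^ 2 + x ^ 2))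
        = x⁻¹ * (u ^ (2 * (m + 1)) * (x / (u ^ 2 + x ^ 2))) := by
      intro u
      have := (sq_add_sq_pos hx u).ne'
      field_simp
      ring
    simp only [e]
    rw [intervalIntegral.integral_const_mul, integral_pow_mul_div hx, fOdd, ← mul_assoc,
      mul_one_div_cancel h2, one_mul, mul_add, Finset.mul_sum]
    congr 1
    · rw [show 2 * (m + 1) = (2 * m + 1) + 1 by ring, pow_succ x]
      field_simp
    · refine Finset.sum_congr rfl fun k hk => ?_
      have hk' := Finset.mem_range.mp hk
      rw [show m + 1 - k + 1 = (m - k) + 2 by omega,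
        show 2 * (m + 1) - 2 * k - 1 = (2 * m - 2 * k) + 1 by omega, pow_add (-1 : ℝ), pow_succ x]
      field_simp

/-- Subtracting the value at u = 1 gains the factor 1/(1+x²) needed for summation over zeros. The
remaining factor blows up as u, x → 0 but has bounded integral in u. -/
theorem div_sub_div_abs {u x : ℝ} (hx : x ≠ 0) (hu0 : 0 ≤ u) (hu : u ≤ 1) :
    |x / (u ^ 2 + x ^ 2) - x / (1 + x ^ 2)| ≤ 1 / (1 + x ^ 2) * (|x| / (u ^ 2 + |x| ^ 2)) := by
  have h1 := sq_add_sq_pos hx u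
  have h2 : 0 < 1 + x ^ 2 := by positivity
  have e : x / (u ^ 2 + x ^ 2) - x / (1 + x ^ 2)
      = x * (1 - u ^ 2) / ((1 + x ^ 2) * (u ^ 2 + x ^ 2)) := by
    field_simp
    ring
  have h3 : 0 ≤ 1 - u ^ 2 := by nlinarith
  rw [e, abs_div, abs_mul, abs_of_pos (mul_pos h2 h1), abs_of_nonneg h3, sq_abs, div_mul_div_comm]
  refine div_le_div_of_nonneg_right ?_ (by positivity)
  rw [one_mul]
  exact mul_le_of_le_one_right (abs_nonneg _) (by nlinarith [sq_nonneg u])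

theorem integrable_div_sub_div (x : ℝ) {n : ℕ} {a : ℝ} :
    IntervalIntegrable (fun u => u ^ n * (x / (u ^ 2 + x ^ 2) - x / (1 + x ^ 2))) volume a 1 := by
  rcases eq_or_ne x 0 with rfl | hx
  · simp
  · simp only [mul_sub]
    exact ((continuous_pow_mul_div hx _).sub (by fun_prop)).intervalIntegrable _ _

theorem integral_abs_div_sub_div_le (x : ℝ) :
    ∫ u in (0 : ℝ)..1, |x / (u ^ 2 + x ^ 2) - x / (1 + x ^ 2)| ≤ 2 / (1 + x ^ 2) := by
  rcases eq_or_ne x 0 with rfl | hx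
  · simp
  · have hx' : |x| ≠ 0 := abs_ne_zero.mpr hx
    have hc := continuous_pow_mul_div hx' 0
    have hi := integrable_div_sub_div x (n := 0) (a := 0)
    simp only [pow_zero, one_mul] at hc hi
    calc _ ≤ ∫ u in (0 : ℝ)..1, 1 / (1 + x ^ 2) * (|x| / (u ^ 2 + |x| ^ 2)) :=
          intervalIntegral.integral_mono_on (by norm_num) hi.abs
            ((hc.const_mul _).intervalIntegrable _ _) fun u hu => div_sub_div_abs hx hu.1 hu.2
      _ = 1 / (1 + x ^ 2) * Real.arctan (1 / |x|) := by
          rw [intervalIntegral.integral_const_mul, integral_div_sq_add_sq hx']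
      _ ≤ 1 / (1 + x ^ 2) * 2 := by
          have := Real.arctan_lt_pi_div_two (1 / |x|)
          have := Real.pi_lt_four
          gcongr
          linarith
      _ = _ := by ring

theorem pow_mul_div_le {u : ℝ} (hu0 : 0 ≤ u) (hu : u ≤ 1) (n : ℕ) (x : ℝ) :
    u ^ (n + 1) * (u / (u ^ 2 + x ^ 2)) ≤ 2 / (1 + x ^ 2) := by
  have h1 : u ^ (n + 1) * (u / (u ^ 2 + x ^ 2)) ≤ u ^ 2 / (u ^ 2 + x ^ 2) := by
    rw [pow_succ, mul_assoc, ← mul_div_assoc, ← sq]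
    exact mul_le_of_le_one_left (by positivity) (pow_le_one₀ hu0 hu)
  refine h1.trans ?_
  rcases eq_or_lt_of_le (show 0 ≤ u ^ 2 + x ^ 2 by positivity) with h | h
  · rw [← h, div_zero]; positivity
  · rw [div_le_div_iff₀ h (by positivity)]
    have : u ^ 2 ≤ 1 := pow_le_one₀ hu0 hu
    nlinarith [sq_nonneg u, sq_nonneg x]

/-! ### Summation over the zeros under the Riemann hypothesis -/

/-- On the critical line |ρ| ≤ 1/2 + |t| + |t - γ|, so the weights centred at t and at 0 are
comparable. Dependence on `T` alone makes the later bounds locally uniform in t. -/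
theorem mult_div_le (hRH : RiemannHypothesis) {T t : ℝ} (ht : |t| ≤ T) (ρ : nontrivialZeros) :
    mult ρ * (1 / (1 + (t - (ρ : ℂ).im) ^ 2))
      ≤ 2 * (3 / 2 + T) ^ 2 * (mult ρ / (1 + ‖(ρ : ℂ)‖) ^ 2) := by
  have hre := re_eq_half hRH ρ.2
  set x := t - (ρ : ℂ).im with hx
  have hT : 0 ≤ T := (abs_nonneg t).trans ht
  have h1 : 1 + ‖(ρ : ℂ)‖ ≤ (3 / 2 + T) * (1 + |x|) := by
    have h2 := Complex.norm_le_abs_re_add_abs_im (ρ : ℂ)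
    rw [hre, abs_of_pos (by norm_num : (0 : ℝ) < 1 / 2)] at h2
    have h3 : |(ρ : ℂ).im| ≤ |t| + |x| := by
      have := abs_sub t x
      rwa [hx, sub_sub_cancel] at this
    nlinarith [abs_nonneg x]
  have h4 : (1 + ‖(ρ : ℂ)‖) ^ 2 ≤ 2 * (3 / 2 + T) ^ 2 * (1 + x ^ 2) := by
    calc (1 + ‖(ρ : ℂ)‖) ^ 2 ≤ ((3 / 2 + T) * (1 + |x|)) ^ 2 := by gcongr
      _ = (3 / 2 + T) ^ 2 * (1 + |x|) ^ 2 := by ring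
      _ ≤ (3 / 2 + T) ^ 2 * (2 * (1 + x ^ 2)) := by
          gcongr
          rw [← sq_abs x]
          nlinarith [sq_nonneg (1 - |x|)]
      _ = _ := by ring
  have hp : 0 < (1 + ‖(ρ : ℂ)‖) ^ 2 := by positivity
  have hm := mult_nonneg ρ
  rw [mul_one_div, ← mul_div_assoc, div_le_div_iff₀ (by positivity) hp]
  calc mult ρ * (1 + ‖(ρ : ℂ)‖) ^ 2 ≤ mult ρ * (2 * (3 / 2 + T) ^ 2 * (1 + x ^ 2)) := by gcongr
    _ = _ := by ring

theorem summable_mult_sub (hRH : RiemannHypothesis) (t : ℝ) :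
    Summable fun ρ : nontrivialZeros => mult ρ * (1 / (1 + (t - (ρ : ℂ).im) ^ 2)) :=
  Summable.of_nonneg_of_le (fun ρ => mul_nonneg (mult_nonneg ρ) (by positivity))
    (fun ρ => mult_div_le hRH le_rfl ρ) (summable_mult_div.mul_left _)

/-- The point at distance `u` to the right of the critical line at height `t`. -/
def pt (u t : ℝ) : ℂ := ((1 / 2 + u : ℝ) : ℂ) + t * Complex.I

@[simp] theorem pt_re (u t : ℝ) : (pt u t).re = 1 / 2 + u := by simp [pt]
@[simp] theorem pt_im (u t : ℝ) : (pt u t).im = t := by simp [pt]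

theorem one_div_pt_sub (hRH : RiemannHypothesis) (u t : ℝ) (ρ : nontrivialZeros) :
    (1 / (pt u t - ρ)).re = u / (u ^ 2 + (t - (ρ : ℂ).im) ^ 2) ∧
    (1 / (pt u t - ρ)).im = -((t - (ρ : ℂ).im) / (u ^ 2 + (t - (ρ : ℂ).im) ^ 2)) := by
  have hre := re_eq_half hRH ρ.2
  have h1 : (pt u t - ρ).re = u := by simp [hre]
  have h2 : (pt u t - ρ).im = t - (ρ : ℂ).im := by simp
  rw [one_div, Complex.inv_re, Complex.inv_im, Complex.normSq_apply, h1, h2]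
  constructor <;> ring

/-- The logarithmic derivative of `xi`. -/
def xiL (s : ℂ) : ℂ := deriv xi s / xi s

theorem hasSum_im_xiL (hRH : RiemannHypothesis) {u : ℝ} (hu : 0 < u) (t : ℝ) :
    HasSum (fun ρ : nontrivialZeros => mult ρ * -((t - (ρ : ℂ).im) / (u ^ 2 + (t - (ρ : ℂ).im) ^ 2)
      - (t - (ρ : ℂ).im) / (1 + (t - (ρ : ℂ).im) ^ 2)))
      ((xiL (pt u t)).im - (xiL (pt 1 t)).im) := by
  have h := Complex.hasSum_im (hasSum_logDeriv_xi_sub (z := pt u t) (w := pt 1 t)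
    (xi_ne_zero hRH (by simpa using hu)) (xi_ne_zero hRH (by simp)))
  rw [Complex.sub_im] at h
  convert! h using 2 with ρ
  rw [Complex.im_ofReal_mul, Complex.sub_im, (one_div_pt_sub hRH u t ρ).2,
    (one_div_pt_sub hRH 1 t ρ).2]
  ring

theorem hasSum_re_xiL (hRH : RiemannHypothesis) {u : ℝ} (hu : 0 < u) (t : ℝ) :
    HasSum (fun ρ : nontrivialZeros => mult ρ * (u / (u ^ 2 + (t - (ρ : ℂ).im) ^ 2)))
      (xiL (pt u t)).re := by
  have h := hasSum_re_logDeriv_xi hRH (s := pt u t) (by simpa using hu)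
  convert! h using 2 with ρ
  rw [(one_div_pt_sub hRH u t ρ).1]

/-- Countability of the zeros allows termwise integration and makes their ordinates a null set. -/
theorem countable_zeros : (riemannZeta ⁻¹' {0}).Countable := by
  have h : riemannZeta ⁻¹' {0} ⊆ ⋃ n : ℕ, closedBall (0 : ℂ) n ∩ riemannZetaZeros := by
    intro z hz
    obtain ⟨n, hn⟩ := exists_nat_ge ‖z‖
    exact mem_iUnion.mpr ⟨n, by simpa using hn, hz⟩
  exact (countable_iUnion fun n : ℕ =>
    ((isCompact_closedBall (0 : ℂ) n).inter_riemannZetaZeros_finite).countable).mono h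

instance : Countable nontrivialZeros :=
  (countable_zeros.mono fun _ h => h.1).to_subtype

/-- Termwise integration of the partial fractions, justified by the summability of the L¹ norms.
Near u = 0 the terms have no uniform bound of order 1/(1+x²), so L¹ norms cannot be replaced by sup
norms. -/
theorem hasSum_fEven (hRH : RiemannHypothesis) (m : ℕ) (t : ℝ) :
    HasSum (zeroTerm (fEven m) t)
      (-∫ u in (0 : ℝ)..1, u ^ (2 * m) * ((xiL (pt u t)).im - (xiL (pt 1 t)).im)) := by
  let G : nontrivialZeros → ℝ → ℝ := fun ρ u => mult ρ * (u ^ (2 * m) *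
    ((t - (ρ : ℂ).im) / (u ^ 2 + (t - (ρ : ℂ).im) ^ 2)
      - (t - (ρ : ℂ).im) / (1 + (t - (ρ : ℂ).im) ^ 2)))
  have hint : ∀ ρ, Integrable (G ρ) (volume.restrict (Ioc 0 1)) := fun ρ =>
    (((integrable_div_sub_div _).const_mul _).1 : IntegrableOn _ _ _)
  have hnorm : ∀ ρ, ∫ u in Ioc (0 : ℝ) 1, ‖G ρ u‖ ≤ 2 * (mult ρ * (1 / (1 + (t - (ρ : ℂ).im) ^ 2))) := by
    intro ρ
    set x := t - (ρ : ℂ).im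
    have hi := integrable_div_sub_div x (n := 0) (a := 0)
    simp only [pow_zero, one_mul] at hi
    calc ∫ u in Ioc (0 : ℝ) 1, ‖G ρ u‖ ≤ ∫ u in Ioc (0 : ℝ) 1, mult ρ * |x / (u ^ 2 + x ^ 2) - x / (1 + x ^ 2)| := by
          refine setIntegral_mono_on (hint ρ).norm (hi.abs.const_mul _).1 measurableSet_Ioc fun u hu => ?_
          simp only [G, norm_mul, Real.norm_eq_abs, abs_of_nonneg (mult_nonneg ρ)]
          refine mul_le_mul_of_nonneg_left ?_ (mult_nonneg ρ)
          refine mul_le_of_le_one_left (abs_nonneg _) ?_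
          rw [abs_of_nonneg (pow_nonneg hu.1.le _)]
          exact pow_le_one₀ hu.1.le hu.2
      _ = mult ρ * ∫ u in (0 : ℝ)..1, |x / (u ^ 2 + x ^ 2) - x / (1 + x ^ 2)| := by
          rw [intervalIntegral.integral_of_le zero_le_one, integral_const_mul]
      _ ≤ mult ρ * (2 / (1 + x ^ 2)) :=
          mul_le_mul_of_nonneg_left (integral_abs_div_sub_div_le x) (mult_nonneg ρ)
      _ = _ := by ring
  have hsum : Summable fun ρ => ∫ u in Ioc (0 : ℝ) 1, ‖G ρ u‖ :=
    Summable.of_nonneg_of_le (fun ρ => integral_nonneg fun _ => norm_nonneg _) hnorm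
      ((summable_mult_sub hRH t).mul_left 2)
  have h := hasSum_integral_of_summable_integral_norm hint hsum
  convert! h using 1
  · funext ρ
    simp only [G]
    rw [integral_const_mul, ← intervalIntegral.integral_of_le zero_le_one, integral_fEven]
    rfl
  · rw [intervalIntegral.integral_of_le zero_le_one, ← integral_neg]
    refine setIntegral_congr_fun measurableSet_Ioc fun u hu => ?_
    have h1 := ((hasSum_im_xiL hRH hu.1 t).mul_left (-u ^ (2 * m))).tsum_eq
    rw [← neg_mul, ← h1]
    refine tsum_congr fun ρ => ?_
    simp only [G]
    ring

/-- Here the extra power of u keeps every term below 2/(1+x²) pointwise, so no subtraction at u = 1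
is needed. -/
theorem hasSum_fOdd (hRH : RiemannHypothesis) (m : ℕ) (t : ℝ) :
    HasSum (fun ρ => (2 * m + 1) * zeroTerm (fOdd m) t ρ)
      (∫ u in (0 : ℝ)..1, u ^ (2 * m + 1) * (xiL (pt u t)).re) := by
  let G : nontrivialZeros → ℝ → ℝ := fun ρ u => mult ρ * (u ^ (2 * m + 1) *
    (u / (u ^ 2 + (t - (ρ : ℂ).im) ^ 2)))
  have hG0 : ∀ ρ, ∀ u ∈ Ioc (0 : ℝ) 1, 0 ≤ G ρ u := fun ρ u hu =>
    mul_nonneg (mult_nonneg ρ) (mul_nonneg (pow_nonneg hu.1.le _)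
      (div_nonneg hu.1.le (by positivity)))
  have hGle : ∀ ρ, ∀ u ∈ Ioc (0 : ℝ) 1,
      ‖G ρ u‖ ≤ 2 * (mult ρ * (1 / (1 + (t - (ρ : ℂ).im) ^ 2))) := by
    intro ρ u hu
    rw [Real.norm_of_nonneg (hG0 ρ u hu)]
    calc G ρ u ≤ mult ρ * (2 / (1 + (t - (ρ : ℂ).im) ^ 2)) :=
          mul_le_mul_of_nonneg_left (pow_mul_div_le hu.1.le hu.2 _ _) (mult_nonneg ρ)
      _ = _ := by ring
  have hint : ∀ ρ, Integrable (G ρ) (volume.restrict (Ioc 0 1)) := fun ρ => by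
    refine Integrable.of_bound (C := 2 * (mult ρ * (1 / (1 + (t - (ρ : ℂ).im) ^ 2)))) ?_
      ((ae_restrict_mem measurableSet_Ioc).mono fun u hu => hGle ρ u hu)
    exact Measurable.aestronglyMeasurable (by fun_prop)
  have hsum : Summable fun ρ => ∫ u in Ioc (0 : ℝ) 1, ‖G ρ u‖ := by
    refine Summable.of_nonneg_of_le (fun ρ => integral_nonneg fun _ => norm_nonneg _) (fun ρ => ?_)
      ((summable_mult_sub hRH t).mul_left 2)
    calc _ ≤ ∫ u in Ioc (0 : ℝ) 1, 2 * (mult ρ * (1 / (1 + (t - (ρ : ℂ).im) ^ 2))) :=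
          setIntegral_mono_on (hint ρ).norm (integrable_const _) measurableSet_Ioc (hGle ρ)
      _ = _ := by simp
  have h := hasSum_integral_of_summable_integral_norm hint hsum
  convert! h using 1
  · funext ρ
    simp only [G]
    rw [integral_const_mul, ← intervalIntegral.integral_of_le zero_le_one, integral_fOdd, zeroTerm, mult]
    ring
  · rw [intervalIntegral.integral_of_le zero_le_one]
    refine setIntegral_congr_fun measurableSet_Ioc fun u hu => ?_
    have h1 := ((hasSum_re_xiL hRH hu.1 t).mul_left (u ^ (2 * m + 1))).tsum_eq
    rw [← h1]
    refine tsum_congr fun ρ => ?_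
    simp only [G]
    ring

/-! ### A branch of log ζ to the right of the critical line -/

/-- The function `(s - 1) ζ(s)` on the right half-plane, without its removable singularity. -/
def zetaReg (s : ℂ) : ℂ := xi s / (s * Complex.Gammaℝ s)

theorem zetaReg_eq {s : ℂ} (hs : 0 < s.re) (h1 : s ≠ 1) : zetaReg s = (s - 1) * riemannZeta s := by
  have h0 : s ≠ 0 := by rintro rfl; simp at hs
  have hG := Complex.Gammaℝ_ne_zero_of_re_pos hs
  rw [zetaReg, xi_eq hs h1]
  field_simp

@[simp] theorem zetaReg_one : zetaReg 1 = 1 := by simp [zetaReg, xi]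

theorem zetaReg_ne_zero (hRH : RiemannHypothesis) {s : ℂ} (hs : 1 / 2 < s.re) : zetaReg s ≠ 0 := by
  have h0 : s ≠ 0 := by rintro rfl; simp at hs; linarith
  exact div_ne_zero (xi_ne_zero hRH hs)
    (mul_ne_zero h0 (Complex.Gammaℝ_ne_zero_of_re_pos (by linarith)))

theorem differentiableAt_zetaReg {s : ℂ} (hs : 0 < s.re) : DifferentiableAt ℂ zetaReg s := by
  have h0 : s ≠ 0 := by rintro rfl; simp at hs
  have hG := Complex.Gammaℝ_ne_zero_of_re_pos hs
  exact (differentiable_xi s).div (differentiableAt_id.mul (differentiableAt_Gammaℝ hs))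
    (mul_ne_zero h0 hG)

theorem deriv_zetaReg_div {s : ℂ} (hs : 0 < s.re) (hx : xi s ≠ 0) :
    deriv zetaReg s / zetaReg s
      = xiL s - 1 / s - deriv Complex.Gammaℝ s / Complex.Gammaℝ s := by
  have h0 : s ≠ 0 := by rintro rfl; simp at hs
  have hG := Complex.Gammaℝ_ne_zero_of_re_pos hs
  have h := ((differentiable_xi s).hasDerivAt.div
    ((hasDerivAt_id s).mul (differentiableAt_Gammaℝ hs).hasDerivAt) (mul_ne_zero h0 hG))
  have e : zetaReg = xi / (id * Complex.Gammaℝ) := rfl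
  rw [xiL, e, h.deriv]
  simp only [Pi.div_apply, Pi.mul_apply, id]
  field_simp
  ring

theorem zetaReg_im_ofReal {x : ℝ} (hx : 0 < x) : (zetaReg x).im = 0 := by
  rcases eq_or_ne x 1 with rfl | h1
  · simp
  · have h1' : (x : ℂ) ≠ 1 := by exact_mod_cast h1
    rw [← Complex.conj_eq_iff_im, zetaReg_eq (by simpa using hx) h1', map_mul, ← riemannZeta_conj]
    simp

/-- `ℓ` is the branch of `log ((s - 1) ζ(s))` on the half-plane `Re s > 1/2` that is real on the
real axis. -/
structure IsLogZetaReg (ℓ : ℂ → ℂ) : Prop where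
  diff : ∀ s, 1 / 2 < s.re → DifferentiableAt ℂ ℓ s
  exp_eq : ∀ s, 1 / 2 < s.re → Complex.exp (ℓ s) = zetaReg s
  im_eq : ∀ x : ℝ, 1 / 2 < x → (ℓ x).im = 0

/-- By continuity `h` stays within π of `h s` nearby, so there it equals `h s` plus the principal
logarithm of g/g(s). -/
theorem differentiableAt_of_exp_eq {h g : ℂ → ℂ} {s : ℂ} (hc : ContinuousAt h s)
    (hg : DifferentiableAt ℂ g s) (he : ∀ᶠ z in 𝓝 s, Complex.exp (h z) = g z) :
    DifferentiableAt ℂ h s := by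
  have hgs : g s ≠ 0 := he.self_of_nhds ▸ Complex.exp_ne_zero _
  have hev : h =ᶠ[𝓝 s] fun z => h s + Complex.log (g z / g s) := by
    have h1 : ∀ᶠ z in 𝓝 s, ‖h z - h s‖ < π := by
      have h2 : Tendsto (fun z => h z - h s) (𝓝 s) (𝓝 0) := by
        simpa using hc.tendsto.sub_const (h s)
      exact h2.norm.eventually_lt_const (by simpa using Real.pi_pos)
    filter_upwards [he, h1] with z hz hz1
    have him := abs_lt.mp ((Complex.abs_im_le_norm _).trans_lt hz1)
    rw [← hz, ← he.self_of_nhds, ← Complex.exp_sub, Complex.log_exp him.1 him.2.le]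
    ring
  refine DifferentiableAt.congr_of_eventuallyEq ?_ hev
  refine DifferentiableAt.const_add _ (DifferentiableAt.clog (hg.div_const _) ?_)
  rw [div_self hgs]
  exact Complex.one_mem_slitPlane

theorem int_of_sin_eq_zero_constant {θ : ℝ → ℝ} {s : Set ℝ} (hs : IsPreconnected s)
    (hc : ContinuousOn θ s) (h : ∀ x ∈ s, Real.sin (θ x) = 0) {x y : ℝ} (hx : x ∈ s) (hy : y ∈ s) :
    θ x = θ y := by
  have hT : IsDiscrete (Set.range ((↑) : ℤ → ℝ)) :=
    ⟨Int.isClosedEmbedding_coe_real.isEmbedding.toHomeomorph.symm.isEmbedding.discreteTopology⟩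
  have h1 := hs.constant_of_mapsTo hT (hc.div_const π) (fun z hz => by
    obtain ⟨n, hn⟩ := Real.sin_eq_zero_iff.mp (h z hz)
    refine ⟨n, ?_⟩
    simp only
    rw [← hn]
    field_simp) hx hy
  have := Real.pi_pos.ne'
  field_simp at h1
  exact h1

theorem isOpen_half : IsOpen {s : ℂ | 1 / 2 < s.re} :=
  isOpen_lt continuous_const Complex.continuous_re

/-- RH makes (s-1)ζ(s) zero-free on a convex, hence simply connected, half-plane, so a continuous
logarithm exists. On the real axis its imaginary part is a continuous multiple of π, hence constant;
subtracting the value at 1 makes it zero. -/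
theorem exists_isLogZetaReg (hRH : RiemannHypothesis) : ∃ ℓ, IsLogZetaReg ℓ := by
  have hconv : Convex ℝ {s : ℂ | 1 / 2 < s.re} := convex_halfSpace_re_gt _
  have hsc : IsSimplyConnected {s : ℂ | 1 / 2 < s.re} := by
    have := hconv.contractibleSpace ⟨1, by simp; norm_num⟩
    exact SimplyConnectedSpace.ofContractible _
  obtain ⟨h, hc, he⟩ := Complex.exists_continuousOn_eqOn_exp_comp hsc isOpen_half (g := zetaReg)
    (fun s hs => (differentiableAt_zetaReg (by have : 1 / 2 < s.re := hs; linarith)).continuousAt.continuousWithinAt)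
    (by rintro ⟨s, hs, h0⟩; exact zetaReg_ne_zero hRH hs h0)
  have hreal : ∀ x : ℝ, 1 / 2 < x → Real.sin (h x).im = 0 := by
    intro x hx
    have h1 : Complex.exp (h x) = zetaReg x := he (show (x : ℂ) ∈ {s : ℂ | 1 / 2 < s.re} by simpa using hx)
    have h2 := zetaReg_im_ofReal (show 0 < x by linarith)
    rw [← h1, Complex.exp_im] at h2
    exact (mul_eq_zero.mp h2).resolve_left (Real.exp_ne_zero _)
  have hcr : ContinuousOn (fun x : ℝ => (h x).im) (Ioi (1 / 2)) :=
    Complex.continuous_im.comp_continuousOn (hc.comp Complex.continuous_ofReal.continuousOn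
      fun x hx => by simpa using hx)
  have hconst : ∀ x : ℝ, 1 / 2 < x → (h x).im = (h (1 : ℝ)).im := fun x hx =>
    int_of_sin_eq_zero_constant isPreconnected_Ioi hcr (fun y hy => hreal y hy) hx
      (by norm_num : (1 : ℝ) ∈ Ioi (1 / 2 : ℝ))
  have h1 : Complex.exp (h 1) = 1 := by
    have : Complex.exp (h 1) = zetaReg 1 := he (show (1 : ℂ) ∈ {s : ℂ | 1 / 2 < s.re} by simp; norm_num)
    rw [this, zetaReg_one]
  have h1re : (h 1).re = 0 := by
    have := congrArg norm h1
    rw [Complex.norm_exp, norm_one, Real.exp_eq_one_iff] at this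
    exact this
  refine ⟨fun s => h s - h 1, fun s hs => ?_, fun s hs => ?_, fun x hx => ?_⟩
  · refine DifferentiableAt.sub_const ?_ _
    refine differentiableAt_of_exp_eq (hc.continuousAt (isOpen_half.mem_nhds hs))
      (differentiableAt_zetaReg (by linarith)) ?_
    filter_upwards [isOpen_half.mem_nhds hs] with z hz using he hz
  · rw [Complex.exp_sub, h1, div_one]
    exact he hs
  · have := hconst x hx
    rw [Complex.sub_im, this]
    simp

/-- The branch of `log ζ(s)` on `Re s > 1/2`, cut along `(1/2, 1]` and continuous from above
there (extended by zero). -/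
def logZeta (ℓ : ℂ → ℂ) (s : ℂ) : ℂ :=
  if 1 / 2 < s.re then ℓ s - Complex.log (s - 1) else 0

namespace IsLogZetaReg

variable {ℓ : ℂ → ℂ} (hℓ : IsLogZetaReg ℓ)
include hℓ

theorem hasDerivAt {s : ℂ} (hs : 1 / 2 < s.re) :
    HasDerivAt ℓ (deriv zetaReg s / zetaReg s) s := by
  have h1 := (hℓ.diff s hs).hasDerivAt
  have h2 : HasDerivAt (fun z => Complex.exp (ℓ z)) (Complex.exp (ℓ s) * deriv ℓ s) s := h1.cexp
  have hev : zetaReg =ᶠ[𝓝 s] fun z => Complex.exp (ℓ z) := by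
    filter_upwards [isOpen_half.mem_nhds hs] with z hz using (hℓ.exp_eq z hz).symm
  have h3 := (h2.congr_of_eventuallyEq hev).deriv
  rw [h3, ← hℓ.exp_eq s hs, mul_div_cancel_left₀ _ (Complex.exp_ne_zero _)]
  exact h1

theorem exp_logZeta {s : ℂ} (hs : 1 / 2 < s.re) (h1 : s ≠ 1) :
    Complex.exp (logZeta ℓ s) = riemannZeta s := by
  have h : s - 1 ≠ 0 := sub_ne_zero.mpr h1
  rw [logZeta, if_pos hs, Complex.exp_sub, hℓ.exp_eq s hs, zetaReg_eq (by linarith) h1,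
    Complex.exp_log h, mul_div_cancel_left₀ _ h]

theorem re_logZeta {s : ℂ} (hs : 1 / 2 < s.re) (h1 : s ≠ 1) :
    (logZeta ℓ s).re = Real.log ‖riemannZeta s‖ := by
  rw [← hℓ.exp_logZeta hs h1, Complex.norm_exp, Real.log_exp]

theorem zeta_ne_zero {s : ℂ} (hs : 1 / 2 < s.re) (h1 : s ≠ 1) : riemannZeta s ≠ 0 := by
  rw [← hℓ.exp_logZeta hs h1]; exact Complex.exp_ne_zero _

theorem hasDerivAt_logZeta {s : ℂ} (hs : 1 / 2 < s.re) (h1 : s - 1 ∈ Complex.slitPlane) :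
    HasDerivAt (logZeta ℓ) (deriv riemannZeta s / riemannZeta s) s := by
  have hne : s ≠ 1 := by rintro rfl; simp at h1
  have hev : logZeta ℓ =ᶠ[𝓝 s] fun z => ℓ z - Complex.log (z - 1) := by
    filter_upwards [isOpen_half.mem_nhds hs] with z hz
    have hz' : 1 / 2 < z.re := hz
    rw [logZeta, if_pos hz']
  have hd : DifferentiableAt ℂ (logZeta ℓ) s := by
    refine DifferentiableAt.congr_of_eventuallyEq ?_ hev
    exact (hℓ.diff s hs).sub ((differentiableAt_id.sub_const 1).clog h1)
  have hev2 : riemannZeta =ᶠ[𝓝 s] fun z => Complex.exp (logZeta ℓ z) := by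
    filter_upwards [isOpen_half.mem_nhds hs, isOpen_ne.mem_nhds hne] with z hz hz1
    exact (hℓ.exp_logZeta hz hz1).symm
  have h2 : HasDerivAt (fun z => Complex.exp (logZeta ℓ z))
    (Complex.exp (logZeta ℓ s) * deriv (logZeta ℓ) s) s := hd.hasDerivAt.cexp
  rw [(h2.congr_of_eventuallyEq hev2).deriv, hℓ.exp_logZeta hs hne,
    mul_div_cancel_left₀ _ (hℓ.zeta_ne_zero hs hne)]
  exact hd.hasDerivAt

theorem im_logZeta_of_one_lt {x : ℝ} (hx : 1 < x) : (logZeta ℓ x).im = 0 := by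
  have h : (1 / 2 : ℝ) < (x : ℂ).re := by simp; linarith
  rw [logZeta, if_pos h, Complex.sub_im, hℓ.im_eq x (by linarith), Complex.log_im]
  have e : (x : ℂ) - 1 = ((x - 1 : ℝ) : ℂ) := by push_cast; ring
  rw [e, Complex.arg_ofReal_of_nonneg (by linarith)]
  simp

/-- On the cut the principal argument of s - 1 is π, the limit from above. This -π is the source of
the constants δ_{2k}. -/
theorem im_logZeta_of_lt_one {x : ℝ} (h0 : 1 / 2 < x) (hx : x < 1) : (logZeta ℓ x).im = -π := by
  have h : (1 / 2 : ℝ) < (x : ℂ).re := by simpa using h0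
  rw [logZeta, if_pos h, Complex.sub_im, hℓ.im_eq x h0, Complex.log_im]
  have e : (x : ℂ) - 1 = ((x - 1 : ℝ) : ℂ) := by push_cast; ring
  rw [e, Complex.arg_ofReal_of_neg (by linarith)]
  simp

end IsLogZetaReg

/-! ### Bounds for log ζ: decay to the right, growth at the critical line -/

/-- The Dirichlet series of Λ starts at n = 2 and log n ≥ 1/2, so moving from abscissa 3/2 to σ
costs each term at least e^(-(σ-3/2)/2); this explains the factor e^(3/4). -/
theorem exists_norm_logDeriv_zeta_le :
    ∃ C, 0 ≤ C ∧ ∀ s : ℂ, 3 / 2 ≤ s.re →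
      ‖deriv riemannZeta s / riemannZeta s‖ ≤ C * Real.exp (-s.re / 2) := by
  have hsum := ArithmeticFunction.LSeriesSummable_vonMangoldt (s := (3 / 2 : ℂ)) (by norm_num)
  have hre : (3 / 2 : ℂ).re = 3 / 2 := by norm_num
  refine ⟨(∑' n, ‖LSeries.term (fun n => (ArithmeticFunction.vonMangoldt n : ℂ)) (3 / 2) n‖) * Real.exp (3 / 4),
    by positivity, fun s hs => ?_⟩
  have h1 := ArithmeticFunction.LSeries_vonMangoldt_eq_deriv_riemannZeta_div (s := s) (by linarith)
  rw [neg_div] at h1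
  rw [← norm_neg, ← h1, LSeries, mul_assoc, ← tsum_mul_right, ← Real.exp_add]
  refine tsum_of_norm_bounded (hsum.norm.mul_right _).hasSum fun n => ?_
  rcases Nat.eq_zero_or_pos n with rfl | hn
  · simp
  rcases eq_or_ne n 1 with rfl | hn1
  · simp [LSeries.term]
  · have hn2 : (2 : ℝ) ≤ n := by
      have : 2 ≤ n := by omega
      exact_mod_cast this
    have hn0 : (0 : ℝ) < n := by linarith
    rw [LSeries.norm_term_eq, LSeries.norm_term_eq, if_neg hn.ne', if_neg hn.ne', hre,
      div_mul_eq_mul_div, div_le_div_iff₀ (by positivity) (by positivity), mul_assoc]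
    gcongr
    rw [Real.rpow_def_of_pos hn0, Real.rpow_def_of_pos hn0, ← Real.exp_add, Real.exp_le_exp]
    have hl : 1 / 2 ≤ Real.log n := by
      have := Real.log_le_log (by norm_num) hn2
      linarith [Real.log_two_gt_d9]
    nlinarith

theorem slit_of_im_pos {s : ℂ} (h : s.im ≠ 0) : s - 1 ∈ Complex.slitPlane :=
  Complex.mem_slitPlane_iff.mpr (Or.inr (by simpa using h))

theorem slit_of_one_lt {s : ℂ} (h : 1 < s.re) : s - 1 ∈ Complex.slitPlane :=
  Complex.mem_slitPlane_iff.mpr (Or.inl (by simpa using h))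

theorem hasDerivAt_comp_horizontal {f : ℂ → ℂ} {f' : ℂ} {x t : ℝ}
    (h : HasDerivAt f f' (x + t * Complex.I)) :
    HasDerivAt (fun y : ℝ => f (y + t * Complex.I)) f' x := by
  have h1 : HasDerivAt (fun y : ℝ => (y : ℂ) + t * Complex.I) 1 x :=
    (Complex.ofRealCLM.hasDerivAt).add_const _
  have := h.scomp x h1
  simpa using! this

theorem continuousAt_logDeriv_zeta {s : ℂ} (h1 : s ≠ 1) (h : riemannZeta s ≠ 0) :
    ContinuousAt (fun s => deriv riemannZeta s / riemannZeta s) s := by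
  have han := analyticOn_riemannZeta s h1
  exact han.deriv.continuousAt.div han.continuousAt h

/-- The branch tends to 0 at +∞, so it is recovered by integrating ζ'/ζ from infinity along a
horizontal ray; 2C is the integral constant of C e^(-x/2). -/
theorem IsLogZetaReg.exists_norm_logZeta_le {ℓ : ℂ → ℂ} (hℓ : IsLogZetaReg ℓ) :
    ∃ C, 0 ≤ C ∧ ∀ s : ℂ, 3 / 2 ≤ s.re → ‖logZeta ℓ s‖ ≤ C * Real.exp (-s.re / 2) := by
  obtain ⟨C, hC0, hC⟩ := exists_norm_logDeriv_zeta_le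
  have hexp : ∀ D : ℝ, Tendsto (fun b : ℝ => D * Real.exp (-b / 2)) atTop (𝓝 0) := by
    intro D
    have h1 : Tendsto (fun b : ℝ => -b / 2) atTop atBot := by
      have := tendsto_neg_atTop_atBot.comp (tendsto_id.atTop_div_const (show (0 : ℝ) < 2 by norm_num))
      refine this.congr fun b => ?_
      simp [neg_div]
    simpa using (Real.tendsto_exp_atBot.comp h1).const_mul D
  have hreal : Tendsto (fun b : ℝ => logZeta ℓ b) atTop (𝓝 0) := by
    have h1 : Tendsto (fun b : ℝ => riemannZeta b) atTop (𝓝 1) := by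
      have h2 := LSeries.tendsto_atTop (f := 1) (by
        rw [LSeries.abscissaOfAbsConv_one]; exact EReal.coe_lt_top 1)
      refine h2.congr' ?_
      filter_upwards [eventually_gt_atTop 1] with b hb
      exact LSeries_one_eq_riemannZeta (by simpa using hb)
    have h2 : Tendsto (fun b : ℝ => ((Real.log ‖riemannZeta b‖ : ℝ) : ℂ)) atTop (𝓝 0) := by
      have h3 := (Real.continuousAt_log (x := 1) one_ne_zero).tendsto.comp
        (by simpa using h1.norm : Tendsto (fun b : ℝ => ‖riemannZeta b‖) atTop (𝓝 1))
      rw [Real.log_one] at h3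
      exact_mod_cast (Complex.continuous_ofReal.tendsto 0).comp h3
    refine h2.congr' ?_
    filter_upwards [eventually_gt_atTop 1] with b hb
    have hb1 : (b : ℂ) ≠ 1 := by exact_mod_cast hb.ne'
    apply Complex.ext
    · rw [Complex.ofReal_re, hℓ.re_logZeta (by simp; linarith) hb1]
    · rw [Complex.ofReal_im, hℓ.im_logZeta_of_one_lt hb]
  -- On the real axis ζ → 1 and the branch is real, so it tends to 0; a vertical move of length |t|
  -- changes it by an exponentially small amount.
  have hzero : ∀ t : ℝ, Tendsto (fun b : ℝ => logZeta ℓ (b + t * Complex.I)) atTop (𝓝 0) := by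
    intro t
    have h1 : Tendsto (fun b : ℝ => logZeta ℓ (b + t * Complex.I) - logZeta ℓ b) atTop (𝓝 0) := by
      refine squeeze_zero_norm' ?_ (hexp (C * |t|))
      filter_upwards [eventually_ge_atTop (3 / 2)] with b hb
      have hmv := (convex_halfSpace_re_ge b).norm_image_sub_le_of_norm_hasDerivWithin_le
        (f := logZeta ℓ) (f' := fun s => deriv riemannZeta s / riemannZeta s)
        (C := C * Real.exp (-b / 2))
        (fun s hs => (hℓ.hasDerivAt_logZeta (by have : b ≤ s.re := hs; linarith)
          (slit_of_one_lt (by have : b ≤ s.re := hs; linarith))).hasDerivWithinAt)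
        (fun s hs => by
          have hs' : b ≤ s.re := hs
          refine (hC s (by linarith)).trans ?_
          gcongr)
        (x := (b : ℂ)) (y := b + t * Complex.I) (by simp) (by simp)
      refine hmv.trans (le_of_eq ?_)
      simp
      ring
    simpa using h1.add hreal
  refine ⟨2 * C, by positivity, fun s hs => ?_⟩
  have hseq : ∀ b : ℝ, s.re ≤ b →
      ‖logZeta ℓ (b + s.im * Complex.I) - logZeta ℓ s‖ ≤ 2 * C * Real.exp (-s.re / 2) := by
    intro b hb
    have hd : ∀ x ∈ uIcc s.re b, HasDerivAt (fun y : ℝ => logZeta ℓ (y + s.im * Complex.I))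
        (deriv riemannZeta (x + s.im * Complex.I) / riemannZeta (x + s.im * Complex.I)) x := by
      intro x hx
      rw [uIcc_of_le hb] at hx
      have := hx.1
      exact hasDerivAt_comp_horizontal (hℓ.hasDerivAt_logZeta (by simp; linarith)
        (slit_of_one_lt (by simp; linarith)))
    have hcont : ContinuousOn (fun x : ℝ => deriv riemannZeta (x + s.im * Complex.I)
        / riemannZeta (x + s.im * Complex.I)) (uIcc s.re b) := by
      intro x hx
      rw [uIcc_of_le hb] at hx
      have hx1 : 1 < ((x : ℂ) + s.im * Complex.I).re := by simp; linarith [hx.1]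
      have hne : (x : ℂ) + s.im * Complex.I ≠ 1 := by
        intro h; rw [h] at hx1; simp at hx1
      have := continuousAt_logDeriv_zeta hne (riemannZeta_ne_zero_of_one_le_re hx1.le)
      exact (ContinuousAt.comp (f := fun x : ℝ => (x : ℂ) + s.im * Complex.I) this
        (by fun_prop)).continuousWithinAt
    have hint := intervalIntegral.integral_eq_sub_of_hasDerivAt hd hcont.intervalIntegrable
    have e : (s.re : ℂ) + s.im * Complex.I = s := Complex.re_add_im s
    rw [e] at hint
    rw [← hint]
    have hdE : ∀ x ∈ uIcc s.re b, HasDerivAt (fun x => -(2 * C) * Real.exp (-x / 2))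
        (C * Real.exp (-x / 2)) x := by
      intro x _
      have := (((hasDerivAt_id x).neg.div_const 2).exp).const_mul (-(2 * C))
      convert! this using 1
      simp
      ring
    have hE := intervalIntegral.integral_eq_sub_of_hasDerivAt hdE
      ((by fun_prop : Continuous fun x => C * Real.exp (-x / 2)).intervalIntegrable _ _)
    calc _ ≤ ∫ x in s.re..b, C * Real.exp (-x / 2) := by
          refine intervalIntegral.norm_integral_le_of_norm_le hb ?_
            ((by fun_prop : Continuous fun x => C * Real.exp (-x / 2)).intervalIntegrable _ _)
          refine Eventually.of_forall fun x hx => ?_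
          have := hC (x + s.im * Complex.I) (by simp; linarith [hx.1])
          simpa using this
      _ = -(2 * C) * Real.exp (-b / 2) - -(2 * C) * Real.exp (-s.re / 2) := hE
      _ ≤ _ := by
          have := Real.exp_pos (-b / 2)
          nlinarith
  have hlim := ((hzero s.im).sub_const (logZeta ℓ s)).norm
  rw [zero_sub, norm_neg] at hlim
  exact le_of_tendsto hlim ((eventually_ge_atTop s.re).mono hseq)

theorem continuous_pt : Continuous fun p : ℝ × ℝ => pt p.1 p.2 := by
  unfold pt; fun_prop

theorem hasDerivAt_comp_pt {f : ℂ → ℂ} {f' : ℂ} {u t : ℝ} (h : HasDerivAt f f' (pt u t)) :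
    HasDerivAt (fun v => f (pt v t)) f' u := by
  have h1 : HasDerivAt (fun y : ℝ => f (y + t * Complex.I)) f' (1 / 2 + u) :=
    hasDerivAt_comp_horizontal h
  have h2 := h1.scomp u ((hasDerivAt_id u).const_add (1 / 2))
  rw [one_smul] at h2
  exact h2.congr_of_eventuallyEq (Eventually.of_forall fun v => by simp [pt])

theorem exists_bound_pt {g : ℂ → ℂ} {a b T : ℝ}
    (hg : ∀ u ∈ Icc a b, ∀ t ∈ Icc (-T) T, ContinuousAt g (pt u t)) :
    ∃ C, 0 ≤ C ∧ ∀ u ∈ Icc a b, ∀ t, |t| ≤ T → ‖g (pt u t)‖ ≤ C := by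
  have hc : ContinuousOn (fun p : ℝ × ℝ => g (pt p.1 p.2)) (Icc a b ×ˢ Icc (-T) T) := by
    intro p hp
    exact (ContinuousAt.comp (f := fun p : ℝ × ℝ => pt p.1 p.2) (hg p.1 hp.1 p.2 hp.2)
      continuous_pt.continuousAt).continuousWithinAt
  obtain ⟨C, hC⟩ := (isCompact_Icc.prod isCompact_Icc).exists_bound_of_continuousOn hc
  exact ⟨max C 0, le_max_right _ _, fun u hu t ht =>
    (hC (u, t) ⟨hu, abs_le.mp ht⟩).trans (le_max_left _ _)⟩

theorem tsum_mult_sub_le (hRH : RiemannHypothesis) {T t : ℝ} (ht : |t| ≤ T) :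
    ∑' ρ : nontrivialZeros, mult ρ * (1 / (1 + (t - (ρ : ℂ).im) ^ 2))
      ≤ 2 * (3 / 2 + T) ^ 2 * ∑' ρ : nontrivialZeros, mult ρ / (1 + ‖(ρ : ℂ)‖) ^ 2 := by
  rw [← tsum_mul_left]
  exact (summable_mult_sub hRH t).tsum_le_tsum (mult_div_le hRH ht) (summable_mult_div.mul_left _)

theorem continuousAt_xiL {s : ℂ} (h : xi s ≠ 0) : ContinuousAt xiL s :=
  (differentiable_xi.analyticAt s).deriv.continuousAt.div differentiable_xi.continuous.continuousAt h

/-- Comparison with the abscissa u = 1: each difference of fractions is at most 1/(u(1+x²)), because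
√(u²+x²) ≥ u√(1+x²) for u ≤ 1. -/
theorem exists_norm_xiL_le (hRH : RiemannHypothesis) (T : ℝ) :
    ∃ C, 0 ≤ C ∧ ∀ u, 0 < u → u ≤ 1 → ∀ t, |t| ≤ T → ‖xiL (pt u t)‖ ≤ C / u := by
  obtain ⟨C₁, hC₁, h1⟩ := exists_bound_pt (g := xiL) (a := 1) (b := 1) (T := T)
    fun u hu t _ => continuousAt_xiL (xi_ne_zero hRH (by simp; linarith [hu.1]))
  set B := 2 * (3 / 2 + T) ^ 2 * ∑' ρ : nontrivialZeros, mult ρ / (1 + ‖(ρ : ℂ)‖) ^ 2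
  have hB : 0 ≤ B := mul_nonneg (by positivity)
    (tsum_nonneg fun ρ => div_nonneg (mult_nonneg ρ) (by positivity))
  refine ⟨C₁ + B, by positivity, fun u hu0 hu1 t ht => ?_⟩
  have hd : ‖xiL (pt u t) - xiL (pt 1 t)‖ ≤ B / u := by
    have hs := hasSum_logDeriv_xi_sub (z := pt u t) (w := pt 1 t)
      (xi_ne_zero hRH (by simpa using hu0)) (xi_ne_zero hRH (by simp))
    rw [xiL, xiL, ← hs.tsum_eq]
    have hb := (summable_mult_sub hRH t).hasSum.mul_left (1 / u)
    refine (tsum_of_norm_bounded hb fun ρ => ?_).trans ?_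
    · set x := t - (ρ : ℂ).im with hx
      have hre := re_eq_half hRH ρ.2
      have hn : ∀ v : ℝ, ‖pt v t - ρ‖ = √(v ^ 2 + x ^ 2) := by
        intro v
        rw [Complex.norm_eq_sqrt_sq_add_sq]
        simp [hre, hx]
      have hpos : ∀ v : ℝ, 0 < v → 0 < √(v ^ 2 + x ^ 2) := fun v hv => by positivity
      have hz : pt u t - ρ ≠ 0 := norm_pos_iff.mp (by rw [hn]; exact hpos u hu0)
      have hw : pt 1 t - ρ ≠ 0 := norm_pos_iff.mp (by rw [hn]; exact hpos 1 one_pos)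
      have e : 1 / (pt u t - ρ) - 1 / (pt 1 t - ρ) = ((1 - u : ℝ) : ℂ) / ((pt u t - ρ) * (pt 1 t - ρ)) := by
        have : pt 1 t - pt u t = ((1 - u : ℝ) : ℂ) := by simp [pt]
        rw [← this]
        field_simp
        ring
      rw [norm_mul, e, norm_div, norm_mul, hn, hn, Complex.norm_real, Complex.norm_real,
        Real.norm_of_nonneg (mult_nonneg ρ), Real.norm_of_nonneg (by linarith)]
      have h2 : u * √(1 ^ 2 + x ^ 2) ≤ √(u ^ 2 + x ^ 2) := by
        rw [Real.le_sqrt (by positivity) (by positivity), mul_pow, Real.sq_sqrt (by positivity)]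
        nlinarith [sq_nonneg x, mul_nonneg (sq_nonneg x) (by nlinarith : 0 ≤ 1 - u ^ 2)]
      have h3 : √(1 ^ 2 + x ^ 2) * √(1 ^ 2 + x ^ 2) = 1 + x ^ 2 := by
        rw [Real.mul_self_sqrt (by positivity)]; ring
      calc mult ρ * ((1 - u) / (√(u ^ 2 + x ^ 2) * √(1 ^ 2 + x ^ 2)))
          ≤ mult ρ * (1 / ((u * √(1 ^ 2 + x ^ 2)) * √(1 ^ 2 + x ^ 2))) := by
            have := mult_nonneg ρ
            have := hpos 1 one_pos
            gcongr
            linarith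
        _ = 1 / u * (mult ρ * (1 / (1 + x ^ 2))) := by
            rw [mul_assoc, h3]
            field_simp
    · rw [one_div, div_eq_inv_mul]
      exact mul_le_mul_of_nonneg_left (tsum_mult_sub_le hRH ht) (by positivity)
  have h2 := h1 1 (by simp) t ht
  have h3 : ‖xiL (pt u t)‖ ≤ ‖xiL (pt u t) - xiL (pt 1 t)‖ + ‖xiL (pt 1 t)‖ := by
    have := norm_add_le (xiL (pt u t) - xiL (pt 1 t)) (xiL (pt 1 t))
    simpa using this
  have h4 : C₁ ≤ C₁ / u := by
    rw [le_div_iff₀ hu0]; nlinarith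
  rw [add_div]
  linarith

/-- Uniform in u, unlike what integrating the C/u bound would give: the summands have bounded L¹
norms down to the critical line. This keeps arg ζ bounded as u → 0. -/
theorem abs_integral_im_xiL_le (hRH : RiemannHypothesis) {u : ℝ} (hu0 : 0 < u) (hu1 : u ≤ 1) (t : ℝ) :
    |∫ v in u..1, ((xiL (pt v t)).im - (xiL (pt 1 t)).im)|
      ≤ 2 * ∑' ρ : nontrivialZeros, mult ρ * (1 / (1 + (t - (ρ : ℂ).im) ^ 2)) := by
  let G : nontrivialZeros → ℝ → ℝ := fun ρ v => mult ρ *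
    -((t - (ρ : ℂ).im) / (v ^ 2 + (t - (ρ : ℂ).im) ^ 2) - (t - (ρ : ℂ).im) / (1 + (t - (ρ : ℂ).im) ^ 2))
  have hi : ∀ (ρ : nontrivialZeros) (a : ℝ), IntervalIntegrable (G ρ) volume a 1 := by
    intro ρ a
    have := integrable_div_sub_div (t - (ρ : ℂ).im) (n := 0) (a := a)
    simp only [pow_zero, one_mul] at this
    exact this.neg.const_mul _
  have hint : ∀ ρ, Integrable (G ρ) (volume.restrict (Ioc u 1)) := fun ρ => (hi ρ u).1
  have hnorm : ∀ ρ, ∫ v in Ioc u 1, ‖G ρ v‖ ≤ 2 * (mult ρ * (1 / (1 + (t - (ρ : ℂ).im) ^ 2))) := by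
    intro ρ
    calc ∫ v in Ioc u 1, ‖G ρ v‖ ≤ ∫ v in Ioc 0 1, ‖G ρ v‖ :=
          setIntegral_mono_set (hi ρ 0).norm.1 (Eventually.of_forall fun _ => norm_nonneg _)
            (Ioc_subset_Ioc_left hu0.le).eventuallyLE
      _ = mult ρ * ∫ v in (0 : ℝ)..1, |(t - (ρ : ℂ).im) / (v ^ 2 + (t - (ρ : ℂ).im) ^ 2)
            - (t - (ρ : ℂ).im) / (1 + (t - (ρ : ℂ).im) ^ 2)| := by
          rw [intervalIntegral.integral_of_le zero_le_one, ← integral_const_mul]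
          refine integral_congr_ae (Eventually.of_forall fun v => ?_)
          simp only [G, norm_mul, norm_neg, Real.norm_eq_abs, abs_of_nonneg (mult_nonneg ρ)]
      _ ≤ mult ρ * (2 / (1 + (t - (ρ : ℂ).im) ^ 2)) :=
          mul_le_mul_of_nonneg_left (integral_abs_div_sub_div_le _) (mult_nonneg ρ)
      _ = _ := by ring
  have hsum : Summable fun ρ => ∫ v in Ioc u 1, ‖G ρ v‖ :=
    Summable.of_nonneg_of_le (fun ρ => integral_nonneg fun _ => norm_nonneg _) hnorm
      ((summable_mult_sub hRH t).mul_left 2)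
  have h := hasSum_integral_of_summable_integral_norm hint hsum
  have e : ∫ v in u..1, ((xiL (pt v t)).im - (xiL (pt 1 t)).im) = ∫ v in Ioc u 1, ∑' ρ, G ρ v := by
    rw [intervalIntegral.integral_of_le hu1]
    refine setIntegral_congr_fun measurableSet_Ioc fun v hv => ?_
    exact (hasSum_im_xiL hRH (hu0.trans hv.1) t).tsum_eq.symm
  rw [e, ← h.tsum_eq, ← tsum_mul_left]
  exact tsum_of_norm_bounded ((summable_mult_sub hRH t).mul_left 2).hasSum fun ρ =>
    (norm_integral_le_integral_norm _).trans (hnorm ρ)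

/-- The part of the logarithmic derivative of `(s - 1) ζ(s)` that comes from `s Γ_ℝ(s)`. -/
def gammaPart (s : ℂ) : ℂ := 1 / s + deriv Complex.Gammaℝ s / Complex.Gammaℝ s

theorem continuousAt_gammaPart {s : ℂ} (hs : 0 < s.re) : ContinuousAt gammaPart s := by
  have h0 : s ≠ 0 := by rintro rfl; simp at hs
  have hU : IsOpen {z : ℂ | 0 < z.re} := isOpen_lt continuous_const Complex.continuous_re
  have hG : AnalyticAt ℂ Complex.Gammaℝ s :=
    (DifferentiableOn.analyticAt (s := {z : ℂ | 0 < z.re})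
      (fun z hz => (differentiableAt_Gammaℝ hz).differentiableWithinAt) (hU.mem_nhds hs))
  exact (continuousAt_const.div continuousAt_id h0).add
    (hG.deriv.continuousAt.div hG.continuousAt (Complex.Gammaℝ_ne_zero_of_re_pos hs))

theorem deriv_zetaReg_div' (hRH : RiemannHypothesis) {s : ℂ} (hs : 1 / 2 < s.re) :
    deriv zetaReg s / zetaReg s = xiL s - gammaPart s := by
  rw [deriv_zetaReg_div (by linarith) (xi_ne_zero hRH hs), gammaPart]; ring

theorem integral_eq_sub_pt (hRH : RiemannHypothesis) {ℓ : ℂ → ℂ} (hℓ : IsLogZetaReg ℓ) {u : ℝ}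
    (hu0 : 0 < u) (hu1 : u ≤ 1) (t : ℝ) :
    ∫ v in u..1, (xiL (pt v t) - gammaPart (pt v t)) = ℓ (pt 1 t) - ℓ (pt u t) := by
  refine intervalIntegral.integral_eq_sub_of_hasDerivAt (f := fun v => ℓ (pt v t)) (fun v hv => ?_)
    (ContinuousOn.intervalIntegrable fun v hv => ?_)
  all_goals
    rw [uIcc_of_le hu1] at hv
    have hv0 : 0 < v := hu0.trans_le hv.1
    have hre : 1 / 2 < (pt v t).re := by simpa using hv0
  · rw [← deriv_zetaReg_div' hRH hre]
    exact hasDerivAt_comp_pt (hℓ.hasDerivAt hre)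
  · have hc := (continuousAt_xiL (xi_ne_zero hRH hre)).sub (continuousAt_gammaPart (by linarith))
    exact (ContinuousAt.comp (f := fun v : ℝ => pt v t) hc
      (by unfold pt; fun_prop)).continuousWithinAt

/-- Integration from u to 1 of the logarithmic derivative: the C/u bound gives the logarithm for the
modulus, the uniform integral bound controls the imaginary part. -/
theorem exists_norm_logZetaReg_le (hRH : RiemannHypothesis) {ℓ : ℂ → ℂ} (hℓ : IsLogZetaReg ℓ)
    (T : ℝ) :
    ∃ C, 0 ≤ C ∧ ∀ u, 0 < u → u ≤ 1 → ∀ t, |t| ≤ T →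
      ‖ℓ (pt u t)‖ ≤ C * (1 + |Real.log u|) ∧ |(ℓ (pt u t)).im| ≤ C := by
  obtain ⟨C₁, hC₁, h1⟩ := exists_norm_xiL_le hRH T
  obtain ⟨C₂, hC₂, h2⟩ := exists_bound_pt (g := gammaPart) (a := 0) (b := 1) (T := T)
    fun u hu t _ => continuousAt_gammaPart (by simp; linarith [hu.1])
  obtain ⟨C₃, hC₃, h3⟩ := exists_bound_pt (g := ℓ) (a := 1) (b := 1) (T := T)
    fun u hu t _ => (hℓ.diff _ (by simp; linarith [hu.1])).continuousAt
  set B := 2 * (3 / 2 + T) ^ 2 * ∑' ρ : nontrivialZeros, mult ρ / (1 + ‖(ρ : ℂ)‖) ^ 2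
  have hB : 0 ≤ B := mul_nonneg (by positivity)
    (tsum_nonneg fun ρ => div_nonneg (mult_nonneg ρ) (by positivity))
  refine ⟨C₃ + C₂ + C₁ + 2 * B, by positivity, fun u hu0 hu1 t ht => ⟨?_, ?_⟩⟩
  · have hI : ‖∫ v in u..1, (xiL (pt v t) - gammaPart (pt v t))‖ ≤ ∫ v in u..1, (C₁ * v⁻¹ + C₂) := by
      refine intervalIntegral.norm_integral_le_of_norm_le hu1 (Eventually.of_forall fun v hv => ?_) ?_
      · refine (norm_sub_le _ _).trans (add_le_add ?_ (h2 v ⟨(hu0.trans hv.1).le, hv.2⟩ t ht))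
        rw [← div_eq_mul_inv]
        exact h1 v (hu0.trans hv.1) hv.2 t ht
      · refine ContinuousOn.intervalIntegrable fun v hv => ?_
        rw [uIcc_of_le hu1] at hv
        have : v ≠ 0 := (hu0.trans_le hv.1).ne'
        exact ContinuousAt.continuousWithinAt (by fun_prop (disch := assumption))
    have hii : IntervalIntegrable (fun v : ℝ => C₁ * v⁻¹) volume u 1 := by
      refine (intervalIntegral.intervalIntegrable_inv (fun v hv => ?_) continuousOn_id).const_mul _
      rw [uIcc_of_le hu1] at hv
      exact (hu0.trans_le hv.1).ne'
    rw [intervalIntegral.integral_add hii intervalIntegrable_const,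
      intervalIntegral.integral_const_mul, integral_inv_of_pos hu0 one_pos,
      intervalIntegral.integral_const, integral_eq_sub_pt hRH hℓ hu0 hu1 t, one_div, Real.log_inv,
      smul_eq_mul] at hI
    have h4 := h3 1 (by simp) t ht
    have h5 : ‖ℓ (pt u t)‖ ≤ ‖ℓ (pt 1 t)‖ + ‖ℓ (pt 1 t) - ℓ (pt u t)‖ := by
      have := norm_sub_le (ℓ (pt 1 t)) (ℓ (pt 1 t) - ℓ (pt u t))
      simpa using this
    have h6 : -Real.log u ≤ |Real.log u| := neg_le_abs _
    have h7 := abs_nonneg (Real.log u)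
    nlinarith
  · have e := congrArg Complex.im (integral_eq_sub_pt hRH hℓ hu0 hu1 t)
    have hcx : ∀ v ∈ Icc u 1, ContinuousAt (fun v => xiL (pt v t)) v := fun v hv =>
      ContinuousAt.comp (f := fun v : ℝ => pt v t)
        (continuousAt_xiL (xi_ne_zero hRH (by simpa using hu0.trans_le hv.1))) (by unfold pt; fun_prop)
    have hcg : ∀ v ∈ Icc u 1, ContinuousAt (fun v => gammaPart (pt v t)) v := fun v hv =>
      ContinuousAt.comp (f := fun v : ℝ => pt v t)
        (continuousAt_gammaPart (by simp; linarith [hv.1])) (by unfold pt; fun_prop)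
    have hix : IntervalIntegrable (fun v => xiL (pt v t)) volume u 1 :=
      ContinuousOn.intervalIntegrable (fun v hv => (hcx v (by rwa [uIcc_of_le hu1] at hv)).continuousWithinAt)
    have hig : IntervalIntegrable (fun v => gammaPart (pt v t)) volume u 1 :=
      ContinuousOn.intervalIntegrable (fun v hv => (hcg v (by rwa [uIcc_of_le hu1] at hv)).continuousWithinAt)
    have him : ∀ {f : ℝ → ℂ}, IntervalIntegrable f volume u 1 →
        (∫ v in u..1, f v).im = ∫ v in u..1, (f v).im := fun hf =>
      (Complex.imCLM.intervalIntegral_comp_comm hf).symm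
    rw [intervalIntegral.integral_sub hix hig, Complex.sub_im, Complex.sub_im, him hix] at e
    have h4 := abs_integral_im_xiL_le hRH hu0 hu1 t
    have himx : IntervalIntegrable (fun v => (xiL (pt v t)).im) volume u 1 :=
      ContinuousOn.intervalIntegrable (fun v hv => (Complex.continuous_im.continuousAt.comp
        (hcx v (by rwa [uIcc_of_le hu1] at hv))).continuousWithinAt)
    rw [intervalIntegral.integral_sub himx intervalIntegrable_const, intervalIntegral.integral_const,
      smul_eq_mul] at h4
    have h5 : 2 * ∑' ρ : nontrivialZeros, mult ρ * (1 / (1 + (t - (ρ : ℂ).im) ^ 2)) ≤ 2 * B :=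
      mul_le_mul_of_nonneg_left (tsum_mult_sub_le hRH ht) zero_le_two
    have h6 : |(∫ v in u..1, gammaPart (pt v t)).im| ≤ C₂ := by
      refine (Complex.abs_im_le_norm _).trans ?_
      have := intervalIntegral.norm_integral_le_of_norm_le_const (a := u) (b := 1)
        (f := fun v => gammaPart (pt v t)) (C := C₂) fun v hv => by
          rw [uIoc_of_le hu1] at hv
          exact h2 v ⟨(hu0.trans hv.1).le, hv.2⟩ t ht
      refine this.trans ?_
      rw [abs_of_nonneg (by linarith)]
      nlinarith
    have h7 : |(1 - u) * (xiL (pt 1 t)).im| ≤ C₁ := by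
      rw [abs_mul, abs_of_nonneg (by linarith)]
      have := (Complex.abs_im_le_norm _).trans (h1 1 one_pos le_rfl t ht)
      rw [div_one] at this
      nlinarith [abs_nonneg (xiL (pt 1 t)).im]
    have h8 : |(ℓ (pt 1 t)).im| ≤ C₃ := (Complex.abs_im_le_norm _).trans (h3 1 (by simp) t ht)
    rw [abs_le] at h4 h6 h7 h8 ⊢
    constructor <;> linarith [h4.1, h4.2, h6.1, h6.2, h7.1, h7.2, h8.1, h8.2]

theorem exists_im_logZeta_le (hRH : RiemannHypothesis) {ℓ : ℂ → ℂ} (hℓ : IsLogZetaReg ℓ) (T : ℝ) :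
    ∃ C, 0 ≤ C ∧ ∀ u, 0 < u → u ≤ 1 → ∀ t, |t| ≤ T → |(logZeta ℓ (pt u t)).im| ≤ C := by
  obtain ⟨C, hC, h⟩ := exists_norm_logZetaReg_le hRH hℓ T
  refine ⟨C + π, by positivity, fun u hu0 hu1 t ht => ?_⟩
  rw [logZeta, if_pos (by simpa using hu0), Complex.sub_im, Complex.log_im]
  exact (abs_sub _ _).trans (add_le_add (h u hu0 hu1 t ht).2 (Complex.abs_arg_le_pi _))

/-- One majorant for all |t| ≤ T with every moment finite: |log u| for the critical line, |log(u -
1/2)| for the pole at s = 1, and exponential decay beyond u = 1. It feeds all uses of dominated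
convergence and Fubini below. -/
theorem exists_majorant (hRH : RiemannHypothesis) {ℓ : ℂ → ℂ} (hℓ : IsLogZetaReg ℓ) (T : ℝ) :
    ∃ b : ℝ → ℝ, (∀ u, 0 ≤ b u) ∧ (∀ k : ℕ, IntegrableOn (fun u => u ^ k * b u) (Ioi 0)) ∧
      ∀ u, 0 < u → u ≠ 1 / 2 → ∀ t, |t| ≤ T → ‖logZeta ℓ (pt u t)‖ ≤ b u := by
  obtain ⟨C₁, hC₁, h1⟩ := exists_norm_logZetaReg_le hRH hℓ T
  obtain ⟨C₂, hC₂, h2⟩ := hℓ.exists_norm_logZeta_le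
  set D := C₁ + 1 + (|Real.log (2 + T)| + π)
  have hpi := Real.pi_pos
  have hD : 0 ≤ D := by positivity
  let q : ℝ → ℝ := fun u => D * (1 + |Real.log u| + |Real.log (u - 1 / 2)|)
  have hq0 : ∀ u, 0 ≤ q u := fun u => by positivity
  refine ⟨fun u => (Iic (1 : ℝ)).indicator q u + C₂ * Real.exp (-u / 2), fun u => ?_, fun k => ?_,
    fun u hu0 hu t ht => ?_⟩
  · have : 0 ≤ (Iic (1 : ℝ)).indicator q u := indicator_nonneg (fun _ _ => hq0 _) _
    positivity
  · simp only [mul_add]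
    refine IntegrableOn.add ?_ ?_
    · have e : (fun u => u ^ k * (Iic (1 : ℝ)).indicator q u)
          = (Iic (1 : ℝ)).indicator fun u => u ^ k * q u := by
        funext u
        by_cases hu : u ∈ Iic (1 : ℝ) <;> simp [hu]
      rw [e, IntegrableOn, integrable_indicator_iff measurableSet_Iic, IntegrableOn,
        Measure.restrict_restrict measurableSet_Iic, inter_comm, Ioi_inter_Iic, ← IntegrableOn,
        ← intervalIntegrable_iff_integrableOn_Ioc_of_le zero_le_one]
      have hl1 : IntervalIntegrable Real.log volume 0 1 := intervalIntegral.intervalIntegrable_log'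
      have hl2 : IntervalIntegrable (fun u => Real.log (u - 1 / 2)) volume 0 1 := by
        have := (intervalIntegral.intervalIntegrable_log' (a := 0 - 1 / 2) (b := 1 - 1 / 2)).comp_sub_right (1 / 2)
        simpa using this
      exact (((intervalIntegrable_const.add hl1.abs).add hl2.abs).const_mul D).continuousOn_mul
        (by fun_prop)
    · have h3 := integrableOn_rpow_mul_exp_neg_mul_rpow (p := 1) (s := k) (b := 1 / 2)
        (by have : (0 : ℝ) ≤ k := by positivity
            linarith) one_pos (by norm_num)
      have h4 : IntegrableOn (fun u : ℝ => C₂ * (u ^ (k : ℝ) * Real.exp (-(1 / 2) * u ^ (1 : ℝ))))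
        (Ioi 0) := h3.const_mul C₂
      refine h4.congr_fun (fun u hu => ?_) measurableSet_Ioi
      simp only [Real.rpow_one, Real.rpow_natCast]
      rw [show -(1 / 2) * u = -u / 2 by ring]
      ring
  · have hexp := Real.exp_pos (-u / 2)
    show ‖logZeta ℓ (pt u t)‖ ≤ (Iic (1 : ℝ)).indicator q u + C₂ * Real.exp (-u / 2)
    rcases le_or_gt u 1 with hu1 | hu1
    · rw [indicator_of_mem (show u ∈ Iic (1 : ℝ) from hu1)]
      suffices h : ‖logZeta ℓ (pt u t)‖ ≤ q u by nlinarith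
      rw [logZeta, if_pos (by simpa using hu0)]
      have h3 := (h1 u hu0 hu1 t ht).1
      set z := pt u t - 1 with hz
      have hzre : z.re = u - 1 / 2 := by simp [hz]; ring
      have hzim : z.im = t := by simp [hz]
      have hlow : |u - 1 / 2| ≤ ‖z‖ := hzre ▸ Complex.abs_re_le_norm z
      have hpos : 0 < |u - 1 / 2| := abs_pos.mpr (sub_ne_zero.mpr hu)
      have hup : ‖z‖ ≤ 2 + T := by
        refine (Complex.norm_le_abs_re_add_abs_im z).trans ?_
        rw [hzre, hzim]
        have : |u - 1 / 2| ≤ 2 := by rw [abs_le]; constructor <;> linarith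
        linarith
      have hl1 : Real.log |u - 1 / 2| ≤ Real.log ‖z‖ := Real.log_le_log hpos hlow
      have hl2 : Real.log ‖z‖ ≤ Real.log (2 + T) := Real.log_le_log (hpos.trans_le hlow) hup
      rw [Real.log_abs] at hl1
      have hlz : |Real.log ‖z‖| ≤ |Real.log (u - 1 / 2)| + |Real.log (2 + T)| := by
        rw [abs_le]
        constructor
        · linarith [neg_abs_le (Real.log (u - 1 / 2)), abs_nonneg (Real.log (2 + T))]
        · linarith [le_abs_self (Real.log (2 + T)), abs_nonneg (Real.log (u - 1 / 2))]
      have h4 : ‖Complex.log z‖ ≤ |Real.log (u - 1 / 2)| + |Real.log (2 + T)| + π := by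
        refine (Complex.norm_le_abs_re_add_abs_im _).trans ?_
        rw [Complex.log_re, Complex.log_im]
        exact add_le_add hlz (Complex.abs_arg_le_pi _)
      have a1 := abs_nonneg (Real.log u)
      have a2 := abs_nonneg (Real.log (u - 1 / 2))
      have a3 := abs_nonneg (Real.log (2 + T))
      refine (norm_sub_le _ _).trans ((add_le_add h3 h4).trans ?_)
      simp only [q, D]
      nlinarith [mul_nonneg hC₁ a2, mul_nonneg (add_nonneg a3 hpi.le) a1,
        mul_nonneg (add_nonneg a3 hpi.le) a2]
    · rw [indicator_of_notMem (show u ∉ Iic (1 : ℝ) by simpa using hu1), zero_add]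
      refine (h2 _ (by simp; linarith)).trans ?_
      gcongr
      simp

/-! ### S(t) as the boundary value of Im log ζ -/

theorem argVariation_eq_im_sub {f : ℂ → ℂ} {a b : ℂ} {g : ℝ → ℂ} (hg : ContinuousOn g (Icc 0 1))
    (he : ∀ u ∈ Icc (0 : ℝ) 1, Complex.exp (g u) = f (a + u * (b - a))) :
    argVariation f a b = (g 1 - g 0).im := by
  rw [argVariation_eq (θ := fun u => (g u).im) ⟨Complex.continuous_im.comp_continuousOn hg, ?_⟩]
  · simp
  · intro u hu
    rw [← he u hu]
    exact Complex.exp_ne_zero _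
  · intro u hu
    rw [← he u hu, Complex.norm_exp, Complex.ofReal_exp, ← Complex.exp_add, Complex.re_add_im]

theorem countable_ordinates : {t : ℝ | IsZetaOrdinate t}.Countable := by
  refine (countable_zeros.image Complex.im).mono ?_
  rintro t ⟨ρ, h0, rfl⟩
  exact ⟨ρ, h0, rfl⟩

theorem ae_not_isZetaOrdinate : ∀ᵐ t : ℝ, ¬ IsZetaOrdinate t := by
  rw [ae_iff]
  simpa using countable_ordinates.measure_zero volume

theorem continuousAt_logDeriv_zeta_pt {ℓ : ℂ → ℂ} (hℓ : IsLogZetaReg ℓ) {u t : ℝ} (ht : t ≠ 0)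
    (h : 0 < u ∨ 0 ≤ u ∧ ¬ IsZetaOrdinate t) :
    ContinuousAt (fun v => deriv riemannZeta (pt v t) / riemannZeta (pt v t)) u := by
  have h1 : pt u t ≠ 1 := fun e => ht (by simpa using congrArg Complex.im e)
  have hz : riemannZeta (pt u t) ≠ 0 := by
    rcases h with h | h
    · exact hℓ.zeta_ne_zero (by simpa using h) h1
    · exact fun e => h.2 ⟨_, e, by simp⟩
  exact ContinuousAt.comp (f := fun v : ℝ => pt v t) (continuousAt_logDeriv_zeta h1 hz)
    (by unfold pt; fun_prop)

theorem integral_logDeriv_zeta_pt {ℓ : ℂ → ℂ} (hℓ : IsLogZetaReg ℓ) {u v t : ℝ} (ht : t ≠ 0)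
    (hu : 0 < u) (hv : 0 < v) :
    ∫ w in u..v, deriv riemannZeta (pt w t) / riemannZeta (pt w t)
      = logZeta ℓ (pt v t) - logZeta ℓ (pt u t) := by
  have hpos : ∀ w ∈ uIcc u v, 0 < w := fun w hw => (lt_min hu hv).trans_le hw.1
  refine intervalIntegral.integral_eq_sub_of_hasDerivAt (f := fun w => logZeta ℓ (pt w t))
    (fun w hw => ?_) (ContinuousOn.intervalIntegrable fun w hw =>
      (continuousAt_logDeriv_zeta_pt hℓ ht (Or.inl (hpos w hw))).continuousWithinAt)
  exact hasDerivAt_comp_pt (hℓ.hasDerivAt_logZeta (by simpa using hpos w hw)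
    (slit_of_im_pos (by simpa using ht)))

/-- If no zero has ordinate t, then ζ'/ζ is continuous up to u = 0 at this height, so its primitive
continues the branch of log ζ to the critical line and computes both argument variations. -/
theorem pi_mul_S_eq {ℓ : ℂ → ℂ} (hℓ : IsLogZetaReg ℓ) {t : ℝ} (ht : t ≠ 0)
    (hn : ¬ IsZetaOrdinate t) :
    π * S t = (logZeta ℓ (pt 1 t)
        - ∫ u in (0 : ℝ)..1, deriv riemannZeta (pt u t) / riemannZeta (pt u t)).im ∧
      Tendsto (fun a => (logZeta ℓ (pt a t)).im) (𝓝[>] 0) (𝓝 (π * S t)) := by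
  set q : ℝ → ℂ := fun u => deriv riemannZeta (pt u t) / riemannZeta (pt u t) with hq
  -- Equal to log ζ for v > 0, where `logZeta` is given by the branch; at v = 0, where `logZeta` is
  -- set to 0, it has the right limit instead.
  let h : ℝ → ℂ := fun v => logZeta ℓ (pt 1 t) - ∫ u in v..1, q u
  have hqc : ContinuousOn q (Icc 0 (3 / 2)) := fun u hu =>
    (continuousAt_logDeriv_zeta_pt hℓ ht (Or.inr ⟨hu.1, hn⟩)).continuousWithinAt
  have hh : ∀ v, 0 < v → h v = logZeta ℓ (pt v t) := by
    intro v hv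
    simp only [h, hq]
    rw [integral_logDeriv_zeta_pt hℓ ht hv one_pos]
    ring
  have hc : ContinuousOn h (Icc 0 (3 / 2)) := by
    have e : h = fun v => logZeta ℓ (pt 1 t) + ∫ u in (1 : ℝ)..v, q u := by
      funext v
      simp only [h]
      rw [intervalIntegral.integral_symm, sub_neg_eq_add]
    rw [e]
    have hi : IntegrableOn q (uIcc 0 (3 / 2)) := by
      rw [uIcc_of_le (by norm_num)]
      exact hqc.integrableOn_Icc
    have := intervalIntegral.continuousOn_primitive_interval' (μ := volume) (f := q) (a := 1)
      (b₁ := 0) (b₂ := 3 / 2) hi.intervalIntegrable (by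
        rw [uIcc_of_le (by norm_num)]; constructor <;> norm_num)
    rw [uIcc_of_le (by norm_num)] at this
    exact continuousOn_const.add this
  have hlim : Tendsto h (𝓝[>] 0) (𝓝 (h 0)) := by
    have h0 := hc 0 (by constructor <;> norm_num)
    refine h0.tendsto.mono_left ?_
    rw [← nhdsWithin_Ioo_eq_nhdsGT (show (0 : ℝ) < 3 / 2 by norm_num)]
    exact nhdsWithin_mono _ Ioo_subset_Icc_self
  have hlim' : Tendsto (fun v => logZeta ℓ (pt v t)) (𝓝[>] 0) (𝓝 (h 0)) := by
    refine hlim.congr' ?_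
    filter_upwards [self_mem_nhdsWithin] with v hv using hh v hv
  have hne : ∀ v, pt v t ≠ 1 := fun v e => ht (by simpa using congrArg Complex.im e)
  have hexp : ∀ v, 0 ≤ v → Complex.exp (h v) = riemannZeta (pt v t) := by
    intro v hv
    rcases hv.eq_or_lt with rfl | hv
    · have h1 := (Complex.continuous_exp.tendsto _).comp hlim
      have h2 : Tendsto (fun v => riemannZeta (pt v t)) (𝓝[>] 0) (𝓝 (riemannZeta (pt 0 t))) := by
        have : ContinuousAt (fun v : ℝ => riemannZeta (pt v t)) 0 :=
          ContinuousAt.comp (f := fun v : ℝ => pt v t)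
            (differentiableAt_riemannZeta (hne 0)).continuousAt (by unfold pt; fun_prop)
        exact this.tendsto.mono_left nhdsWithin_le_nhds
      refine tendsto_nhds_unique h1 (h2.congr' ?_)
      filter_upwards [self_mem_nhdsWithin] with v hv
      simp only [Function.comp]
      rw [hh v hv, hℓ.exp_logZeta (by simpa using hv) (hne v)]
    · rw [hh v hv, hℓ.exp_logZeta (by simpa using hv) (hne v)]
  -- The parameter 3/2 is the abscissa 2. The branch is real at 2, so the variation starts from
  -- argument 0.
  have hA1 : argVariation riemannZeta 2 (2 + t * Complex.I) = (logZeta ℓ (pt (3 / 2) t)).im := by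
    have hre : ∀ u : ℝ, (2 + (u : ℂ) * (2 + t * Complex.I - 2)).re = 2 := by intro u; simp
    rw [argVariation_eq_im_sub (g := fun u : ℝ => logZeta ℓ (2 + u * (2 + t * Complex.I - 2)))]
    · have e1 : (2 : ℂ) + ((1 : ℝ) : ℂ) * (2 + t * Complex.I - 2) = pt (3 / 2) t := by
        simp [pt]; norm_num
      have e2 : (2 : ℂ) + ((0 : ℝ) : ℂ) * (2 + t * Complex.I - 2) = ((2 : ℝ) : ℂ) := by simp
      simp only [e1, e2]
      rw [Complex.sub_im, hℓ.im_logZeta_of_one_lt one_lt_two, sub_zero]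
    · intro u _
      refine ContinuousAt.continuousWithinAt (ContinuousAt.comp
        (f := fun u : ℝ => 2 + (u : ℂ) * (2 + t * Complex.I - 2))
        (hℓ.hasDerivAt_logZeta (by rw [hre]; norm_num)
          (slit_of_one_lt (by rw [hre]; norm_num))).continuousAt (by fun_prop))
    · intro u _
      refine hℓ.exp_logZeta (by rw [hre]; norm_num) fun e => ?_
      have := congrArg Complex.re e
      rw [hre] at this
      norm_num at this
  have hA2 : argVariation riemannZeta (2 + t * Complex.I) (1 / 2 + t * Complex.I)
      = (h 0 - logZeta ℓ (pt (3 / 2) t)).im := by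
    have hpt : ∀ u : ℝ, 2 + t * Complex.I + u * (1 / 2 + t * Complex.I - (2 + t * Complex.I))
        = pt (3 / 2 * (1 - u)) t := by
      intro u; simp only [pt]; push_cast; ring
    rw [argVariation_eq_im_sub (g := fun u : ℝ => h (3 / 2 * (1 - u)))]
    · simp only [sub_self, mul_zero, sub_zero, mul_one]
      rw [hh (3 / 2) (by norm_num)]
    · refine hc.comp (by fun_prop) fun u hu => ⟨?_, ?_⟩ <;> linarith [hu.1, hu.2]
    · intro u hu
      rw [hpt, hexp _ (by linarith [hu.2])]
  have hS : π * S t = (h 0).im := by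
    have hpi := Real.pi_pos.ne'
    rw [S, if_neg hn, argZeta, hA1, hA2, Complex.sub_im]
    field_simp
    ring
  exact ⟨hS, hS ▸ (Complex.continuous_im.tendsto _).comp hlim'⟩

/-! ### Cauchy's formula for iterated tail integrals -/

section IteratedIntegral

variable {E : Type*} [NormedAddCommGroup E] [NormedSpace ℝ E]

theorem integral_sub_pow_div_factorial (k : ℕ) {σ v : ℝ} (h : σ ≤ v) :
    ∫ u in Ioo σ v, (u - σ) ^ k / k ! = (v - σ) ^ (k + 1) / (k + 1)! := by
  rw [← integral_Ioc_eq_integral_Ioo, ← intervalIntegral.integral_of_le h,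
    intervalIntegral.integral_div, intervalIntegral.integral_comp_sub_right (fun x => x ^ k),
    integral_pow, Nat.factorial_succ]
  push_cast
  rw [sub_self, zero_pow (Nat.succ_ne_zero k)]
  field_simp
  ring

/-- The kernel that turns `∫ (u - σ)^k / k! ∫_u^∞ g` into a double integral. -/
def tailKernel (k : ℕ) (σ : ℝ) (g : ℝ → E) (u v : ℝ) : E :=
  (Ioi u).indicator (fun v => ((u - σ) ^ k / (k ! : ℝ)) • g v) v

theorem tailKernel_eq_of_gt (k : ℕ) {σ v : ℝ} (g : ℝ → E) (u : ℝ) :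
    tailKernel k σ g u v = (Iio v).indicator (fun u => ((u - σ) ^ k / (k ! : ℝ))) u • g v := by
  unfold tailKernel
  by_cases h : u < v
  · rw [indicator_of_mem (show v ∈ Ioi u from h), indicator_of_mem (show u ∈ Iio v from h)]
  · rw [indicator_of_notMem (show v ∉ Ioi u from h), indicator_of_notMem (show u ∉ Iio v from h),
      zero_smul]

theorem integrableOn_sub_pow (k : ℕ) (σ v : ℝ) :
    IntegrableOn (fun u : ℝ => (u - σ) ^ k / (k ! : ℝ)) (Ioo σ v) :=
  ((by fun_prop : Continuous fun u : ℝ => (u - σ) ^ k / (k ! : ℝ)).integrableOn_Icc).mono_set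
    Ioo_subset_Icc_self

/-- Integrating out u first produces the moment of order k + 1 of |g|, which is finite by
hypothesis. -/
theorem integrable_tailKernel (k : ℕ) {σ : ℝ} {g : ℝ → E}
    (hg : ∀ k : ℕ, IntegrableOn (fun u => (u - σ) ^ k • g u) (Ioi σ)) :
    Integrable (Function.uncurry (tailKernel k σ g))
      ((volume.restrict (Ioi σ)).prod (volume.restrict (Ioi σ))) := by
  have hg0 : AEStronglyMeasurable g (volume.restrict (Ioi σ)) := by
    have := (hg 0).1
    simpa using this
  have hm : AEStronglyMeasurable (Function.uncurry (tailKernel k σ g))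
      ((volume.restrict (Ioi σ)).prod (volume.restrict (Ioi σ))) := by
    have e : Function.uncurry (tailKernel k σ g) = {p : ℝ × ℝ | p.1 < p.2}.indicator
        fun p => ((p.1 - σ) ^ k / (k ! : ℝ)) • g p.2 := by
      funext p
      simp only [Function.uncurry, tailKernel, indicator, mem_Ioi, mem_ofPred_eq]
    rw [e]
    refine AEStronglyMeasurable.indicator ?_ (measurableSet_lt measurable_fst measurable_snd)
    exact (by fun_prop : Continuous fun p : ℝ × ℝ => (p.1 - σ) ^ k / (k ! : ℝ)).aestronglyMeasurable.smul
      hg0.comp_snd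
  rw [integrable_prod_iff' hm]
  constructor
  · refine Eventually.of_forall fun v => ?_
    simp only [Function.uncurry, tailKernel_eq_of_gt]
    refine Integrable.smul_const ?_ _
    rw [integrable_indicator_iff measurableSet_Iio, IntegrableOn,
      Measure.restrict_restrict measurableSet_Iio, inter_comm, Ioi_inter_Iio]
    exact integrableOn_sub_pow k σ v
  · refine Integrable.congr (((hg (k + 1)).norm).div_const ((k + 1)! : ℝ)) ?_
    filter_upwards [ae_restrict_mem measurableSet_Ioi] with v hv
    have hv' : σ < v := hv
    simp only [Function.uncurry, tailKernel_eq_of_gt, norm_smul]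
    rw [integral_mul_const]
    have e : ∀ u, ‖(Iio v).indicator (fun u => (u - σ) ^ k / (k ! : ℝ)) u‖
        = (Iio v).indicator (fun u => ‖(u - σ) ^ k / (k ! : ℝ)‖) u := fun u =>
      norm_indicator_eq_indicator_norm _ _
    simp only [e]
    rw [integral_indicator measurableSet_Iio, Measure.restrict_restrict measurableSet_Iio, inter_comm,
      Ioi_inter_Iio, setIntegral_congr_fun (g := fun u => (u - σ) ^ k / (k ! : ℝ)) measurableSet_Ioo,
      integral_sub_pow_div_factorial k hv'.le, Real.norm_of_nonneg (by positivity)]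
    · ring
    · intro u hu
      have : 0 ≤ u - σ := by linarith [hu.1]
      simp only
      rw [Real.norm_of_nonneg (by positivity)]

theorem integral_tailKernel (k : ℕ) {σ : ℝ} (g : ℝ → E) {u : ℝ} (hu : σ < u) :
    ∫ v in Ioi σ, tailKernel k σ g u v = ((u - σ) ^ k / (k ! : ℝ)) • ∫ v in Ioi u, g v := by
  unfold tailKernel
  rw [integral_indicator measurableSet_Ioi, Measure.restrict_restrict measurableSet_Ioi,
    Ioi_inter_Ioi, sup_of_le_left hu.le, integral_smul]

/-- Finiteness of all moments passes to the tail integral; this is what lets the iteration continue.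
-/
theorem integrableOn_sub_pow_smul_integral_Ioi {σ : ℝ} {g : ℝ → E}
    (hg : ∀ k : ℕ, IntegrableOn (fun u => (u - σ) ^ k • g u) (Ioi σ)) (k : ℕ) :
    IntegrableOn (fun u => (u - σ) ^ k • ∫ v in Ioi u, g v) (Ioi σ) := by
  have h := ((integrable_tailKernel k hg).integral_prod_left).smul (k ! : ℝ)
  refine Integrable.congr h ?_
  filter_upwards [ae_restrict_mem measurableSet_Ioi] with u hu
  simp only [Function.uncurry, Pi.smul_apply]
  rw [integral_tailKernel k g hu, smul_smul]
  congr 1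
  have : (k ! : ℝ) ≠ 0 := by positivity
  field_simp

theorem integral_sub_pow_smul_integral_Ioi [CompleteSpace E] {σ : ℝ} {g : ℝ → E}
    (hg : ∀ k : ℕ, IntegrableOn (fun u => (u - σ) ^ k • g u) (Ioi σ)) (k : ℕ) :
    ∫ u in Ioi σ, ((u - σ) ^ k / (k ! : ℝ)) • ∫ v in Ioi u, g v
      = ∫ v in Ioi σ, ((v - σ) ^ (k + 1) / ((k + 1)! : ℝ)) • g v := by
  have h := integral_integral_swap (integrable_tailKernel k hg)
  rw [setIntegral_congr_fun measurableSet_Ioi fun u hu => (integral_tailKernel k g hu).symm, h]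
  refine setIntegral_congr_fun measurableSet_Ioi fun v hv => ?_
  simp only [tailKernel_eq_of_gt]
  rw [integral_smul_const, integral_indicator measurableSet_Iio,
    Measure.restrict_restrict measurableSet_Iio, inter_comm, Ioi_inter_Iio,
    integral_sub_pow_div_factorial k (le_of_lt hv)]

theorem iterate_integral_Ioi [CompleteSpace E] {σ : ℝ} (n : ℕ) {g : ℝ → E}
    (hg : ∀ k : ℕ, IntegrableOn (fun u => (u - σ) ^ k • g u) (Ioi σ)) :
    (fun (h : ℝ → E) (x : ℝ) => ∫ v in Ioi x, h v)^[n + 1] g σ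
      = ∫ u in Ioi σ, ((u - σ) ^ n / (n ! : ℝ)) • g u := by
  induction n generalizing g with
  | zero => simp
  | succ n ih =>
    rw [Function.iterate_succ_apply, ih (integrableOn_sub_pow_smul_integral_Ioi hg),
      integral_sub_pow_smul_integral_Ioi hg]

end IteratedIntegral

/-! ### Contour shift and Littlewood's formula -/

theorem IsLogZetaReg.measurable_logZeta {ℓ : ℂ → ℂ} (hℓ : IsLogZetaReg ℓ) :
    Measurable (logZeta ℓ) := by
  classical
  have h1 : Measurable ({s : ℂ | 1 / 2 < s.re}.piecewise ℓ fun _ => 0) :=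
    ContinuousOn.measurable_piecewise
      (fun s hs => (hℓ.diff s hs).continuousAt.continuousWithinAt) continuousOn_const
      isOpen_half.measurableSet
  have h2 : Measurable ({s : ℂ | 1 / 2 < s.re}.indicator fun s => Complex.log (s - 1)) :=
    (Complex.measurable_log.comp (measurable_id.sub_const 1)).indicator isOpen_half.measurableSet
  convert! h1.sub h2 using 1
  funext s
  by_cases hs : 1 / 2 < s.re
  · have hs' : s ∈ {s : ℂ | 1 / 2 < s.re} := hs
    rw [Pi.sub_apply, logZeta, if_pos hs, piecewise_eq_of_mem _ _ _ hs', indicator_of_mem hs']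
  · have hs' : s ∉ {s : ℂ | 1 / 2 < s.re} := hs
    rw [Pi.sub_apply, logZeta, if_neg hs, piecewise_eq_of_notMem _ _ _ hs',
      indicator_of_notMem hs', sub_zero]

theorem IsLogZetaReg.measurable_logZeta_pt {ℓ : ℂ → ℂ} (hℓ : IsLogZetaReg ℓ) :
    Measurable fun p : ℝ × ℝ => logZeta ℓ (pt p.1 p.2) :=
  hℓ.measurable_logZeta.comp continuous_pt.measurable

theorem ae_ne_half : ∀ᵐ u : ℝ, u ≠ 1 / 2 := by
  filter_upwards [(countable_singleton (1 / 2 : ℝ)).ae_notMem volume] with u hu using hu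

theorem integrableOn_pow_smul_logZeta (hRH : RiemannHypothesis) {ℓ : ℂ → ℂ} (hℓ : IsLogZetaReg ℓ)
    (t : ℝ) (k : ℕ) : IntegrableOn (fun u : ℝ => u ^ k • logZeta ℓ (pt u t)) (Ioi 0) := by
  obtain ⟨b, hb0, hb, hL⟩ := exists_majorant hRH hℓ |t|
  have hm : Measurable fun u : ℝ => logZeta ℓ (pt u t) :=
    hℓ.measurable_logZeta_pt.comp (measurable_id.prodMk measurable_const)
  refine (hb k).mono' ((measurable_id.pow_const k).smul hm).aestronglyMeasurable ?_
  filter_upwards [ae_restrict_mem measurableSet_Ioi, ae_restrict_of_ae ae_ne_half] with u hu hu'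
  have hu0 : 0 < u := hu
  rw [norm_smul, norm_pow, Real.norm_of_nonneg hu0.le]
  exact mul_le_mul_of_nonneg_left (hL u hu hu' t le_rfl) (by positivity)

theorem integrableOn_logZeta (hRH : RiemannHypothesis) {ℓ : ℂ → ℂ} (hℓ : IsLogZetaReg ℓ)
    (t : ℝ) : IntegrableOn (fun u : ℝ => logZeta ℓ (pt u t)) (Ioi 0) := by
  simpa using integrableOn_pow_smul_logZeta hRH hℓ t 0

/-- The branch of `log ζ` is continuous from above at the points of the cut. -/
theorem IsLogZetaReg.tendsto_logZeta_real {ℓ : ℂ → ℂ} (hℓ : IsLogZetaReg ℓ) {u : ℝ} (hu0 : 0 < u)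
    (hu : u ≠ 1 / 2) :
    Tendsto (fun ε => logZeta ℓ (pt u ε)) (𝓝[>] 0) (𝓝 (logZeta ℓ (pt u 0))) := by
  have hre : ∀ ε, 1 / 2 < (pt u ε).re := by simpa using hu0
  have hp : Tendsto (fun ε => pt u ε) (𝓝[>] 0) (𝓝 (pt u 0)) := by
    have : Continuous fun ε => pt u ε := by unfold pt; fun_prop
    exact (this.tendsto 0).mono_left nhdsWithin_le_nhds
  simp only [logZeta, hre, if_true]
  refine ((hℓ.diff _ (hre 0)).continuousAt.tendsto.comp hp).sub ?_
  rcases hu.lt_or_gt with h | h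
  · have h1 := Complex.continuousWithinAt_log_of_re_neg_of_im_zero (z := pt u 0 - 1)
      (by simp; linarith) (by simp)
    refine h1.tendsto.comp (tendsto_nhdsWithin_iff.mpr ⟨hp.sub_const 1, ?_⟩)
    filter_upwards [self_mem_nhdsWithin] with ε hε
    have : 0 < ε := hε
    simpa using this.le
  · exact ((continuousAt_clog (slit_of_one_lt (by simp; linarith))).tendsto).comp (hp.sub_const 1)

/-- Cauchy's theorem on the rectangle from a to b and from height ε to t, with b → ∞. Positive
heights keep it away from the cut, and the far side vanishes by exponential decay. -/
theorem integral_logZeta_vertical_of_pos (hRH : RiemannHypothesis) {ℓ : ℂ → ℂ} (hℓ : IsLogZetaReg ℓ)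
    {a ε t : ℝ} (ha : 0 < a) (hε : 0 < ε) (ht : 0 < t) :
    ∫ τ in ε..t, logZeta ℓ (pt a τ)
      = Complex.I * ((∫ v in Ioi a, logZeta ℓ (pt v t)) - ∫ v in Ioi a, logZeta ℓ (pt v ε)) := by
  obtain ⟨C, hC0, hC⟩ := hℓ.exists_norm_logZeta_le
  have hmin : 0 < min ε t := lt_min hε ht
  have hrect : ∀ b, a < b → (∫ v in a..b, logZeta ℓ (pt v ε)) - (∫ v in a..b, logZeta ℓ (pt v t))
      + Complex.I * (∫ y in ε..t, logZeta ℓ (pt b y)) - Complex.I * (∫ y in ε..t, logZeta ℓ (pt a y))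
      = 0 := by
    intro b hab
    have H := Complex.integral_boundary_rect_eq_zero_of_differentiableOn
      (fun s => logZeta ℓ (1 / 2 + s)) (a + ε * Complex.I) (b + t * Complex.I) (by
        intro s hs
        rw [Complex.mem_reProdIm] at hs
        simp only [Complex.add_re, Complex.ofReal_re, Complex.mul_re, Complex.I_re, mul_zero,
          Complex.ofReal_im, Complex.I_im, mul_one, sub_self, add_zero, Complex.add_im,
          Complex.mul_im, zero_add] at hs
        rw [uIcc_of_le hab.le] at hs
        have h1 := hs.1.1
        have h2 : 0 < s.im := hmin.trans_le hs.2.1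
        have hd := (hℓ.hasDerivAt_logZeta (s := 1 / 2 + s) (by simp; linarith)
          (slit_of_im_pos (by simpa using h2.ne'))).differentiableAt
        exact (DifferentiableAt.comp s (f := fun s => 1 / 2 + s) hd
          (by fun_prop)).differentiableWithinAt)
    have e : ∀ x y : ℝ, (2⁻¹ : ℂ) + (x + y * Complex.I) = pt x y := by
      intro x y; simp [pt]; ring
    simpa [e, smul_eq_mul] using H
  have hI : ∀ t, IntegrableOn (fun u : ℝ => logZeta ℓ (pt u t)) (Ioi a) := fun t =>
    (integrableOn_logZeta hRH hℓ t).mono_set (Ioi_subset_Ioi ha.le)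
  have l1 := intervalIntegral_tendsto_integral_Ioi a (hI ε) tendsto_id
  have l2 := intervalIntegral_tendsto_integral_Ioi a (hI t) tendsto_id
  have l3 : Tendsto (fun b => ∫ y in ε..t, logZeta ℓ (pt b y)) atTop (𝓝 0) := by
    have hexp : Tendsto (fun b : ℝ => C * Real.exp (-b / 2) * |t - ε|) atTop (𝓝 0) := by
      have h1 : Tendsto (fun b : ℝ => -b / 2) atTop atBot := by
        have := tendsto_neg_atTop_atBot.comp (tendsto_id.atTop_div_const (show (0 : ℝ) < 2 by norm_num))
        refine this.congr fun b => ?_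
        simp [neg_div]
      simpa using ((Real.tendsto_exp_atBot.comp h1).const_mul C).mul_const |t - ε|
    refine squeeze_zero_norm' ?_ hexp
    filter_upwards [eventually_ge_atTop 1] with b hb
    refine intervalIntegral.norm_integral_le_of_norm_le_const fun y _ => ?_
    refine (hC _ (by simp; linarith)).trans ?_
    gcongr
    simp
  have hlim := ((l1.sub l2).add (l3.const_mul Complex.I)).sub
    (tendsto_const_nhds (x := Complex.I * ∫ y in ε..t, logZeta ℓ (pt a y)))
  have h0 := tendsto_nhds_unique (hlim.congr' (by
    filter_upwards [eventually_gt_atTop a] with b hb using hrect b hb)) tendsto_const_nhds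
  rw [mul_zero, add_zero, sub_eq_zero] at h0
  have := congrArg (fun z => Complex.I * z) h0
  simp only [← mul_assoc, Complex.I_mul_I] at this
  linear_combination this

/-- The limit ε → 0+ of the previous identity, using that the branch is continuous from above on the
cut; `a ≠ 1 / 2` keeps the vertical side off the pole. -/
theorem integral_logZeta_vertical (hRH : RiemannHypothesis) {ℓ : ℂ → ℂ} (hℓ : IsLogZetaReg ℓ)
    {a t : ℝ} (ha : 0 < a) (ha' : a ≠ 1 / 2) (ht : 0 < t) :
    ∫ τ in (0 : ℝ)..t, logZeta ℓ (pt a τ)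
      = Complex.I * ((∫ v in Ioi a, logZeta ℓ (pt v t)) - ∫ v in Ioi a, logZeta ℓ (pt v 0)) := by
  obtain ⟨b, hb0, hb, hL⟩ := exists_majorant hRH hℓ t
  have hbi : IntegrableOn b (Ioi a) := by
    have := hb 0
    simp only [pow_zero, one_mul] at this
    exact this.mono_set (Ioi_subset_Ioi ha.le)
  have hsmall : ∀ᶠ ε in 𝓝[>] (0 : ℝ), ε ∈ Ioo 0 t := Ioo_mem_nhdsGT ht
  have hi : IntervalIntegrable (fun τ => logZeta ℓ (pt a τ)) volume 0 t := by
    have hm : Measurable fun τ : ℝ => logZeta ℓ (pt a τ) :=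
      hℓ.measurable_logZeta_pt.comp (measurable_const.prodMk measurable_id)
    rw [intervalIntegrable_iff_integrableOn_Ioc_of_le ht.le]
    refine Integrable.mono' (g := fun _ => b a) (integrable_const _) hm.aestronglyMeasurable ?_
    filter_upwards [ae_restrict_mem measurableSet_Ioc] with τ hτ
    exact hL a ha ha' τ (by rw [abs_of_pos hτ.1]; exact hτ.2)
  have l1 : Tendsto (fun ε => ∫ τ in ε..t, logZeta ℓ (pt a τ)) (𝓝[>] 0)
      (𝓝 (∫ τ in (0 : ℝ)..t, logZeta ℓ (pt a τ))) := by
    have h1 := intervalIntegral.continuousOn_primitive_interval' hi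
      (a := t) (by simp) 0 (by simp)
    have h2 : Tendsto (fun ε => -∫ τ in t..ε, logZeta ℓ (pt a τ)) (𝓝[>] 0)
        (𝓝 (-∫ τ in t..0, logZeta ℓ (pt a τ))) := by
      refine (h1.tendsto.mono_left ?_).neg
      rw [uIcc_of_le ht.le, ← nhdsWithin_Ioo_eq_nhdsGT ht]
      exact nhdsWithin_mono _ Ioo_subset_Icc_self
    simpa only [← intervalIntegral.integral_symm] using h2
  have l2 : Tendsto (fun ε => ∫ v in Ioi a, logZeta ℓ (pt v ε)) (𝓝[>] 0)
      (𝓝 (∫ v in Ioi a, logZeta ℓ (pt v 0))) := by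
    refine tendsto_integral_filter_of_dominated_convergence b (Eventually.of_forall fun ε => ?_) ?_
      hbi ?_
    · exact (hℓ.measurable_logZeta_pt.comp
        (measurable_id.prodMk measurable_const)).aestronglyMeasurable
    · filter_upwards [hsmall] with ε hε
      filter_upwards [ae_restrict_mem measurableSet_Ioi, ae_restrict_of_ae ae_ne_half] with v hv hv'
      exact hL v (ha.trans hv) hv' ε (by rw [abs_of_pos hε.1]; exact hε.2.le)
    · filter_upwards [ae_restrict_mem measurableSet_Ioi, ae_restrict_of_ae ae_ne_half] with v hv hv'
      exact hℓ.tendsto_logZeta_real (ha.trans hv) hv'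
  refine tendsto_nhds_unique l1 (((tendsto_const_nhds.sub l2).const_mul Complex.I).congr' ?_)
  filter_upwards [hsmall] with ε hε
  exact (integral_logZeta_vertical_of_pos hRH hℓ ha hε.1 ht).symm

/-- The moment `∫_0^∞ u^k / k! log ζ(1/2 + u + i t) du`. -/
def logZetaMoment (ℓ : ℂ → ℂ) (k : ℕ) (t : ℝ) : ℂ :=
  ∫ u in Ioi (0 : ℝ), (u ^ k / (k ! : ℝ)) • logZeta ℓ (pt u t)

theorem tendsto_integral_Ioi_logZeta (hRH : RiemannHypothesis) {ℓ : ℂ → ℂ} (hℓ : IsLogZetaReg ℓ)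
    (t : ℝ) :
    Tendsto (fun a => ∫ v in Ioi a, logZeta ℓ (pt v t)) (𝓝[>] 0) (𝓝 (logZetaMoment ℓ 0 t)) := by
  have hI := integrableOn_logZeta hRH hℓ t
  have hi : IntervalIntegrable (fun v => logZeta ℓ (pt v t)) volume 0 1 := by
    rw [intervalIntegrable_iff_integrableOn_Ioc_of_le zero_le_one]
    exact hI.mono_set Ioc_subset_Ioi_self
  have h1 := intervalIntegral.continuousOn_primitive_interval' hi (a := 0) (by simp) 0 (by simp)
  have h2 : Tendsto (fun a => ∫ v in (0 : ℝ)..a, logZeta ℓ (pt v t)) (𝓝[>] 0) (𝓝 0) := by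
    have := h1.tendsto
    rw [intervalIntegral.integral_same] at this
    refine this.mono_left ?_
    rw [uIcc_of_le zero_le_one, ← nhdsWithin_Ioo_eq_nhdsGT one_pos]
    exact nhdsWithin_mono _ Ioo_subset_Icc_self
  have h3 := (tendsto_const_nhds (x := logZetaMoment ℓ 0 t)).sub h2
  rw [sub_zero] at h3
  refine h3.congr' ?_
  filter_upwards [self_mem_nhdsWithin] with a ha
  have ha' : 0 < a := ha
  rw [logZetaMoment, sub_eq_iff_eq_add']
  simpa using (intervalIntegral.integral_interval_add_Ioi hI
    (hI.mono_set (Ioi_subset_Ioi ha'.le))).symm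

/-- The vertical line moves to the critical line: Im log ζ is bounded uniformly in `a` and tends to
π S(τ) for all τ that are not ordinates, hence almost everywhere. -/
theorem integral_pi_mul_S (hRH : RiemannHypothesis) {ℓ : ℂ → ℂ} (hℓ : IsLogZetaReg ℓ)
    {t : ℝ} (ht : 0 < t) :
    ∫ τ in (0 : ℝ)..t, π * S τ
      = (Complex.I * (logZetaMoment ℓ 0 t - logZetaMoment ℓ 0 0)).im := by
  obtain ⟨C, hC0, hC⟩ := exists_im_logZeta_le hRH hℓ t
  obtain ⟨b, hb0, hb, hL⟩ := exists_majorant hRH hℓ t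
  have hsmall : ∀ᶠ a in 𝓝[>] (0 : ℝ), a ∈ Ioo (0 : ℝ) (1 / 2) := Ioo_mem_nhdsGT (by norm_num)
  have hm : ∀ a, Measurable fun τ : ℝ => logZeta ℓ (pt a τ) := fun a =>
    hℓ.measurable_logZeta_pt.comp (measurable_const.prodMk measurable_id)
  have l1 : Tendsto (fun a => ∫ τ in (0 : ℝ)..t, (logZeta ℓ (pt a τ)).im) (𝓝[>] 0)
      (𝓝 (∫ τ in (0 : ℝ)..t, π * S τ)) := by
    refine intervalIntegral.tendsto_integral_filter_of_dominated_convergence (fun _ => C)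
      (Eventually.of_forall fun a => (Complex.measurable_im.comp (hm a)).aestronglyMeasurable) ?_
      intervalIntegrable_const ?_
    · filter_upwards [hsmall] with a ha
      refine Eventually.of_forall fun τ hτ => ?_
      rw [uIoc_of_le ht.le] at hτ
      exact hC a ha.1 (by linarith [ha.2]) τ (by rw [abs_of_pos hτ.1]; exact hτ.2)
    · filter_upwards [ae_not_isZetaOrdinate] with τ hτ hτ'
      rw [uIoc_of_le ht.le] at hτ'
      exact (pi_mul_S_eq hℓ hτ'.1.ne' hτ).2
  have l2 := (Complex.continuous_im.tendsto _).comp (((tendsto_integral_Ioi_logZeta hRH hℓ t).sub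
    (tendsto_integral_Ioi_logZeta hRH hℓ 0)).const_mul Complex.I)
  refine tendsto_nhds_unique l1 (l2.congr' ?_)
  filter_upwards [hsmall] with a ha
  simp only [Function.comp]
  rw [← integral_logZeta_vertical hRH hℓ ha.1 ha.2.ne ht]
  have hi : IntervalIntegrable (fun τ => logZeta ℓ (pt a τ)) volume 0 t := by
    rw [intervalIntegrable_iff_integrableOn_Ioc_of_le ht.le]
    refine Integrable.mono' (g := fun _ => b a) (integrable_const _) (hm a).aestronglyMeasurable ?_
    filter_upwards [ae_restrict_mem measurableSet_Ioc] with τ hτ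
    exact hL a ha.1 ha.2.ne τ (by rw [abs_of_pos hτ.1]; exact hτ.2)
  exact (Complex.imCLM.intervalIntegral_comp_comm hi).symm

theorem integrable_logZeta_prod (hRH : RiemannHypothesis) {ℓ : ℂ → ℂ} (hℓ : IsLogZetaReg ℓ)
    (k : ℕ) (t : ℝ) :
    Integrable (Function.uncurry fun τ u : ℝ => (u ^ k / (k ! : ℝ)) • logZeta ℓ (pt u τ))
      ((volume.restrict (Ioc 0 t)).prod (volume.restrict (Ioi 0))) := by
  obtain ⟨b, hb0, hb, hL⟩ := exists_majorant hRH hℓ t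
  have hg : Integrable (fun p : ℝ × ℝ => p.2 ^ k * b p.2 / (k ! : ℝ))
      ((volume.restrict (Ioc 0 t)).prod (volume.restrict (Ioi 0))) :=
    Integrable.comp_snd (f := fun u : ℝ => u ^ k * b u / (k ! : ℝ)) ((hb k).div_const _) _
  refine hg.mono' ?_ ?_
  · have : Measurable fun p : ℝ × ℝ => (p.2 ^ k / (k ! : ℝ)) • logZeta ℓ (pt p.2 p.1) :=
      (by fun_prop : Measurable fun p : ℝ × ℝ => p.2 ^ k / (k ! : ℝ)).smul
        (hℓ.measurable_logZeta_pt.comp measurable_swap)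
    exact this.aestronglyMeasurable
  · have h1 : ∀ᵐ p : ℝ × ℝ ∂((volume.restrict (Ioc 0 t)).prod (volume.restrict (Ioi 0))),
        p.1 ∈ Ioc 0 t := Measure.quasiMeasurePreserving_fst.ae (ae_restrict_mem measurableSet_Ioc)
    have h2 : ∀ᵐ p : ℝ × ℝ ∂((volume.restrict (Ioc 0 t)).prod (volume.restrict (Ioi 0))),
        p.2 ∈ Ioi (0 : ℝ) := Measure.quasiMeasurePreserving_snd.ae (ae_restrict_mem measurableSet_Ioi)
    have h3 : ∀ᵐ p : ℝ × ℝ ∂((volume.restrict (Ioc 0 t)).prod (volume.restrict (Ioi 0))),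
        p.2 ≠ 1 / 2 := Measure.quasiMeasurePreserving_snd.ae (ae_restrict_of_ae ae_ne_half)
    filter_upwards [h1, h2, h3] with p h1 h2 h3
    have hp0 : 0 < p.2 := h2
    simp only [Function.uncurry]
    rw [norm_smul, Real.norm_of_nonneg (by positivity), mul_div_right_comm]
    exact mul_le_mul_of_nonneg_left (hL _ h2 h3 _ (by rw [abs_of_pos h1.1]; exact h1.2))
      (by positivity)

theorem intervalIntegrable_logZetaMoment (hRH : RiemannHypothesis) {ℓ : ℂ → ℂ} (hℓ : IsLogZetaReg ℓ)
    (k : ℕ) {t : ℝ} (ht : 0 ≤ t) :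
    IntervalIntegrable (logZetaMoment ℓ k) volume 0 t := by
  rw [intervalIntegrable_iff_integrableOn_Ioc_of_le ht]
  exact (integrable_logZeta_prod hRH hℓ k t).integral_prod_left

/-- After exchanging the τ and u integrals, the contour shift at each u produces tail integrals, and
weighting these by u^k/k! raises the order of the moment by one. -/
theorem integral_logZetaMoment (hRH : RiemannHypothesis) {ℓ : ℂ → ℂ} (hℓ : IsLogZetaReg ℓ)
    (k : ℕ) {t : ℝ} (ht : 0 < t) :
    ∫ τ in (0 : ℝ)..t, logZetaMoment ℓ k τ
      = Complex.I * (logZetaMoment ℓ (k + 1) t - logZetaMoment ℓ (k + 1) 0) := by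
  have hint : ∀ τ, ∀ j : ℕ, IntegrableOn (fun u : ℝ => (u - 0) ^ j • logZeta ℓ (pt u τ)) (Ioi 0) := by
    intro τ j
    simpa using integrableOn_pow_smul_logZeta hRH hℓ τ j
  have hA : ∀ τ, ∫ u in Ioi (0 : ℝ), (u ^ k / (k ! : ℝ)) • ∫ v in Ioi u, logZeta ℓ (pt v τ)
      = logZetaMoment ℓ (k + 1) τ := by
    intro τ
    have := integral_sub_pow_smul_integral_Ioi (hint τ) k
    simpa only [sub_zero, logZetaMoment] using this
  have hAi : ∀ τ, IntegrableOn (fun u : ℝ => (u ^ k / (k ! : ℝ)) • ∫ v in Ioi u, logZeta ℓ (pt v τ))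
      (Ioi 0) := by
    intro τ
    have h : IntegrableOn (fun u : ℝ => (k ! : ℝ)⁻¹ • ((u - 0) ^ k • ∫ v in Ioi u, logZeta ℓ (pt v τ)))
      (Ioi 0) := (integrableOn_sub_pow_smul_integral_Ioi (hint τ) k).smul ((k ! : ℝ)⁻¹)
    refine h.congr_fun (fun u _ => ?_) measurableSet_Ioi
    simp only [sub_zero, smul_smul]
    congr 1
    ring
  rw [intervalIntegral.integral_of_le ht.le]
  unfold logZetaMoment
  rw [integral_integral_swap (integrable_logZeta_prod hRH hℓ k t)]
  have e : ∀ᵐ u ∂(volume.restrict (Ioi (0 : ℝ))),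
      ∫ τ in Ioc 0 t, (u ^ k / (k ! : ℝ)) • logZeta ℓ (pt u τ)
        = Complex.I * ((u ^ k / (k ! : ℝ)) • (∫ v in Ioi u, logZeta ℓ (pt v t))
          - (u ^ k / (k ! : ℝ)) • ∫ v in Ioi u, logZeta ℓ (pt v 0)) := by
    filter_upwards [ae_restrict_mem measurableSet_Ioi, ae_restrict_of_ae ae_ne_half] with u hu hu'
    rw [integral_smul, ← intervalIntegral.integral_of_le ht.le,
      integral_logZeta_vertical hRH hℓ hu hu' ht, ← smul_sub, mul_smul_comm]
  rw [integral_congr_ae e, integral_const_mul, integral_sub (hAi t) (hAi 0), hA, hA]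
  rfl

theorem setIntegral_Ioi_add {E : Type*} [NormedAddCommGroup E] [NormedSpace ℝ E] (f : ℝ → E) (a : ℝ) :
    ∫ u in Ioi (0 : ℝ), f (u + a) = ∫ x in Ioi a, f x := by
  have := (measurePreserving_add_right volume a).setIntegral_preimage_emb
    (measurableEmbedding_addRight a) f (Ioi a)
  simpa using this

theorem logZetaIter_eq_iterate (n : ℕ) :
    logZetaIter n = (fun (h : ℝ → ℝ) (x : ℝ) => ∫ v in Ioi x, h v)^[n] (logZetaIter 0) := by
  induction n with
  | zero => rfl
  | succ n ih =>
    rw [Function.iterate_succ_apply', ← ih]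
    rfl

theorem re_logZeta_pt_zero {ℓ : ℂ → ℂ} (hℓ : IsLogZetaReg ℓ) {u : ℝ} (hu : 0 < u) (hu' : u ≠ 1 / 2) :
    (logZeta ℓ (pt u 0)).re = logZetaIter 0 (u + 1 / 2) := by
  have h1 : pt u 0 ≠ 1 := fun e => hu' (by have := congrArg Complex.re e; simp at this; linarith)
  rw [hℓ.re_logZeta (by simpa using hu) h1, logZetaIter]
  simp [pt, add_comm]

theorem im_logZeta_pt_zero {ℓ : ℂ → ℂ} (hℓ : IsLogZetaReg ℓ) {u : ℝ} (hu : 0 < u) (hu' : u ≠ 1 / 2) :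
    (logZeta ℓ (pt u 0)).im = (Iio (1 / 2)).indicator (fun _ => -π) u := by
  have e : pt u 0 = ((1 / 2 + u : ℝ) : ℂ) := by simp [pt]
  rw [e]
  rcases hu'.lt_or_gt with h | h
  · rw [indicator_of_mem (show u ∈ Iio (1 / 2 : ℝ) from h),
      hℓ.im_logZeta_of_lt_one (by linarith) (by linarith)]
  · rw [indicator_of_notMem (show u ∉ Iio (1 / 2 : ℝ) from not_lt.mpr h.le),
      hℓ.im_logZeta_of_one_lt (by linarith)]

theorem integrableOn_smul_logZeta (hRH : RiemannHypothesis) {ℓ : ℂ → ℂ} (hℓ : IsLogZetaReg ℓ)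
    (k : ℕ) (t : ℝ) :
    IntegrableOn (fun u : ℝ => (u ^ k / (k ! : ℝ)) • logZeta ℓ (pt u t)) (Ioi 0) := by
  have h : IntegrableOn (fun u : ℝ => (k ! : ℝ)⁻¹ • (u ^ k • logZeta ℓ (pt u t))) (Ioi 0) :=
    (integrableOn_pow_smul_logZeta hRH hℓ t k).smul ((k ! : ℝ)⁻¹)
  refine h.congr_fun (fun u _ => ?_) measurableSet_Ioi
  simp only [smul_smul]
  congr 1
  ring

/-- The iterated integral defining the odd constants collapses, by Cauchy's formula, to a single
moment of log |ζ|. -/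
theorem re_logZetaMoment_zero (hRH : RiemannHypothesis) {ℓ : ℂ → ℂ} (hℓ : IsLogZetaReg ℓ) (k : ℕ) :
    (logZetaMoment ℓ k 0).re = logZetaIter (k + 1) (1 / 2) := by
  have hre : ∀ᵐ u ∂(volume.restrict (Ioi (0 : ℝ))),
      (logZeta ℓ (pt u 0)).re = logZetaIter 0 (u + 1 / 2) := by
    filter_upwards [ae_restrict_mem measurableSet_Ioi, ae_restrict_of_ae ae_ne_half] with u hu hu'
    exact re_logZeta_pt_zero hℓ hu hu'
  have hint : ∀ j : ℕ, IntegrableOn (fun x : ℝ => (x - 1 / 2) ^ j • logZetaIter 0 x) (Ioi (1 / 2)) := by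
    intro j
    rw [← (measurePreserving_add_right volume (1 / 2 : ℝ)).integrableOn_comp_preimage
      (measurableEmbedding_addRight _)]
    have h1 : IntegrableOn (fun u : ℝ => (u ^ j • logZeta ℓ (pt u 0)).re) (Ioi 0) :=
      (integrableOn_pow_smul_logZeta hRH hℓ 0 j).re
    have h2 : (fun u : ℝ => u + 1 / 2) ⁻¹' Ioi (1 / 2) = Ioi 0 := by ext; simp
    rw [h2]
    refine Integrable.congr h1 ?_
    filter_upwards [hre] with u hu
    simp only [Complex.real_smul, Complex.re_ofReal_mul, Function.comp, add_sub_cancel_right,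
      smul_eq_mul, hu]
  rw [logZetaIter_eq_iterate, iterate_integral_Ioi k hint, ← setIntegral_Ioi_add, logZetaMoment,
    ← Complex.reCLM_apply, ← ContinuousLinearMap.integral_comp_comm _ (integrableOn_smul_logZeta hRH hℓ k 0)]
  refine integral_congr_ae ?_
  filter_upwards [hre] with u hu
  simp only [add_sub_cancel_right, map_smul, Complex.reCLM_apply, hu]

/-- At height 0 the imaginary part is -π for u < 1/2 and 0 beyond, so only ∫_0^{1/2} u^k/k! remains.
-/
theorem im_logZetaMoment_zero (hRH : RiemannHypothesis) {ℓ : ℂ → ℂ} (hℓ : IsLogZetaReg ℓ) (k : ℕ) :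
    (logZetaMoment ℓ k 0).im = -π * ((1 / 2) ^ (k + 1) / (k + 1)!) := by
  rw [logZetaMoment, ← Complex.imCLM_apply,
    ← ContinuousLinearMap.integral_comp_comm _ (integrableOn_smul_logZeta hRH hℓ k 0)]
  have h : ∀ᵐ u ∂(volume.restrict (Ioi (0 : ℝ))),
      Complex.imCLM ((u ^ k / (k ! : ℝ)) • logZeta ℓ (pt u 0))
        = (Iio (1 / 2)).indicator (fun u => -π * ((u - 0) ^ k / (k ! : ℝ))) u := by
    filter_upwards [ae_restrict_mem measurableSet_Ioi, ae_restrict_of_ae ae_ne_half] with u hu hu'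
    rw [map_smul, Complex.imCLM_apply, im_logZeta_pt_zero hℓ hu hu', smul_eq_mul]
    by_cases h : u ∈ Iio (1 / 2 : ℝ)
    · rw [indicator_of_mem h, indicator_of_mem h, sub_zero]; ring
    · rw [indicator_of_notMem h, indicator_of_notMem h, mul_zero]
  rw [integral_congr_ae h, integral_indicator measurableSet_Iio,
    Measure.restrict_restrict measurableSet_Iio, inter_comm, Ioi_inter_Iio, integral_const_mul,
    integral_sub_pow_div_factorial k (by norm_num), sub_zero]

theorem I_pow_mul_im_even (k : ℕ) (z : ℂ) : (Complex.I ^ (2 * k) * z).im = (-1) ^ k * z.im := by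
  rw [pow_mul, Complex.I_sq]
  have : ((-1 : ℂ) ^ k) = (((-1 : ℝ) ^ k : ℝ) : ℂ) := by push_cast; rfl
  rw [this, Complex.im_ofReal_mul]

theorem I_pow_mul_im_odd (k : ℕ) (z : ℂ) : (Complex.I ^ (2 * k + 1) * z).im = (-1) ^ k * z.re := by
  rw [pow_succ, mul_assoc, I_pow_mul_im_even, Complex.I_mul_im]

/-- The choice of δ makes Littlewood's formula hold with no leftover constant. For even index
i^(k+1) is real and selects the -π of the cut; for odd index it selects log |ζ|. -/
theorem delta_eq (hRH : RiemannHypothesis) {ℓ : ℂ → ℂ} (hℓ : IsLogZetaReg ℓ) (k : ℕ) :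
    π * delta (k + 1) = (Complex.I ^ (k + 1) * logZetaMoment ℓ k 0).im := by
  have hpi := Real.pi_pos.ne'
  rcases Nat.even_or_odd' (k + 1) with ⟨j, hj | hj⟩
  · have hj1 : j = j - 1 + 1 := by omega
    rw [delta, if_pos (by rw [hj]; exact even_two_mul j), hj, I_pow_mul_im_even,
      im_logZetaMoment_zero hRH hℓ, hj, Nat.mul_div_cancel_left _ two_pos]
    have : (-1 : ℝ) ^ j = -(-1) ^ (j - 1) := by
      conv_lhs => rw [hj1]
      rw [pow_succ]; ring
    rw [this, div_pow, one_pow]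
    field_simp
  · have : ¬ Even (k + 1) := by rw [hj, Nat.not_even_iff_odd]; exact odd_two_mul_add_one j
    rw [delta, if_neg this, ← re_logZetaMoment_zero hRH hℓ, hj, I_pow_mul_im_odd,
      show (2 * j + 1) / 2 = j by omega]
    field_simp

/-- Littlewood's formula: `S_{k+1}(t) = (1/π) Im (i^{k+1} ∫_0^∞ u^k / k! log ζ(1/2 + u + i t) du)`. -/
theorem pi_mul_SMoment_succ (hRH : RiemannHypothesis) {ℓ : ℂ → ℂ} (hℓ : IsLogZetaReg ℓ) (k : ℕ) {t : ℝ}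
    (ht : 0 < t) : π * SMoment (k + 1) t = (Complex.I ^ (k + 1) * logZetaMoment ℓ k t).im := by
  induction k generalizing t with
  | zero =>
    rw [SMoment, mul_add, delta_eq hRH hℓ, ← intervalIntegral.integral_const_mul]
    change (∫ τ in (0 : ℝ)..t, π * S τ) + _ = _
    rw [integral_pi_mul_S hRH hℓ ht, ← Complex.add_im]
    congr 1
    ring
  | succ k ih =>
    rw [SMoment, mul_add, delta_eq hRH hℓ, ← intervalIntegral.integral_const_mul]
    have h1 : ∫ τ in (0 : ℝ)..t, π * SMoment (k + 1) τ
        = ∫ τ in (0 : ℝ)..t, Complex.imCLM (Complex.I ^ (k + 1) * logZetaMoment ℓ k τ) := by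
      rw [intervalIntegral.integral_of_le ht.le, intervalIntegral.integral_of_le ht.le]
      exact setIntegral_congr_fun measurableSet_Ioc fun τ hτ => ih hτ.1
    rw [h1, Complex.imCLM.intervalIntegral_comp_comm
      ((intervalIntegrable_logZetaMoment hRH hℓ k ht.le).const_mul _),
      intervalIntegral.integral_const_mul, integral_logZetaMoment hRH hℓ k ht, Complex.imCLM_apply,
      ← Complex.add_im]
    congr 1
    ring

/-! ### From log ζ to ξ'/ξ by integration by parts -/

/-- The difference of the logarithmic derivatives of `ξ` and `ζ`. -/
def archPart (s : ℂ) : ℂ := gammaPart s + 1 / (s - 1)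

theorem logDeriv_zeta_eq {s : ℂ} (hs : 0 < s.re) (h1 : s ≠ 1) (h : riemannZeta s ≠ 0) :
    deriv riemannZeta s / riemannZeta s = xiL s - archPart s := by
  have hne : s - 1 ≠ 0 := sub_ne_zero.mpr h1
  have h0 : s ≠ 0 := by rintro rfl; simp at hs
  have hx : xi s ≠ 0 := by
    rw [xi_eq hs h1]
    exact mul_ne_zero (mul_ne_zero (mul_ne_zero h0 hne) (Complex.Gammaℝ_ne_zero_of_re_pos hs)) h
  have hev : zetaReg =ᶠ[𝓝 s] fun z => (z - 1) * riemannZeta z := by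
    filter_upwards [(isOpen_lt continuous_const Complex.continuous_re).mem_nhds hs,
      isOpen_ne.mem_nhds h1] with z hz hz1 using zetaReg_eq hz hz1
  have hd : HasDerivAt (fun z => (z - 1) * riemannZeta z)
      (1 * riemannZeta s + (s - 1) * deriv riemannZeta s) s :=
    ((hasDerivAt_id s).sub_const 1).mul (differentiableAt_riemannZeta h1).hasDerivAt
  have h2 := deriv_zetaReg_div hs hx
  rw [hev.deriv_eq, hd.deriv, zetaReg_eq hs h1] at h2
  have h3 : (1 * riemannZeta s + (s - 1) * deriv riemannZeta s) / ((s - 1) * riemannZeta s)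
      = 1 / (s - 1) + deriv riemannZeta s / riemannZeta s := by
    field_simp
  rw [h3] at h2
  rw [archPart, gammaPart]
  linear_combination h2

theorem continuous_archPart_pt {t : ℝ} (ht : t ≠ 0) :
    ContinuousOn (fun u => archPart (pt u t)) (Icc 0 1) := by
  intro u hu
  have h1 : pt u t - 1 ≠ 0 := fun e => ht (by simpa using congrArg Complex.im e)
  have hc : ContinuousAt archPart (pt u t) :=
    (continuousAt_gammaPart (by simp; linarith [hu.1])).add
      (continuousAt_const.div (continuousAt_id.sub_const 1) h1)
  exact (ContinuousAt.comp (f := fun u : ℝ => pt u t) hc (by unfold pt; fun_prop)).continuousWithinAt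

theorem exists_archPart_bound : ∃ C, 0 ≤ C ∧ ∀ u ∈ Icc (0 : ℝ) 1, ∀ t, 2 ≤ t →
    |(archPart (pt u t)).re - Real.log t / 2| ≤ C ∧ |(archPart (pt u t)).im| ≤ C := by
  obtain ⟨C, hC⟩ := exists_logDeriv_Gammaℝ_bound
  have hC0 : 0 ≤ C := (abs_nonneg _).trans (hC 1 2 (by norm_num) (by norm_num) le_rfl).2
  refine ⟨C + 1, by linarith, fun u hu t ht => ?_⟩
  obtain ⟨h1, h2⟩ := hC (1 / 2 + u) t (by linarith [hu.1]) (by linarith [hu.2]) ht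
  have hinv : ∀ z : ℂ, z.im = t → ‖1 / z‖ ≤ 1 / 2 := by
    intro z hz
    have := (Complex.abs_im_le_norm z)
    rw [hz, abs_of_pos (by linarith)] at this
    rw [norm_div, norm_one]
    exact one_div_le_one_div_of_le two_pos (by linarith)
  have e1 := hinv (pt u t) (by simp)
  have e2 := hinv (pt u t - 1) (by simp)
  have r1 := abs_le.mp ((Complex.abs_re_le_norm _).trans e1)
  have i1 := abs_le.mp ((Complex.abs_im_le_norm _).trans e1)
  have r2 := abs_le.mp ((Complex.abs_re_le_norm _).trans e2)
  have i2 := abs_le.mp ((Complex.abs_im_le_norm _).trans e2)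
  change |(deriv Complex.Gammaℝ (pt u t) / Complex.Gammaℝ (pt u t)).re - Real.log t / 2| ≤ C at h1
  change |(deriv Complex.Gammaℝ (pt u t) / Complex.Gammaℝ (pt u t)).im| ≤ C at h2
  rw [abs_le] at h1 h2
  simp only [archPart, gammaPart, Complex.add_re, Complex.add_im]
  constructor <;> rw [abs_le] <;> constructor <;> linarith [h1.1, h1.2, h2.1, h2.2, r1.1, r1.2,
    r2.1, r2.2, i1.1, i1.2, i2.1, i2.2]

theorem logDeriv_zeta_pt_eq {ℓ : ℂ → ℂ} (hℓ : IsLogZetaReg ℓ) {u t : ℝ} (ht : t ≠ 0) (hu : 0 < u) :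
    deriv riemannZeta (pt u t) / riemannZeta (pt u t) = xiL (pt u t) - archPart (pt u t) := by
  have h1 : pt u t ≠ 1 := fun e => ht (by simpa using congrArg Complex.im e)
  exact logDeriv_zeta_eq (by simp; linarith) h1 (hℓ.zeta_ne_zero (by simpa using hu) h1)

/-- The weight u^(k+1) cancels the C/u singularity even when t is an ordinate, which is why
ordinates need excluding only for S_0. -/
theorem intervalIntegrable_smul_logDeriv_zeta (hRH : RiemannHypothesis) {ℓ : ℂ → ℂ}
    (hℓ : IsLogZetaReg ℓ) (k : ℕ) {t : ℝ} (ht : t ≠ 0) :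
    IntervalIntegrable (fun u : ℝ => (u ^ (k + 1) / ((k + 1)! : ℝ)) •
      (deriv riemannZeta (pt u t) / riemannZeta (pt u t))) volume 0 1 := by
  obtain ⟨C₁, hC₁, h1⟩ := exists_norm_xiL_le hRH |t|
  obtain ⟨C₂, h2⟩ := isCompact_Icc.exists_bound_of_continuousOn (continuous_archPart_pt ht)
  have hC₂ : 0 ≤ C₂ := (norm_nonneg _).trans (h2 0 (by simp))
  rw [intervalIntegrable_iff_integrableOn_Ioc_of_le zero_le_one]
  refine Integrable.mono' (g := fun _ => C₁ + C₂) (integrable_const _) ?_ ?_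
  · refine ContinuousOn.aestronglyMeasurable (fun u hu => ?_) measurableSet_Ioc
    have hw : ContinuousAt (fun u : ℝ => u ^ (k + 1) / ((k + 1)! : ℝ)) u := by fun_prop
    exact (hw.smul (continuousAt_logDeriv_zeta_pt hℓ ht (Or.inl hu.1))).continuousWithinAt
  · filter_upwards [ae_restrict_mem measurableSet_Ioc] with u hu
    have hu0 := hu.1
    rw [norm_smul, logDeriv_zeta_pt_eq hℓ ht hu0, Real.norm_of_nonneg (by positivity)]
    have h3 := (norm_sub_le (xiL (pt u t)) (archPart (pt u t))).trans
      (add_le_add (h1 u hu0 hu.2 t le_rfl) (h2 u ⟨hu0.le, hu.2⟩))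
    have hfac : (1 : ℝ) ≤ ((k + 1)! : ℝ) := by exact_mod_cast Nat.one_le_iff_ne_zero.mpr (Nat.factorial_ne_zero _)
    have h4 : u ^ (k + 1) / ((k + 1)! : ℝ) ≤ u := by
      refine (div_le_self (by positivity) hfac).trans ?_
      rw [pow_succ]
      exact mul_le_of_le_one_left hu0.le (pow_le_one₀ hu0.le hu.2)
    calc _ ≤ u * (C₁ / u + C₂) := mul_le_mul h4 h3 (norm_nonneg _) hu0.le
      _ = C₁ + u * C₂ := by field_simp
      _ ≤ C₁ + C₂ := by nlinarith [hu.2]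

theorem tendsto_smul_logZeta (hRH : RiemannHypothesis) {ℓ : ℂ → ℂ} (hℓ : IsLogZetaReg ℓ) (k : ℕ)
    {t : ℝ} (ht : t ≠ 0) :
    Tendsto (fun u : ℝ => (u ^ (k + 1) / ((k + 1)! : ℝ)) • logZeta ℓ (pt u t)) (𝓝[>] 0) (𝓝 0) := by
  obtain ⟨C₁, hC₁, h1⟩ := exists_norm_logZetaReg_le hRH hℓ |t|
  have hlc : ContinuousOn (fun u => Complex.log (pt u t - 1)) (Icc 0 1) := fun u _ => by
    have h : ContinuousAt (fun u => pt u t - 1) u := by unfold pt; fun_prop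
    exact (h.clog (slit_of_im_pos (by simpa using ht))).continuousWithinAt
  obtain ⟨C₂, h2⟩ := isCompact_Icc.exists_bound_of_continuousOn hlc
  have hul : Tendsto (fun u : ℝ => C₁ * |Real.log u * u| + (C₁ + C₂) * u) (𝓝[>] 0) (𝓝 0) := by
    have e1 : Tendsto (fun u : ℝ => Real.log u * u) (𝓝[>] 0) (𝓝 0) := by
      simpa using tendsto_log_mul_rpow_nhdsGT_zero one_pos
    have e2 : Tendsto (fun u : ℝ => u) (𝓝[>] 0) (𝓝 0) := tendsto_id.mono_left nhdsWithin_le_nhds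
    simpa using (e1.abs.const_mul C₁).add (e2.const_mul (C₁ + C₂))
  refine squeeze_zero_norm' ?_ hul
  filter_upwards [Ioo_mem_nhdsGT one_pos] with u hu
  have hu0 := hu.1
  have hfac : (1 : ℝ) ≤ ((k + 1)! : ℝ) := by exact_mod_cast Nat.one_le_iff_ne_zero.mpr (Nat.factorial_ne_zero _)
  have h4 : u ^ (k + 1) / ((k + 1)! : ℝ) ≤ u := by
    refine (div_le_self (by positivity) hfac).trans ?_
    rw [pow_succ]
    exact mul_le_of_le_one_left hu0.le (pow_le_one₀ hu0.le hu.2.le)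
  have h5 : ‖logZeta ℓ (pt u t)‖ ≤ C₁ * (1 + |Real.log u|) + C₂ := by
    rw [logZeta, if_pos (by simpa using hu0)]
    exact (norm_sub_le _ _).trans (add_le_add (h1 u hu0 hu.2.le t le_rfl).1 (h2 u ⟨hu0.le, hu.2.le⟩))
  rw [norm_smul, Real.norm_of_nonneg (by positivity), abs_mul, abs_of_pos hu0]
  calc _ ≤ u * (C₁ * (1 + |Real.log u|) + C₂) := mul_le_mul h4 h5 (norm_nonneg _) hu0.le
    _ = _ := by ring

/-- Integration by parts; the boundary term at 0 vanishes because log ζ grows at most like |log u|.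
-/
theorem integral_smul_logZeta_eq (hRH : RiemannHypothesis) {ℓ : ℂ → ℂ} (hℓ : IsLogZetaReg ℓ) (k : ℕ)
    {t : ℝ} (ht : t ≠ 0) :
    ∫ u in (0 : ℝ)..1, (u ^ k / (k ! : ℝ)) • logZeta ℓ (pt u t)
      = ((1 : ℝ) / (k + 1)!) • logZeta ℓ (pt 1 t) - ∫ u in (0 : ℝ)..1, (u ^ (k + 1) / ((k + 1)! : ℝ)) •
        (deriv riemannZeta (pt u t) / riemannZeta (pt u t)) := by
  have hq := intervalIntegrable_smul_logDeriv_zeta hRH hℓ k ht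
  have hL : IntervalIntegrable (fun u : ℝ => (u ^ k / (k ! : ℝ)) • logZeta ℓ (pt u t)) volume 0 1 := by
    rw [intervalIntegrable_iff_integrableOn_Ioc_of_le zero_le_one]
    exact (integrableOn_smul_logZeta hRH hℓ k t).mono_set Ioc_subset_Ioi_self
  have hL' : ∀ u : ℝ, 0 < u → HasDerivAt (fun u => logZeta ℓ (pt u t))
      (deriv riemannZeta (pt u t) / riemannZeta (pt u t)) u := fun u hu =>
    hasDerivAt_comp_pt (hℓ.hasDerivAt_logZeta (by simpa using hu) (slit_of_im_pos (by simpa using ht)))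
  have hd : ∀ u : ℝ, 0 < u → HasDerivAt (fun u : ℝ => (u ^ (k + 1) / ((k + 1)! : ℝ)) • logZeta ℓ (pt u t))
      ((u ^ (k + 1) / ((k + 1)! : ℝ)) • (deriv riemannZeta (pt u t) / riemannZeta (pt u t))
        + (u ^ k / (k ! : ℝ)) • logZeta ℓ (pt u t)) u := by
    intro u hu
    have hp : HasDerivAt (fun u : ℝ => u ^ (k + 1) / ((k + 1)! : ℝ)) (u ^ k / (k ! : ℝ)) u := by
      have := (hasDerivAt_pow (k + 1) u).div_const ((k + 1)! : ℝ)
      convert! this using 1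
      rw [Nat.factorial_succ]
      push_cast
      field_simp
    exact hp.smul (hL' u hu)
  have hend : Tendsto (fun u : ℝ => (u ^ (k + 1) / ((k + 1)! : ℝ)) • logZeta ℓ (pt u t)) (𝓝[<] 1)
      (𝓝 (((1 : ℝ) / (k + 1)!) • logZeta ℓ (pt 1 t))) := by
    have := (hd 1 one_pos).continuousAt.tendsto.mono_left (nhdsWithin_le_nhds (s := Iio 1))
    simpa using this
  have h := intervalIntegral.integral_eq_sub_of_hasDerivAt_of_tendsto zero_lt_one
    (fun u hu => hd u hu.1) (hq.add hL) (tendsto_smul_logZeta hRH hℓ k ht) hend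
  rw [intervalIntegral.integral_add hq hL, sub_zero] at h
  exact eq_sub_of_add_eq' h

/-- Both the boundary term at u = 1 and the tail u > 1 are bounded independently of t by the
exponential decay of log ζ. -/
theorem exists_logZetaMoment_bound (hRH : RiemannHypothesis) {ℓ : ℂ → ℂ} (hℓ : IsLogZetaReg ℓ) (k : ℕ) :
    ∃ C, ∀ t : ℝ, t ≠ 0 → ‖logZetaMoment ℓ k t + ∫ u in (0 : ℝ)..1, (u ^ (k + 1) / ((k + 1)! : ℝ)) •
        (deriv riemannZeta (pt u t) / riemannZeta (pt u t))‖ ≤ C := by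
  obtain ⟨C, hC0, hC⟩ := hℓ.exists_norm_logZeta_le
  have hexp : IntegrableOn (fun u : ℝ => u ^ k / (k ! : ℝ) * (C * Real.exp (-(1 / 2 + u) / 2))) (Ioi 1) := by
    have h3 := integrableOn_rpow_mul_exp_neg_mul_rpow (p := 1) (s := k) (b := 1 / 2)
      (by have : (0 : ℝ) ≤ k := by positivity
          linarith) one_pos (by norm_num)
    have h4 : IntegrableOn (fun u : ℝ => C / (k ! : ℝ) * Real.exp (-(1 / 4)) *
      (u ^ (k : ℝ) * Real.exp (-(1 / 2) * u ^ (1 : ℝ)))) (Ioi 0) := h3.const_mul _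
    refine (h4.congr_fun (fun u hu => ?_) measurableSet_Ioi).mono_set (Ioi_subset_Ioi zero_le_one)
    simp only [Real.rpow_one, Real.rpow_natCast]
    rw [show -(1 / 2 + u) / 2 = -(1 / 4) + -(1 / 2) * u by ring, Real.exp_add]
    ring
  refine ⟨(1 / (k + 1)!) * (C * Real.exp (-(3 / 2) / 2))
    + ∫ u in Ioi (1 : ℝ), u ^ k / (k ! : ℝ) * (C * Real.exp (-(1 / 2 + u) / 2)), fun t ht => ?_⟩
  have hI := integrableOn_smul_logZeta hRH hℓ k t
  have hI1 := hI.mono_set (Ioi_subset_Ioi zero_le_one)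
  rw [logZetaMoment, ← intervalIntegral.integral_interval_add_Ioi hI hI1,
    integral_smul_logZeta_eq hRH hℓ k ht]
  rw [show ∀ a b c : ℂ, a - b + c + b = a + c by intros; ring]
  refine (norm_add_le _ _).trans (add_le_add ?_ ?_)
  · rw [norm_smul, Real.norm_of_nonneg (by positivity)]
    refine mul_le_mul_of_nonneg_left ((hC _ (by simp; norm_num)).trans (le_of_eq ?_)) (by positivity)
    simp only [pt_re]
    norm_num
  · refine norm_integral_le_of_norm_le hexp ?_
    filter_upwards [ae_restrict_mem measurableSet_Ioi] with u hu
    have hu1 : 1 < u := hu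
    rw [norm_smul, Real.norm_of_nonneg (by positivity)]
    refine mul_le_mul_of_nonneg_left ((hC _ (by simp; linarith)).trans (le_of_eq ?_)) (by positivity)
    simp only [pt_re]

theorem exists_SMoment_bound (hRH : RiemannHypothesis) {ℓ : ℂ → ℂ} (hℓ : IsLogZetaReg ℓ) (n : ℕ) :
    ∃ C, ∀ t : ℝ, 0 < t → (n = 0 → ¬ IsZetaOrdinate t) →
      IntervalIntegrable (fun u : ℝ => (u ^ n / (n ! : ℝ)) •
        (deriv riemannZeta (pt u t) / riemannZeta (pt u t))) volume 0 1 ∧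
      |π * SMoment n t + (Complex.I ^ n * ∫ u in (0 : ℝ)..1, (u ^ n / (n ! : ℝ)) •
        (deriv riemannZeta (pt u t) / riemannZeta (pt u t))).im| ≤ C := by
  rcases n with _ | k
  · obtain ⟨C, hC0, hC⟩ := hℓ.exists_norm_logZeta_le
    refine ⟨C * Real.exp (-(3 / 2) / 2), fun t ht hn => ⟨?_, ?_⟩⟩
    · simp only [pow_zero, Nat.factorial_zero, Nat.cast_one, div_one, one_smul]
      refine ContinuousOn.intervalIntegrable fun u hu => ?_
      rw [uIcc_of_le zero_le_one] at hu
      exact (continuousAt_logDeriv_zeta_pt hℓ ht.ne' (Or.inr ⟨hu.1, hn rfl⟩)).continuousWithinAt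
    · simp only [pow_zero, Nat.factorial_zero, Nat.cast_one, div_one, one_smul, one_mul]
      rw [SMoment, (pi_mul_S_eq hℓ ht.ne' (hn rfl)).1, Complex.sub_im, sub_add_cancel]
      refine (Complex.abs_im_le_norm _).trans ((hC _ (by simp; norm_num)).trans (le_of_eq ?_))
      simp only [pt_re]
      norm_num
  · obtain ⟨C, hC⟩ := exists_logZetaMoment_bound hRH hℓ k
    refine ⟨C, fun t ht _ => ⟨intervalIntegrable_smul_logDeriv_zeta hRH hℓ k ht.ne', ?_⟩⟩
    rw [pi_mul_SMoment_succ hRH hℓ k ht, ← Complex.add_im, ← mul_add]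
    refine (Complex.abs_im_le_norm _).trans ?_
    rw [norm_mul, norm_pow, Complex.norm_I, one_pow, one_mul]
    exact hC t ht.ne'

theorem integral_pow_div_factorial (n : ℕ) :
    ∫ u in (0 : ℝ)..1, u ^ n / (n ! : ℝ) = 1 / ((n + 1)! : ℝ) := by
  rw [intervalIntegral.integral_div, integral_pow, Nat.factorial_succ]
  push_cast
  rw [one_pow, zero_pow (Nat.succ_ne_zero n)]
  field_simp
  ring

theorem abs_integral_weight_mul_le {n : ℕ} {C : ℝ} {f : ℝ → ℝ}
    (hf : ∀ u ∈ Ioc (0 : ℝ) 1, |f u| ≤ C) :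
    |∫ u in (0 : ℝ)..1, u ^ n / (n ! : ℝ) * f u| ≤ C := by
  have hfac : (1 : ℝ) ≤ (n ! : ℝ) := by exact_mod_cast Nat.one_le_iff_ne_zero.mpr (Nat.factorial_ne_zero _)
  have := intervalIntegral.norm_integral_le_of_norm_le_const (a := 0) (b := 1)
    (f := fun u : ℝ => u ^ n / (n ! : ℝ) * f u) (C := C) fun u hu => by
      rw [uIoc_of_le zero_le_one] at hu
      have h1 : u ^ n / (n ! : ℝ) ≤ 1 :=
        (div_le_one₀ (by positivity)).mpr ((pow_le_one₀ hu.1.le hu.2).trans hfac)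
      have h2 : 0 ≤ u ^ n / (n ! : ℝ) := div_nonneg (pow_nonneg hu.1.le _) (by positivity)
      rw [norm_mul, Real.norm_of_nonneg h2, Real.norm_eq_abs]
      calc _ ≤ 1 * C := mul_le_mul h1 (hf u hu) (abs_nonneg _) zero_le_one
        _ = C := one_mul C
  simpa using this

/-- At abscissa 3/2 the Dirichlet series bounds ζ'/ζ and the archimedean part has bounded imaginary
part, so the subtracted value in the even case is harmless. -/
theorem exists_im_xiL_le {ℓ : ℂ → ℂ} (hℓ : IsLogZetaReg ℓ) :
    ∃ C, 0 ≤ C ∧ ∀ t : ℝ, 2 ≤ t → |(xiL (pt 1 t)).im| ≤ C := by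
  obtain ⟨C₁, hC₁, h1⟩ := exists_norm_logDeriv_zeta_le
  obtain ⟨C₂, hC₂, h2⟩ := exists_archPart_bound
  refine ⟨C₁ + C₂, by positivity, fun t ht => ?_⟩
  have e := logDeriv_zeta_pt_eq hℓ (t := t) (by linarith) one_pos
  have h3 := h1 (pt 1 t) (by simp; norm_num)
  have h4 : C₁ * Real.exp (-(pt 1 t).re / 2) ≤ C₁ := by
    refine mul_le_of_le_one_right hC₁ (Real.exp_le_one_iff.mpr ?_)
    simp only [pt_re]
    norm_num
  have h5 := abs_le.mp ((Complex.abs_im_le_norm _).trans (h3.trans h4))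
  have h6 := abs_le.mp (h2 1 (by simp) t ht).2
  rw [e, Complex.sub_im] at h5
  rw [abs_le]
  constructor <;> linarith [h5.1, h5.2, h6.1, h6.2]

theorem abs_sub_add_le {a b c C D : ℝ} (h1 : |a + b| ≤ C) (h2 : |b - c| ≤ D) : |a + c| ≤ C + D := by
  rw [abs_le] at *
  constructor <;> linarith [h1.1, h1.2, h2.1, h2.2]

/-! ### The representation of S_{2m} and S_{2m+1} -/

theorem exists_SMoment_even_bound (hRH : RiemannHypothesis) (m : ℕ) :
    ∃ C, ∀ t : ℝ, 2 ≤ t → (m = 0 → ¬ IsZetaOrdinate t) →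
      |SMoment (2 * m) t - (-1) ^ m / (π * (2 * m)!) * ∑' ρ, zeroTerm (fEven m) t ρ| ≤ C := by
  obtain ⟨ℓ, hℓ⟩ := exists_isLogZetaReg hRH
  obtain ⟨C₁, h1⟩ := exists_SMoment_bound hRH hℓ (2 * m)
  obtain ⟨C₂, hC₂, h2⟩ := exists_archPart_bound
  obtain ⟨C₃, hC₃, h3⟩ := exists_im_xiL_le hℓ
  refine ⟨(C₁ + (C₂ + C₃)) / π, fun t ht hm => ?_⟩
  have hpi := Real.pi_pos
  obtain ⟨hi, hb⟩ := h1 t (by linarith) (fun h => hm (by omega))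
  have ht0 : t ≠ 0 := by linarith
  set w : ℝ → ℝ := fun u => u ^ (2 * m) / ((2 * m)! : ℝ) with hw
  set q : ℝ → ℂ := fun u => deriv riemannZeta (pt u t) / riemannZeta (pt u t) with hq
  have him : (∫ u in (0 : ℝ)..1, w u • q u).im = ∫ u in (0 : ℝ)..1, w u * (q u).im := by
    rw [← Complex.imCLM_apply, ← Complex.imCLM.intervalIntegral_comp_comm hi]
    simp only [Complex.imCLM_apply, Complex.smul_im, smul_eq_mul]
    rfl
  rw [I_pow_mul_im_even, him] at hb
  have hqi : IntervalIntegrable (fun u => w u * (q u).im) volume 0 1 := by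
    have := Complex.imCLM.integrable_comp hi.1
    rw [intervalIntegrable_iff_integrableOn_Ioc_of_le zero_le_one]
    refine this.congr (Eventually.of_forall fun u => ?_)
    simp only [Complex.imCLM_apply, Complex.smul_im, smul_eq_mul]
    rfl
  have hri : IntervalIntegrable (fun u => w u * ((xiL (pt 1 t)).im - (archPart (pt u t)).im)) volume 0 1 := by
    refine ContinuousOn.intervalIntegrable ?_
    rw [uIcc_of_le zero_le_one]
    exact ContinuousOn.mul (by fun_prop) (continuousOn_const.sub
      (Complex.continuous_im.comp_continuousOn (continuous_archPart_pt ht0)))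
  -- The imaginary part of ζ'/ζ splits into the difference of ξ'/ξ between u and 1, which produces
  -- the sum over zeros, and a bounded remainder.
  have hdiff : (∫ u in (0 : ℝ)..1, w u * (q u).im)
      - ∫ u in (0 : ℝ)..1, w u * ((xiL (pt 1 t)).im - (archPart (pt u t)).im)
      = 1 / ((2 * m)! : ℝ) * ∫ u in (0 : ℝ)..1, u ^ (2 * m) * ((xiL (pt u t)).im - (xiL (pt 1 t)).im) := by
    rw [← intervalIntegral.integral_sub hqi hri, ← intervalIntegral.integral_const_mul,
      intervalIntegral.integral_of_le zero_le_one, intervalIntegral.integral_of_le zero_le_one]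
    refine setIntegral_congr_fun measurableSet_Ioc fun u hu => ?_
    simp only [hw, hq]
    rw [logDeriv_zeta_pt_eq hℓ ht0 hu.1, Complex.sub_im]
    ring
  have hsum := (hasSum_fEven hRH m t).tsum_eq
  have hsum' : ∫ u in (0 : ℝ)..1, u ^ (2 * m) * ((xiL (pt u t)).im - (xiL (pt 1 t)).im)
      = -∑' ρ, zeroTerm (fEven m) t ρ := by rw [hsum, neg_neg]
  rw [hsum'] at hdiff
  have hrb : |∫ u in (0 : ℝ)..1, w u * ((xiL (pt 1 t)).im - (archPart (pt u t)).im)| ≤ C₂ + C₃ := by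
    refine abs_integral_weight_mul_le fun u hu => (abs_sub _ _).trans ?_
    linarith [h3 t ht, (h2 u ⟨hu.1.le, hu.2⟩ t ht).2]
  rw [le_div_iff₀ hpi, ← abs_of_pos hpi, ← abs_mul, abs_of_pos hpi]
  have e : (SMoment (2 * m) t - (-1) ^ m / (π * (2 * m)!) * ∑' ρ, zeroTerm (fEven m) t ρ) * π
      = π * SMoment (2 * m) t + (-1) ^ m * (1 / ((2 * m)! : ℝ) * -∑' ρ, zeroTerm (fEven m) t ρ) := by
    field_simp
    ring
  rw [e]
  refine abs_sub_add_le hb ?_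
  rw [← hdiff, ← mul_sub, sub_sub_cancel, abs_mul, abs_neg_one_pow, one_mul]
  exact hrb

theorem exists_SMoment_odd_bound (hRH : RiemannHypothesis) (m : ℕ) :
    ∃ C, ∀ t : ℝ, 2 ≤ t →
      |SMoment (2 * m + 1) t - ((-1) ^ m / (2 * π * (2 * m + 2)!) * Real.log t
          - (-1) ^ m / (π * (2 * m)!) * ∑' ρ, zeroTerm (fOdd m) t ρ)| ≤ C := by
  obtain ⟨ℓ, hℓ⟩ := exists_isLogZetaReg hRH
  obtain ⟨C₁, h1⟩ := exists_SMoment_bound hRH hℓ (2 * m + 1)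
  obtain ⟨C₂, hC₂, h2⟩ := exists_archPart_bound
  refine ⟨(C₁ + C₂) / π, fun t ht => ?_⟩
  have hpi := Real.pi_pos
  obtain ⟨hi, hb⟩ := h1 t (by linarith) (fun h => by omega)
  have ht0 : t ≠ 0 := by linarith
  set w : ℝ → ℝ := fun u => u ^ (2 * m + 1) / ((2 * m + 1)! : ℝ) with hw
  set q : ℝ → ℂ := fun u => deriv riemannZeta (pt u t) / riemannZeta (pt u t) with hq
  have hre : (∫ u in (0 : ℝ)..1, w u • q u).re = ∫ u in (0 : ℝ)..1, w u * (q u).re := by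
    rw [← Complex.reCLM_apply, ← Complex.reCLM.intervalIntegral_comp_comm hi]
    simp only [Complex.reCLM_apply, Complex.smul_re, smul_eq_mul]
    rfl
  rw [I_pow_mul_im_odd, hre] at hb
  have hqi : IntervalIntegrable (fun u => w u * (q u).re) volume 0 1 := by
    have := Complex.reCLM.integrable_comp hi.1
    rw [intervalIntegrable_iff_integrableOn_Ioc_of_le zero_le_one]
    refine this.congr (Eventually.of_forall fun u => ?_)
    simp only [Complex.reCLM_apply, Complex.smul_re, smul_eq_mul]
    rfl
  have hri : IntervalIntegrable (fun u => w u * (Real.log t / 2 - (archPart (pt u t)).re)) volume 0 1 := by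
    refine ContinuousOn.intervalIntegrable ?_
    rw [uIcc_of_le zero_le_one]
    exact ContinuousOn.mul (by fun_prop) (continuousOn_const.sub
      (Complex.continuous_re.comp_continuousOn (continuous_archPart_pt ht0)))
  have hli : IntervalIntegrable (fun u => w u * (Real.log t / 2)) volume 0 1 :=
    (by fun_prop : Continuous fun u => w u * (Real.log t / 2)).intervalIntegrable _ _
  -- The archimedean part is centred at (log t)/2: the centred integral is O(1), and the constant
  -- integrates to the main term through ∫_0^1 u^(2m+1)/(2m+1)! du = 1/(2m+2)!.
  have hdiff : (∫ u in (0 : ℝ)..1, w u * (q u).re)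
      - (∫ u in (0 : ℝ)..1, w u * (Real.log t / 2 - (archPart (pt u t)).re))
      + ∫ u in (0 : ℝ)..1, w u * (Real.log t / 2)
      = 1 / ((2 * m + 1)! : ℝ) * ∫ u in (0 : ℝ)..1, u ^ (2 * m + 1) * (xiL (pt u t)).re := by
    rw [← intervalIntegral.integral_sub hqi hri, ← intervalIntegral.integral_add (hqi.sub hri) hli,
      ← intervalIntegral.integral_const_mul,
      intervalIntegral.integral_of_le zero_le_one, intervalIntegral.integral_of_le zero_le_one]
    refine setIntegral_congr_fun measurableSet_Ioc fun u hu => ?_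
    simp only [hw, hq]
    rw [logDeriv_zeta_pt_eq hℓ ht0 hu.1, Complex.sub_re]
    ring
  have hsum : ∫ u in (0 : ℝ)..1, u ^ (2 * m + 1) * (xiL (pt u t)).re
      = (2 * m + 1) * ∑' ρ, zeroTerm (fOdd m) t ρ := by
    rw [← (hasSum_fOdd hRH m t).tsum_eq, tsum_mul_left]
  rw [hsum, intervalIntegral.integral_mul_const, integral_pow_div_factorial] at hdiff
  have hrb : |∫ u in (0 : ℝ)..1, w u * (Real.log t / 2 - (archPart (pt u t)).re)| ≤ C₂ := by
    refine abs_integral_weight_mul_le fun u hu => ?_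
    rw [abs_sub_comm]
    exact (h2 u ⟨hu.1.le, hu.2⟩ t ht).1
  rw [le_div_iff₀ hpi, ← abs_of_pos hpi, ← abs_mul, abs_of_pos hpi]
  have e : (SMoment (2 * m + 1) t - ((-1) ^ m / (2 * π * (2 * m + 2)!) * Real.log t
        - (-1) ^ m / (π * (2 * m)!) * ∑' ρ, zeroTerm (fOdd m) t ρ)) * π
      = π * SMoment (2 * m + 1) t + (-1) ^ m * (1 / ((2 * m + 1)! : ℝ) *
          ((2 * m + 1) * ∑' ρ, zeroTerm (fOdd m) t ρ) - 1 / ((2 * m + 1 + 1)! : ℝ) * (Real.log t / 2)) := by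
    have hf : ((2 * m + 1)! : ℝ) = (2 * m + 1) * ((2 * m)! : ℝ) := by
      rw [Nat.factorial_succ]; push_cast; ring
    rw [hf]
    have : ((2 * m)! : ℝ) ≠ 0 := by positivity
    have : (2 * (m : ℝ) + 1) ≠ 0 := by positivity
    field_simp
    ring
  rw [e, ← hdiff, add_sub_cancel_right]
  refine abs_sub_add_le hb ?_
  rw [← mul_sub, sub_sub_cancel, abs_mul, abs_neg_one_pow, one_mul]
  exact hrb

theorem summable_fOdd (hRH : RiemannHypothesis) (m : ℕ) (t : ℝ) : Summable (zeroTerm (fOdd m) t) := by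
  have h : (2 * (m : ℝ) + 1) ≠ 0 := by positivity
  exact (summable_mul_left_iff h).mp (hasSum_fOdd hRH m t).summable

end ZetaMoments

end
theorem mainTheorem3 (hRH : RiemannHypothesis) (m : ℕ) :
    (∃ C : ℝ, ∀ t : ℝ, 2 ≤ t → (m = 0 → ¬ ZetaMoments.IsZetaOrdinate t) →
      Summable (ZetaMoments.zeroTerm (ZetaMoments.fEven m) t) ∧
      |ZetaMoments.SMoment (2 * m) t
        - (-1) ^ m / (π * (2 * m)!) * ∑' ρ, ZetaMoments.zeroTerm (ZetaMoments.fEven m) t ρ| ≤ C) ∧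
    (∃ C : ℝ, ∀ t : ℝ, 2 ≤ t →
      Summable (ZetaMoments.zeroTerm (ZetaMoments.fOdd m) t) ∧
      |ZetaMoments.SMoment (2 * m + 1) t
        - ((-1) ^ m / (2 * π * (2 * m + 2)!) * Real.log t
          - (-1) ^ m / (π * (2 * m)!) *
              ∑' ρ, ZetaMoments.zeroTerm (ZetaMoments.fOdd m) t ρ)| ≤ C) := by
  obtain ⟨C₁, h1⟩ := ZetaMoments.exists_SMoment_even_bound hRH m
  obtain ⟨C₂, h2⟩ := ZetaMoments.exists_SMoment_odd_bound hRH m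
  exact ⟨⟨C₁, fun t ht hm => ⟨(ZetaMoments.hasSum_fEven hRH m t).summable, h1 t ht hm⟩⟩,
    ⟨C₂, fun t ht => ⟨ZetaMoments.summable_fOdd hRH m t, h2 t ht⟩⟩⟩
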